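/- Let $\Sigma$ be a closed (compact, without boundary) smooth 3-manifold carrying the data induced on a spacelike hypersurface of a spacetime of signature $(+,-,-,-)$ with future pointing unit normal $t^a$: the smooth negative definite metric $h_{ab}$, the smooth symmetric extrinsic curvature $\chi_{ab}$ (the tangential projection of $\nabla_a t_b$), and a spin structure. Let $\mathbb S^A$ be the bundle of unprimed two-component spinors over $\Sigma$ (with symplectic form $\varepsilon_{AB}$, complex conjugate bundle $\bar{\mathbb S}^{A'}$, and Hermitian elements of $\mathbb S^A\otimes\bar{\mathbb S}^{A'}$ identified with $T\Sigma\oplus\mathbb R t$). Let $\mathcal D_a$ be the Sen connection, i.e. the tangential projection of the spacetime Levi-Civita connection: on the Lorentzian bundle $T\Sigma\oplus\mathbb R t$ it is $\mathcal D_XY=D_XY-\chi(X,Y)\,t$, $\mathcal D_Xt^a=X^b\chi_b{}^a$, with $D$ the Levi-Civita connection of $h_{ab}$, and on spinors it is the induced connection that annihilates $\varepsilon_{AB}$. Write $\mathcal D_{AA'}$ for its spinor form. All spinor fields are smooth. Call $c\in\mathbb C$ an eigenvalue of the squared Sen–Witten operator $\lambda^A\mapsto 2\mathcal D^{AA'}\mathcal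 D_{A'B}\lambda^B$ if $2\mathcal D^{AA'}\mathcal D_{A'B}\lambda^B=c\,\lambda^A$ for some spinor field $\lambda^A\neq0$ (an eigenspinor); its multiplicity is the complex dimension of the space of solutions $\lambda^A$. Then: 1. If $\alpha\in\mathbb C$ and $(\lambda^A,\bar\mu^{A'})\neq 0$ satisfy $\mathrm i\mathcal D_{A'A}\lambda^A=\frac{\alpha}{\sqrt2}\bar\mu_{A'}$ and $\mathrm i\mathcal D_{AA'}\bar\mu^{A'}=\frac{\alpha}{\sqrt2}\lambda_A$ (the eigenvalue problem of the Sen–Witten operator on Dirac spinors), then $\alpha$ is real and $2\mathcal D^{AA'}\mathcal D_{A'B}\lambda^B=\alpha^2\lambda^A$. 2. Every eigenvalue of $2\mathcal D^{AA'}\mathcal D_{A'B}$ is real and nonnegative, i.e. of the form $\alpha^2$ with $\alpha\in\mathbb R$. 3. If $\alpha\in\mathbb R\setminus\{0\}$ and $\lambda^A$ is an eigenspinor with eigenvalue $\alpha^2$, then $\mu^A:=-\mathrm i\frac{\sqrt2}{\alpha}\mathcal D^A{}_{A'}\bar\lambda^{A'}$ is also an eigenspinor with eigenvalue $\alpha^2$,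 it is linearly independent of $\lambda^A$ over $\mathbb C$, and $(\lambda^A,\bar\mu^{A'})$ solves the equations in 1 with this $\alpha$. 4. Every nonzero eigenvalue of $2\mathcal D^{AA'}\mathcal D_{A'B}$ has finite, even multiplicity. -/

import Mathlib

open scoped Manifold ContDiff Matrix ComplexConjugate

noncomputable section

namespace SenWitten

/-- The model space of a smooth 3-manifold without boundary. -/
abbrev E3 := EuclideanSpace ℝ (Fin 3)

/-! ### Two-component spinor algebra -/

/-- The symplectic form `ε^{AB}` (numerically also `ε_{AB}`, `ε^{A'B'}` and `ε_{A'B'}`). -/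
def eps : Matrix (Fin 2) (Fin 2) ℂ := !![0, 1; -1, 0]

/-- `ξ^A = ε^{AB} ξ_B`. -/
def raise (v : Fin 2 → ℂ) : Fin 2 → ℂ := eps *ᵥ v

/-- `ξ_B = ξ^A ε_{AB}`. -/
def lower (v : Fin 2 → ℂ) : Fin 2 → ℂ := epsᵀ *ᵥ v

/-- Complex conjugation `λ^A ↦ \bar λ^{A'}` (componentwise). -/
def bar (v : Fin 2 → ℂ) : Fin 2 → ℂ := fun A => conj (v A)

/-- The identity and the Pauli matrices, in the Penrose–Rindler convention. -/
def pauli : Fin 4 → Matrix (Fin 2) (Fin 2) ℂ :=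
  ![!![1, 0; 0, 1], !![0, 1; 1, 0], !![0, Complex.I; -Complex.I, 0], !![1, 0; 0, -1]]

/-- The diagonal of the Minkowski metric of signature `(+,-,-,-)`. -/
def eta : Fin 4 → ℂ := ![1, -1, -1, -1]

/-- The Infeld–van der Waerden symbols `σ_a^{AA'}`. -/
def sigmaUp (a : Fin 4) : Matrix (Fin 2) (Fin 2) ℂ := ((1 / √2 : ℝ) : ℂ) • pauli a

/-- The symbols `σ^a_{AA'} = η^{ab} σ_b^{BB'} ε_{BA} ε_{B'A'}`. -/
def sigmaDown (a : Fin 4) : Matrix (Fin 2) (Fin 2) ℂ := eta a • (epsᵀ * sigmaUp a * eps)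

/-! ### Initial data sets and spin structures -/

section

variable (M : Type*) [TopologicalSpace M] [ChartedSpace E3 M] [IsManifold 𝓘(ℝ, E3) ∞ M]

/-- The data induced on a spacelike hypersurface of a spacetime of signature `(+,-,-,-)` with
future pointing unit normal `t^a`. -/
structure InitialData where
  /-- The positive definite metric `-h_{ab}`, where `h_{ab}` is the induced negative definite
  metric. -/
  metric : Bundle.ContMDiffRiemannianMetric 𝓘(ℝ, E3) ∞ E3
    (fun x : M => TangentSpace 𝓘(ℝ, E3) x)
  /-- The extrinsic curvature `χ_{ab}`, the tangential projection of `∇_a t_b`. -/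
  chi (x : M) : TangentSpace 𝓘(ℝ, E3) x →L[ℝ] TangentSpace 𝓘(ℝ, E3) x →L[ℝ] ℝ
  chi_symm (x : M) (v w : TangentSpace 𝓘(ℝ, E3) x) : chi x v w = chi x w v
  chi_contMDiff : ContMDiff 𝓘(ℝ, E3) (𝓘(ℝ, E3).prod 𝓘(ℝ, E3 →L[ℝ] E3 →L[ℝ] ℝ)) ∞
    (fun x => Bundle.TotalSpace.mk' (E3 →L[ℝ] E3 →L[ℝ] ℝ)
      (E := fun x : M => TangentSpace 𝓘(ℝ, E3) x →L[ℝ] TangentSpace 𝓘(ℝ, E3) x →L[ℝ] ℝ)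
      x (chi x))

variable {M}

/-- A spin structure, given by local gauges: an open cover with smooth orthonormal frames
`E_1, E_2, E_3` (completed by `E_0 = t` to a Lorentzian orthonormal frame), and an
`SU(2)`-valued cocycle of transition functions that covers the change of frame under the double
covering `SU(2) → SO(3)`. -/
structure SpinStructure (D : InitialData M) (ι : Type*) where
  U : ι → Set M
  isOpen_U (i : ι) : IsOpen (U i)
  cover (x : M) : ∃ i, x ∈ U i
  frame (i : ι) (a : Fin 3) (x : M) : TangentSpace 𝓘(ℝ, E3) x
  frame_contMDiffOn (i : ι) (a : Fin 3) :
    ContMDiffOn 𝓘(ℝ, E3) 𝓘(ℝ, E3).tangent ∞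
      (fun x => (⟨x, frame i a x⟩ : TangentBundle 𝓘(ℝ, E3) M)) (U i)
  frame_orthonormal (i : ι) (x : M) (hx : x ∈ U i) (a b : Fin 3) :
    D.metric.inner x (frame i a x) (frame i b x) = if a = b then 1 else 0
  g : ι → ι → M → Matrix (Fin 2) (Fin 2) ℂ
  g_contMDiffOn (i j : ι) (A B : Fin 2) :
    ContMDiffOn 𝓘(ℝ, E3) 𝓘(ℝ, ℂ) ∞ (fun x => g i j x A B) (U i ∩ U j)
  g_mem (i j : ι) (x : M) (hx : x ∈ U i ∩ U j) :
    g i j x ∈ Matrix.specialUnitaryGroup (Fin 2) ℂ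
  g_cocycle (i j k : ι) (x : M) (hx : x ∈ U i ∩ U j ∩ U k) :
    g i j x * g j k x = g i k x
  g_covers (i j : ι) (x : M) (hx : x ∈ U i ∩ U j) (a : Fin 3) :
    g i j x * pauli a.succ * (g i j x)ᴴ =
      ∑ b : Fin 3, (D.metric.inner x (frame i b x) (frame j a x) : ℂ) • pauli b.succ

/-! ### The Sen connection in a local gauge -/

/-- The Levi-Civita coefficients `⟨D_{E_i} E_j, E_k⟩` of an orthonormal frame with respect to
`-h`, by Koszul's formula (the derivatives of the scalar products vanish for such a frame). -/
def leviCivita (D : InitialData M) (e : Fin 3 → (x : M) → TangentSpace 𝓘(ℝ, E3) x)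
    (i j k : Fin 3) (x : M) : ℝ :=
  (1 / 2) * (D.metric.inner x (VectorField.mlieBracket 𝓘(ℝ, E3) (e i) (e j) x) (e k x)
    - D.metric.inner x (VectorField.mlieBracket 𝓘(ℝ, E3) (e j) (e k) x) (e i x)
    + D.metric.inner x (VectorField.mlieBracket 𝓘(ℝ, E3) (e k) (e i) x) (e j x))

/-- The coefficients `Γ_i{}^a{}_b` of the Sen connection, the tangential part of the spacetime
Levi-Civita connection: `𝒟_{E_i} E_b = ∑_a Γ_i{}^a{}_b E_a` in the Lorentzian frame `E_0 = t`,
`E_1, E_2, E_3`. Here `𝒟_X t = χ_X{}^a` and `𝒟_X Y = D_X Y - χ(X, Y) t`; the spatial index of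
`χ` is raised by the negative definite metric. -/
def senCoeff (D : InitialData M) (e : Fin 3 → (x : M) → TangentSpace 𝓘(ℝ, E3) x)
    (i : Fin 3) (x : M) (a b : Fin 4) : ℝ :=
  Fin.cases (motive := fun _ => ℝ)
    (Fin.cases (motive := fun _ => ℝ) 0 (fun k => - D.chi x (e i x) (e k x)) b)
    (fun j => Fin.cases (motive := fun _ => ℝ) (- D.chi x (e i x) (e j x))
      (fun k => leviCivita D e i k j x) b) a

/-- The spinor form `γ_i{}^A{}_C = ½ Γ_i{}^a{}_b σ_a^{AA'} σ^b_{CA'}` of the Sen connection. -/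
def spinCoeff (D : InitialData M) (e : Fin 3 → (x : M) → TangentSpace 𝓘(ℝ, E3) x)
    (i : Fin 3) (x : M) : Matrix (Fin 2) (Fin 2) ℂ :=
  (1 / 2 : ℂ) • ∑ a : Fin 4, ∑ b : Fin 4,
    (senCoeff D e i x a b : ℂ) • (sigmaUp a * (sigmaDown b)ᵀ)

/-- The derivative of the components of a spinor field along `E_i`. -/
def partialFrame (e : Fin 3 → (x : M) → TangentSpace 𝓘(ℝ, E3) x) (i : Fin 3)
    (f : M → Fin 2 → ℂ) (x : M) : Fin 2 → ℂ :=
  mfderiv 𝓘(ℝ, E3) 𝓘(ℝ, Fin 2 → ℂ) f x (e i x)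

/-- `𝒟_{E_i} λ^A`. -/
def senUp (D : InitialData M) (e : Fin 3 → (x : M) → TangentSpace 𝓘(ℝ, E3) x) (i : Fin 3)
    (f : M → Fin 2 → ℂ) (x : M) : Fin 2 → ℂ :=
  partialFrame e i f x + spinCoeff D e i x *ᵥ f x

/-- `𝒟_{E_i} ξ^{A'}`. -/
def senUpPrimed (D : InitialData M) (e : Fin 3 → (x : M) → TangentSpace 𝓘(ℝ, E3) x)
    (i : Fin 3) (f : M → Fin 2 → ℂ) (x : M) : Fin 2 → ℂ :=
  partialFrame e i f x + (spinCoeff D e i x).map (starRingEnd ℂ) *ᵥ f x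

/-- `𝒟_{E_i} π_{A'}`. -/
def senDownPrimed (D : InitialData M) (e : Fin 3 → (x : M) → TangentSpace 𝓘(ℝ, E3) x)
    (i : Fin 3) (f : M → Fin 2 → ℂ) (x : M) : Fin 2 → ℂ :=
  partialFrame e i f x - (spinCoeff D e i x)ᴴ *ᵥ f x

/-! ### Sen–Witten operators in a local gauge; `𝒟_{AA'} = σ^i_{AA'} 𝒟_{E_i}` -/

/-- `λ^A ↦ 𝒟_{A'A} λ^A`. -/
def wittenUp (D : InitialData M) (e : Fin 3 → (x : M) → TangentSpace 𝓘(ℝ, E3) x)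
    (f : M → Fin 2 → ℂ) (x : M) : Fin 2 → ℂ :=
  ∑ i : Fin 3, (sigmaDown i.succ)ᵀ *ᵥ senUp D e i f x

/-- `ξ^{A'} ↦ 𝒟_{AA'} ξ^{A'}`. -/
def wittenUpPrimed (D : InitialData M) (e : Fin 3 → (x : M) → TangentSpace 𝓘(ℝ, E3) x)
    (f : M → Fin 2 → ℂ) (x : M) : Fin 2 → ℂ :=
  ∑ i : Fin 3, sigmaDown i.succ *ᵥ senUpPrimed D e i f x

/-- `π_{A'} ↦ 𝒟^{AA'} π_{A'}`, where `𝒟^{AA'} = ε^{AB} ε^{A'B'} 𝒟_{BB'}`. -/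
def wittenDownPrimed (D : InitialData M) (e : Fin 3 → (x : M) → TangentSpace 𝓘(ℝ, E3) x)
    (f : M → Fin 2 → ℂ) (x : M) : Fin 2 → ℂ :=
  ∑ i : Fin 3, (eps * sigmaDown i.succ * epsᵀ) *ᵥ senDownPrimed D e i f x

/-- The squared Sen–Witten operator `λ^A ↦ 2 𝒟^{AA'} 𝒟_{A'B} λ^B`. -/
def wittenSq (D : InitialData M) (e : Fin 3 → (x : M) → TangentSpace 𝓘(ℝ, E3) x)
    (f : M → Fin 2 → ℂ) (x : M) : Fin 2 → ℂ :=
  (2 : ℂ) • wittenDownPrimed D e (wittenUp D e f) x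

/-! ### Spinor fields and the eigenvalue problem -/

variable {D : InitialData M} {ι : Type*}

/-- The space of smooth unprimed spinor fields `λ^A`: families of smooth local components
related by the transition functions. The components in a gauge are only meaningful on its domain;
they are set to zero elsewhere, so that equal fields are equal families. -/
def SpinorField (S : SpinStructure D ι) : Submodule ℂ (ι → M → Fin 2 → ℂ) where
  carrier := {f | (∀ i, ContMDiffOn 𝓘(ℝ, E3) 𝓘(ℝ, Fin 2 → ℂ) ∞ (f i) (S.U i)) ∧
    (∀ i j, ∀ x ∈ S.U i ∩ S.U j, f i x = S.g i j x *ᵥ f j x) ∧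
    (∀ i, ∀ x ∉ S.U i, f i x = 0)}
  zero_mem' := by
    refine ⟨fun i => contMDiffOn_const, fun i j x _ => ?_, fun i x _ => rfl⟩
    simp
  add_mem' := by
    rintro f f' ⟨h1, h2, h3⟩ ⟨h1', h2', h3'⟩
    refine ⟨fun i => (h1 i).add (h1' i), fun i j x hx => ?_, fun i x hx => ?_⟩
    · simp [h2 i j x hx, h2' i j x hx, Matrix.mulVec_add]
    · simp [h3 i x hx, h3' i x hx]
  smul_mem' := by
    rintro c f ⟨h1, h2, h3⟩
    refine ⟨fun i => ?_, fun i j x hx => ?_, fun i x hx => ?_⟩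
    · have hL : ContDiff ℝ ∞ (fun v : Fin 2 → ℂ => c • v) := contDiff_const_smul c
      exact hL.contMDiff.comp_contMDiffOn (h1 i)
    · simp [h2 i j x hx, Matrix.mulVec_smul]
    · simp [h3 i x hx]

/-- `2 𝒟^{AA'} 𝒟_{A'B} λ^B = c λ^A`. -/
def SolvesEigenEq (S : SpinStructure D ι) (c : ℂ) (f : SpinorField S) : Prop :=
  ∀ i, ∀ x ∈ S.U i, wittenSq D (S.frame i) (f.1 i) x = c • f.1 i x

/-- `f` is an eigenspinor of `2 𝒟^{AA'} 𝒟_{A'B}` with eigenvalue `c`. -/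
def IsEigenspinor (S : SpinStructure D ι) (c : ℂ) (f : SpinorField S) : Prop :=
  f ≠ 0 ∧ SolvesEigenEq S c f

/-- The eigenvalue equation `i γ^e 𝒟_e Ψ = α Ψ` of the Sen–Witten operator for the Dirac spinor
`Ψ = (λ^A, \bar μ^{A'})`, i.e. the pair `i 𝒟_{A'A} λ^A = (α/√2) \bar μ_{A'}` and
`i 𝒟_{AA'} \bar μ^{A'} = (α/√2) λ_A`. -/
def SolvesDiracEq (S : SpinStructure D ι) (α : ℂ) (f m : SpinorField S) : Prop :=
  ∀ i, ∀ x ∈ S.U i,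
    Complex.I • wittenUp D (S.frame i) (f.1 i) x = (α / (√2 : ℝ)) • lower (bar (m.1 i x)) ∧
    Complex.I • wittenUpPrimed D (S.frame i) (fun y => bar (m.1 i y)) x =
      (α / (√2 : ℝ)) • lower (f.1 i x)

/-- `μ^A = -i (√2/α) 𝒟^A{}_{A'} \bar λ^{A'}`, where `𝒟^A{}_{A'} = ε^{AB} 𝒟_{BA'}`. -/
def IsPartner (S : SpinStructure D ι) (α : ℝ) (f m : SpinorField S) : Prop :=
  ∀ i, ∀ x ∈ S.U i,
    m.1 i x = (-Complex.I * ((√2 / α : ℝ) : ℂ)) •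
      raise (wittenUpPrimed D (S.frame i) (fun y => bar (f.1 i y)) x)

end

end SenWitten

end

/-! Up to the factor `1/√2`, `wittenUp` and `wittenDownPrimed` are in every gauge the operators A =
P - H/2 and B = -(P + H/2), where P is the Riemannian Dirac operator of the frame and H the trace of
`χ` (`wittenUp_eq`, `wittenDownPrimed_eq`). The Levi-Civita part of the spin coefficients is
anti-Hermitian and the `χ` part Hermitian, which is why H enters A and B with these signs. The
squared Sen–Witten operator is BA. Three facts about A and B carry the proof.

Adjointness. The Hermitian part of the zero order term of P is half the divergence of the frame, and
the rest of it is an imaginary scalar (`spinTerm_structCoeff`). Hence Re⟨Af, h⟩ - Re⟨f, Bh⟩ is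
pointwise a divergence (`rdot_senOp_sub`) and B is the formal adjoint of A on a closed manifold
(`tot_pair_senField`). So BA = A*A has real nonnegative eigenvalues (`eigenvalue_eq`), and the Dirac
eigenvalues are real (`dirac_eigen`).

Quaternionic structure. Charge conjugation J is antilinear with J² = -1. It anticommutes with P, so
AJ = JA* (`senOp_cc`). For real α ≠ 0 the antilinear map -(i/α)JA preserves the eigenspace of α² and
squares to -1 there (`partner_eigen`, `partner_partner`). Therefore an eigenspinor and its partner
are independent, and a finite-dimensional eigenspace has even dimension
(`even_finrank_of_quaternionic`).

Ellipticity. In a patch the first derivatives of a spinor are bounded in L² by Af and f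
(`exists_gaarding`), because the mixed terms of |Pf|² are divergences up to first order terms. If
the averages of f over finitely many small coordinate cubes vanish, a Poincaré inequality bounds the
L² norm of f by a small multiple of that of its gradient (`exists_poincare`). On an eigenspace ‖Af‖²
is a fixed multiple of ‖f‖², so such an f is zero: the eigenspace injects into a finite-dimensional
space of averages (`finiteDimensional_of_senField_le`).

A and J act on global spinor fields by covariance under changes of gauge (`diracOp_change`, which
rests on `mul_spinTerm_of_cover`, and `cc_g_mulVec`). Integration is built by hand from coordinate
integrals with the density |det E|⁻¹, E being the matrix of the frame in the chart, and a finite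
partition of unity. -/

set_option linter.unusedSectionVars false

noncomputable section

namespace SenWitten

/-! ### Derivatives along vector fields and their commutators -/

section DirectionalDerivative

variable {M : Type*} [TopologicalSpace M] [ChartedSpace E3 M] [IsManifold 𝓘(ℝ, E3) ∞ M]
  {F : Type*} [NormedAddCommGroup F] [NormedSpace ℝ F]
  {G : Type*} [NormedAddCommGroup G] [NormedSpace ℝ G]

/-- The derivative of a vector-valued function along a vector field. -/
def lie (X : (x : M) → TangentSpace 𝓘(ℝ, E3) x) (f : M → F) (x : M) : F :=
  mfderiv 𝓘(ℝ, E3) 𝓘(ℝ, F) f x (X x)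

/-- Smoothness of a vector field at a point. -/
abbrev SmoothFieldAt (X : (x : M) → TangentSpace 𝓘(ℝ, E3) x) (x : M) : Prop :=
  ContMDiffAt 𝓘(ℝ, E3) 𝓘(ℝ, E3).tangent ∞
      (fun x => (⟨x, X x⟩ : TangentBundle 𝓘(ℝ, E3) M)) x

/-- Smoothness of a vector-valued function at a point. -/
abbrev SmoothAt (f : M → F) (x : M) : Prop := ContMDiffAt 𝓘(ℝ, E3) 𝓘(ℝ, F) ∞ f x

/-- Differentiability of a vector-valued function at a point. -/
abbrev DiffAt (f : M → F) (x : M) : Prop := MDifferentiableAt 𝓘(ℝ, E3) 𝓘(ℝ, F) f x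

variable {X Y : (x : M) → TangentSpace 𝓘(ℝ, E3) x} {x : M}

lemma SmoothAt.diffAt {f : M → F} (hf : SmoothAt f x) : DiffAt f x :=
  hf.mdifferentiableAt (by simp)

lemma lie_congr {f g : M → F} (h : f =ᶠ[nhds x] g) : lie X f x = lie X g x := by
  unfold lie
  rw [h.mfderiv_eq]
  rfl

lemma lie_comp_clm (L : F →L[ℝ] G) {f : M → F} (hf : DiffAt f x) :
    lie X (fun y => L (f y)) x = L (lie X f x) := by
  have := (L.hasMFDerivAt (x := f x)).comp x hf.hasMFDerivAt
  unfold lie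
  have h2 := this.mfderiv
  rw [show (fun y => L (f y)) = L ∘ f from rfl, h2]
  rfl

lemma lie_const (c : F) : lie X (fun _ => c) x = 0 := by
  unfold lie
  rw [mfderiv_const]
  rfl

lemma lie_add {f g : M → F} (hf : DiffAt f x) (hg : DiffAt g x) :
    lie X (fun y => f y + g y) x = lie X f x + lie X g x := by
  have := (hf.hasMFDerivAt.add hg.hasMFDerivAt).mfderiv
  unfold lie
  rw [show (fun y => f y + g y) = f + g from rfl, this]
  rfl

lemma lie_sum {α : Type} (s : Finset α) {f : α → M → F} (hf : ∀ a ∈ s, DiffAt (f a) x) :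
    lie X (fun y => ∑ a ∈ s, f a y) x = ∑ a ∈ s, lie X (f a) x := by
  classical
  induction s using Finset.induction_on with
  | empty => simpa using lie_const (X := X) (x := x) (0 : F)
  | insert a s ha ih =>
    have h : DiffAt (fun y => ∑ a ∈ s, f a y) x := by
      have := MDifferentiableAt.sum (t := s) (f := f) (z := x) (I := 𝓘(ℝ, E3))
        (𝕜 := ℝ) (E' := F) fun a ha => (by exact hf a (Finset.mem_insert_of_mem ha))
      convert this using 1
      ext y
      simp
    simp only [Finset.sum_insert ha]
    rw [lie_add (hf a (Finset.mem_insert_self _ _)) h,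
      ih fun a ha => hf a (Finset.mem_insert_of_mem ha)]

lemma lie_sub {f g : M → F} (hf : DiffAt f x) (hg : DiffAt g x) :
    lie X (fun y => f y - g y) x = lie X f x - lie X g x := by
  have := (hf.hasMFDerivAt.sub hg.hasMFDerivAt).mfderiv
  unfold lie
  rw [show (fun y => f y - g y) = f - g from rfl, this]
  rfl

lemma lie_mul {A : Type*} [NormedCommRing A] [NormedAlgebra ℝ A] {f g : M → A}
    (hf : DiffAt f x) (hg : DiffAt g x) :
    lie X (fun y => f y * g y) x = lie X f x * g x + f x * lie X g x := by
  have := (hf.hasMFDerivAt.mul hg.hasMFDerivAt).mfderiv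
  unfold lie
  rw [show (fun y => f y * g y) = f * g from rfl, this, add_comm]
  exact congrArg (· + _) (mul_comm (g x) _)

lemma lie_smul_real {f : M → ℝ} {g : M → F} (hf : DiffAt f x) (hg : DiffAt g x) :
    lie X (fun y => f y • g y) x = lie X f x • g x + f x • lie X g x := by
  have := mvfderiv_smul (I := 𝓘(ℝ, E3)) hf hg
  have h2 := congrArg (fun L => L (X x)) this
  rw [add_comm]
  exact h2

lemma lie_apply {ι : Type*} [Fintype ι] {f : M → ι → ℂ} (hf : DiffAt f x) (A : ι) :
    lie X f x A = lie X (fun y => f y A) x :=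
  (lie_comp_clm (ContinuousLinearMap.proj (R := ℝ) (φ := fun _ : ι => ℂ) A) hf).symm

lemma lie_conj {f : M → ℂ} (hf : DiffAt f x) :
    lie X (fun y => conj (f y)) x = conj (lie X f x) :=
  lie_comp_clm (Complex.conjCLE : ℂ →L[ℝ] ℂ) hf

lemma lie_ofReal {f : M → ℝ} (hf : DiffAt f x) :
    lie X (fun y => (f y : ℂ)) x = ((lie X f x : ℝ) : ℂ) :=
  lie_comp_clm Complex.ofRealCLM hf

lemma lie_re {f : M → ℂ} (hf : DiffAt f x) :
    lie X (fun y => (f y).re) x = (lie X f x).re :=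
  lie_comp_clm Complex.reCLM hf

lemma lie_im {f : M → ℂ} (hf : DiffAt f x) :
    lie X (fun y => (f y).im) x = (lie X f x).im :=
  lie_comp_clm Complex.imCLM hf

lemma lie_const_smul (c : ℂ) {f : M → Fin 2 → ℂ} (hf : DiffAt f x) :
    lie X (fun y => c • f y) x = c • lie X f x :=
  lie_comp_clm (c • ContinuousLinearMap.id ℝ (Fin 2 → ℂ)) hf

lemma lie_eq_zero_of_notMem_tsupport {f : M → F} (h : x ∉ tsupport f) : lie X f x = 0 := by
  have : f =ᶠ[nhds x] fun _ => 0 := notMem_tsupport_iff_eventuallyEq.mp h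
  rw [lie_congr this, lie_const]

lemma SmoothAt.lie {f : M → F} (hf : SmoothAt f x) (hX : SmoothFieldAt X x) :
    SmoothAt (lie X f) x := by
  have h1 := hf.mfderiv_const (m := ∞) (by simp)
  have h2 := ContMDiffAt.clm_apply_of_inCoordinates (E₁ := fun x : M => TangentSpace 𝓘(ℝ, E3) x)
    (E₂ := fun y : F => TangentSpace 𝓘(ℝ, F) y) (b₁ := id) (b₂ := f) (v := X)
    (ϕ := fun x => mfderiv 𝓘(ℝ, E3) 𝓘(ℝ, F) f x) h1 hX hf
  exact (contMDiff_snd_tangentBundle_modelSpace F 𝓘(ℝ, F)).contMDiffAt.comp x h2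

/-- The bracket lemmas ask for these smoothness classes; over `ℝ` each of them follows from `∞`. -/
instance : IsManifold 𝓘(ℝ, E3) (minSmoothness ℝ 2) M := by
  rw [minSmoothness_of_isRCLikeNormedField]
  infer_instance

instance : IsManifold 𝓘(ℝ, E3) (minSmoothness ℝ 3) M := by
  rw [minSmoothness_of_isRCLikeNormedField]
  infer_instance

instance : IsManifold 𝓘(ℝ, E3) (((⊤ : ℕ∞) : WithTop ℕ∞) + 1) M := by
  simpa using inferInstanceAs (IsManifold 𝓘(ℝ, E3) ∞ M)

lemma SmoothFieldAt.mlieBracket (hX : SmoothFieldAt X x) (hY : SmoothFieldAt Y x) :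
    SmoothFieldAt (VectorField.mlieBracket 𝓘(ℝ, E3) X Y) x :=
  ContMDiffAt.mlieBracket_vectorField (m := ⊤) (n := ⊤) hX hY (by simp [minSmoothness])

lemma SmoothFieldAt.mdifferentiableAt (hX : SmoothFieldAt X x) :
    MDifferentiableAt 𝓘(ℝ, E3) 𝓘(ℝ, E3).tangent
      (fun x => (⟨x, X x⟩ : TangentBundle 𝓘(ℝ, E3) M)) x :=
  ContMDiffAt.mdifferentiableAt hX (by simp)

lemma SmoothFieldAt.smul {f : M → ℝ} (hf : SmoothAt f x) (hX : SmoothFieldAt X x) :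
    SmoothFieldAt (fun y => f y • X y) x :=
  ContMDiffAt.smul_section hf hX

lemma SmoothFieldAt.add (hX : SmoothFieldAt X x) (hY : SmoothFieldAt Y x) :
    SmoothFieldAt (fun y => X y + Y y) x :=
  ContMDiffAt.add_section hX hY

lemma mlieBracket_smul_right' {f : M → ℝ} (hf : SmoothAt f x) (hY : SmoothFieldAt Y x) :
    VectorField.mlieBracket 𝓘(ℝ, E3) X (fun y => f y • Y y) x =
      lie X f x • Y x + f x • VectorField.mlieBracket 𝓘(ℝ, E3) X Y x :=
  VectorField.mlieBracket_smul_right hf.diffAt hY.mdifferentiableAt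

/-- The Jacobi identity is applied to X, Y, uZ and to X, Y, Z. After expansion by the Leibniz rule
everything cancels except the difference of the two sides times `Z x`, so any auxiliary field that
does not vanish at the point gives the claim. -/
lemma lie_mlieBracket_real {Z : (x : M) → TangentSpace 𝓘(ℝ, E3) x} {u : M → ℝ}
    (hX : ∀ᶠ y in nhds x, SmoothFieldAt X y) (hY : ∀ᶠ y in nhds x, SmoothFieldAt Y y)
    (hZ : ∀ᶠ y in nhds x, SmoothFieldAt Z y) (hZx : Z x ≠ 0)
    (hu : ∀ᶠ y in nhds x, SmoothAt u y) :
    lie (VectorField.mlieBracket 𝓘(ℝ, E3) X Y) u x = lie X (lie Y u) x - lie Y (lie X u) x := by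
  have key : ∀ X Y : (x : M) → TangentSpace 𝓘(ℝ, E3) x, (∀ᶠ y in nhds x, SmoothFieldAt X y) →
      (∀ᶠ y in nhds x, SmoothFieldAt Y y) →
      VectorField.mlieBracket 𝓘(ℝ, E3) X
        (VectorField.mlieBracket 𝓘(ℝ, E3) Y (fun y => u y • Z y)) x =
      lie X (lie Y u) x • Z x + lie Y u x • VectorField.mlieBracket 𝓘(ℝ, E3) X Z x +
        (lie X u x • VectorField.mlieBracket 𝓘(ℝ, E3) Y Z x +
          u x • VectorField.mlieBracket 𝓘(ℝ, E3) X (VectorField.mlieBracket 𝓘(ℝ, E3) Y Z) x) := by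
    intro X Y hX hY
    have h1 : VectorField.mlieBracket 𝓘(ℝ, E3) Y (fun y => u y • Z y) =ᶠ[nhds x]
        (fun y => lie Y u y • Z y) + (fun y => u y • VectorField.mlieBracket 𝓘(ℝ, E3) Y Z y) := by
      filter_upwards [hu, hZ] with y hu hZ using mlieBracket_smul_right' hu hZ
    rw [Filter.EventuallyEq.mlieBracket_vectorField_eq (V₁ := X) (V := X)
        Filter.EventuallyEq.rfl h1,
      VectorField.mlieBracket_add_right, mlieBracket_smul_right', mlieBracket_smul_right']
    · exact hu.self_of_nhds
    · exact hY.self_of_nhds.mlieBracket hZ.self_of_nhds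
    · exact hu.self_of_nhds.lie hY.self_of_nhds
    · exact hZ.self_of_nhds
    · exact (SmoothFieldAt.smul (hu.self_of_nhds.lie hY.self_of_nhds)
        hZ.self_of_nhds).mdifferentiableAt
    · exact (SmoothFieldAt.smul hu.self_of_nhds
        (hY.self_of_nhds.mlieBracket hZ.self_of_nhds)).mdifferentiableAt
  have le2 : minSmoothness ℝ 2 ≤ ∞ := by
    rw [minSmoothness_of_isRCLikeNormedField]
    exact ENat.LEInfty.out
  have hX0 := hX.self_of_nhds
  have hY0 := hY.self_of_nhds
  have hZ0 := hZ.self_of_nhds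
  have jac := VectorField.leibniz_identity_mlieBracket_apply (I := 𝓘(ℝ, E3)) (x := x)
    (hX0.of_le le2) (hY0.of_le le2)
    ((SmoothFieldAt.smul hu.self_of_nhds hZ0).of_le le2)
  have jac' := VectorField.leibniz_identity_mlieBracket_apply (I := 𝓘(ℝ, E3)) (x := x)
    (hX0.of_le le2) (hY0.of_le le2) (hZ0.of_le le2)
  rw [key X Y hX hY, key Y X hY hX, mlieBracket_smul_right' hu.self_of_nhds hZ0, jac'] at jac
  have : (lie (VectorField.mlieBracket 𝓘(ℝ, E3) X Y) u x -
      (lie X (lie Y u) x - lie Y (lie X u) x)) • Z x = 0 := by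
    rw [← sub_eq_zero] at jac
    rw [← neg_eq_zero, ← jac]
    module
  exact sub_eq_zero.mp ((smul_eq_zero.mp this).resolve_right hZx)

lemma lie_mlieBracket {Z : (x : M) → TangentSpace 𝓘(ℝ, E3) x} {u : M → ℂ}
    (hX : ∀ᶠ y in nhds x, SmoothFieldAt X y) (hY : ∀ᶠ y in nhds x, SmoothFieldAt Y y)
    (hZ : ∀ᶠ y in nhds x, SmoothFieldAt Z y) (hZx : Z x ≠ 0)
    (hu : ∀ᶠ y in nhds x, SmoothAt u y) :
    lie (VectorField.mlieBracket 𝓘(ℝ, E3) X Y) u x = lie X (lie Y u) x - lie Y (lie X u) x := by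
  have step : ∀ L : ℂ →L[ℝ] ℝ, L (lie (VectorField.mlieBracket 𝓘(ℝ, E3) X Y) u x) =
      L (lie X (lie Y u) x - lie Y (lie X u) x) := by
    intro L
    have hL : ∀ᶠ y in nhds x, SmoothAt (fun y => L (u y)) y := by
      filter_upwards [hu] with y hy using L.contMDiff.contMDiffAt.comp y hy
    have e : ∀ V : (x : M) → TangentSpace 𝓘(ℝ, E3) x,
        lie V (fun y => L (u y)) =ᶠ[nhds x] fun y => L (lie V u y) := by
      intro V
      filter_upwards [hu] with y hy using lie_comp_clm L hy.diffAt
    have := lie_mlieBracket_real hX hY hZ hZx hL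
    rw [(e _).eq_of_nhds, lie_congr (e _), lie_congr (e _),
      lie_comp_clm L (hu.self_of_nhds.lie hY.self_of_nhds).diffAt,
      lie_comp_clm L (hu.self_of_nhds.lie hX.self_of_nhds).diffAt] at this
    rw [this, map_sub]
  exact Complex.ext (step Complex.reCLM) (step Complex.imCLM)

end DirectionalDerivative

/-! ### Pauli matrices and the zero order term of the Dirac operator -/

/-- The three Pauli matrices. -/
def sig (i : Fin 3) : Matrix (Fin 2) (Fin 2) ℂ := pauli i.succ

lemma sig_zero : sig 0 = !![0, 1; 1, 0] := rfl
lemma sig_one : sig 1 = !![0, Complex.I; -Complex.I, 0] := rfl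
lemma sig_two : sig 2 = !![1, 0; 0, -1] := rfl

/-- The factor `1 / √2` as a complex number. -/
def rt : ℂ := ((1 / √2 : ℝ) : ℂ)

lemma rt_mul_rt : rt * rt = 1 / 2 := by
  unfold rt
  rw [← Complex.ofReal_mul]
  have : (1 / √2 : ℝ) * (1 / √2) = 1 / 2 := by
    rw [div_mul_div_comm, Real.mul_self_sqrt (by norm_num)]; norm_num
  rw [this]; norm_num

lemma rt_ne_zero : rt ≠ 0 := by
  intro h
  have := rt_mul_rt
  rw [h] at this
  norm_num at this

lemma inv_sqrt_two : (1 : ℂ) / ((√2 : ℝ) : ℂ) = rt := by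
  unfold rt; push_cast; rfl

lemma conj_rt : conj rt = rt := Complex.conj_ofReal _

lemma sigmaUp_zero : sigmaUp 0 = rt • 1 := by
  ext A B; fin_cases A <;> fin_cases B <;> simp [sigmaUp, pauli, rt]

lemma sigmaUp_succ (i : Fin 3) : sigmaUp i.succ = rt • sig i := rfl

lemma sigmaDown_zero_transpose : (sigmaDown 0)ᵀ = rt • 1 := by
  ext A B
  fin_cases A <;> fin_cases B <;>
    simp [sigmaDown, sigmaUp, pauli, rt, eta, eps, Matrix.mul_apply, Fin.sum_univ_two]

lemma sigmaDown_succ_transpose (i : Fin 3) : (sigmaDown i.succ)ᵀ = rt • sig i := by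
  fin_cases i <;> ext A B <;> fin_cases A <;> fin_cases B <;>
    simp [sigmaDown, sigmaUp, pauli, rt, eta, eps, Matrix.mul_apply, Fin.sum_univ_two, sig]

lemma sigmaDown_succ (i : Fin 3) : sigmaDown i.succ = rt • (sig i).map conj := by
  rw [← Matrix.transpose_transpose (sigmaDown i.succ), sigmaDown_succ_transpose]
  fin_cases i <;> ext A B <;> fin_cases A <;> fin_cases B <;> simp [sig, pauli]

lemma eps_sigmaDown_succ (i : Fin 3) : eps * sigmaDown i.succ * epsᵀ = -rt • sig i := by
  rw [sigmaDown_succ]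
  fin_cases i <;> ext A B <;> fin_cases A <;> fin_cases B <;>
    simp [eps, sig, pauli, Matrix.mul_apply, Fin.sum_univ_two, Matrix.vecMul, dotProduct]

lemma sig_conjTranspose (i : Fin 3) : (sig i)ᴴ = sig i := by
  fin_cases i <;> ext A B <;> fin_cases A <;> fin_cases B <;> simp [sig, pauli]

/-- The zero order term of the Dirac operator of an orthonormal frame with structure functions
`c i j k = ⟨[e_i, e_j], e_k⟩`. -/
def spinTerm (c : Fin 3 → Fin 3 → Fin 3 → ℂ) : Matrix (Fin 2) (Fin 2) ℂ :=
  ∑ i, ∑ j, ∑ k, ((1 / 8 : ℂ) * (c i k j - c k j i + c j i k)) • (sig i * sig j * sig k)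

/-- A product of three Pauli matrices is a single one if an index repeats and `±i` if the indices
are distinct. Thus the Hermitian part is half the divergence of the frame and, for real `c`, the
rest is an imaginary scalar; formal skew-adjointness of the Dirac operator depends on this split. -/
lemma spinTerm_eq {c : Fin 3 → Fin 3 → Fin 3 → ℂ} (hc : ∀ i j k, c i j k = - c j i k) :
    spinTerm c = (∑ i, ((1 / 2 : ℂ) * ∑ k, c k i k) • sig i) +
      (Complex.I * (1 / 4) * (c 0 1 2 + c 1 2 0 + c 2 0 1)) • 1 := by
  have h0 : ∀ i k, c i i k = 0 := fun i k => by
    have := hc i i k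
    linear_combination (1 / 2) * this
  ext A B
  fin_cases A <;> fin_cases B <;>
    simp [spinTerm, Fin.sum_univ_three, sig_zero, sig_one, sig_two, h0,
      hc 1 0, hc 2 0, hc 2 1] <;> ring_nf

/-! ### The Sen–Witten operators as the Dirac operator plus or minus a mean curvature term -/

section

variable {M : Type*} [TopologicalSpace M] [ChartedSpace E3 M] [IsManifold 𝓘(ℝ, E3) ∞ M]

/-- The structure functions `⟨[e_i, e_j], e_k⟩` of a frame. -/
def structCoeff (D : InitialData M) (e : Fin 3 → (x : M) → TangentSpace 𝓘(ℝ, E3) x)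
    (x : M) (i j k : Fin 3) : ℝ :=
  D.metric.inner x (VectorField.mlieBracket 𝓘(ℝ, E3) (e i) (e j) x) (e k x)

lemma structCoeff_antisymm (D : InitialData M) (e : Fin 3 → (x : M) → TangentSpace 𝓘(ℝ, E3) x)
    (x : M) (i j k : Fin 3) : structCoeff D e x i j k = - structCoeff D e x j i k := by
  unfold structCoeff
  rw [VectorField.mlieBracket_swap_apply]
  simp

/-- The trace of the extrinsic curvature with respect to a frame. -/
def meanCurv (D : InitialData M) (e : Fin 3 → (x : M) → TangentSpace 𝓘(ℝ, E3) x) (x : M) : ℝ :=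
  ∑ i, D.chi x (e i x) (e i x)

/-- The Dirac operator of a frame. -/
def diracOp (D : InitialData M) (e : Fin 3 → (x : M) → TangentSpace 𝓘(ℝ, E3) x)
    (f : M → Fin 2 → ℂ) (x : M) : Fin 2 → ℂ :=
  (∑ i, sig i *ᵥ lie (e i) f x) + spinTerm (fun i j k => (structCoeff D e x i j k : ℂ)) *ᵥ f x

/-- The operator `√2 𝒟_{A'A}`. -/
def senOp (D : InitialData M) (e : Fin 3 → (x : M) → TangentSpace 𝓘(ℝ, E3) x)
    (f : M → Fin 2 → ℂ) (x : M) : Fin 2 → ℂ :=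
  diracOp D e f x - ((1 / 2 : ℂ) * meanCurv D e x) • f x

/-- The operator `√2 𝒟^{AA'}`, the formal adjoint of `senOp`. -/
def senAdj (D : InitialData M) (e : Fin 3 → (x : M) → TangentSpace 𝓘(ℝ, E3) x)
    (f : M → Fin 2 → ℂ) (x : M) : Fin 2 → ℂ :=
  -(diracOp D e f x + ((1 / 2 : ℂ) * meanCurv D e x) • f x)

variable (D : InitialData M) (e : Fin 3 → (x : M) → TangentSpace 𝓘(ℝ, E3) x)

/-- The factor `1/8` combines the `1/2` of the spinor form, the `1/2` of Koszul's formula and `rt² =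
1/2`. In the `χ` term the components `a = 0` and `b = 0` contribute equally. -/
lemma spinCoeff_eq (i : Fin 3) (x : M) :
    spinCoeff D e i x = (∑ j, ∑ k, ((1 / 8 : ℂ) * (structCoeff D e x i k j
      - structCoeff D e x k j i + structCoeff D e x j i k)) • (sig j * sig k)) -
      ∑ k, ((1 / 2 : ℂ) * D.chi x (e i x) (e k x)) • sig k := by
  have h2 : rt ^ 2 = 1 / 2 := by rw [sq, rt_mul_rt]
  unfold spinCoeff
  simp only [Fin.sum_univ_succ (n := 3), sigmaUp_zero, sigmaUp_succ, sigmaDown_zero_transpose,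
    sigmaDown_succ_transpose, senCoeff, Fin.cases_zero, Fin.cases_succ, leviCivita,
    Finset.sum_add_distrib, smul_add, Finset.smul_sum, Matrix.smul_mul, Matrix.mul_smul,
    smul_smul, Matrix.one_mul, Matrix.mul_one, structCoeff]
  simp only [Fin.sum_univ_three]
  ext A B
  simp only [Matrix.add_apply, Matrix.sub_apply, Matrix.smul_apply, smul_eq_mul]
  push_cast
  ring_nf
  rw [h2]
  ring

lemma sig_mul_self (i : Fin 3) : sig i * sig i = 1 := by
  fin_cases i <;> ext A B <;> fin_cases A <;> fin_cases B <;>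
    simp [sig, pauli, Matrix.mul_apply, Fin.sum_univ_two]

lemma sig_anticomm {i j : Fin 3} (h : i ≠ j) : sig i * sig j = - (sig j * sig i) := by
  revert h
  fin_cases i <;> fin_cases j <;> intro h <;> first | exact absurd rfl h | skip
  all_goals
    ext A B
    fin_cases A <;> fin_cases B <;>
    simp [sig, pauli, Matrix.mul_apply, Fin.sum_univ_two]

/-- Distinct Pauli matrices anticommute and `χ` is symmetric, so only the trace of `χ` survives the
contraction. -/
lemma sum_sig_spinCoeff (x : M) :
    ∑ i, sig i * spinCoeff D e i x = spinTerm (fun i j k => (structCoeff D e x i j k : ℂ)) -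
      ((1 / 2 : ℂ) * meanCurv D e x) • 1 := by
  have h : ∑ i, sig i * ∑ k, ((1 / 2 : ℂ) * D.chi x (e i x) (e k x)) • sig k =
      ((1 / 2 : ℂ) * meanCurv D e x) • 1 := by
    simp only [Fin.sum_univ_three, Matrix.mul_add, Matrix.mul_smul, sig_mul_self, meanCurv,
      sig_anticomm (show (1 : Fin 3) ≠ 0 by decide), sig_anticomm (show (2 : Fin 3) ≠ 0 by decide),
      sig_anticomm (show (2 : Fin 3) ≠ 1 by decide), D.chi_symm x (e 1 x) (e 0 x),
      D.chi_symm x (e 2 x) (e 0 x), D.chi_symm x (e 2 x) (e 1 x)]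
    push_cast
    module
  simp only [spinCoeff_eq, Matrix.mul_sub, Finset.sum_sub_distrib, h]
  simp only [spinTerm, Finset.mul_sum, Matrix.mul_smul, Matrix.mul_assoc]

/-- Metric compatibility makes the Levi-Civita part of `spinCoeff` anti-Hermitian, while the `χ`
part is Hermitian. Compared with `sum_sig_spinCoeff` only the first part changes sign, and this
produces the opposite signs of the mean curvature in `senOp` and `senAdj`. -/
lemma sum_sig_spinCoeff_adj (x : M) :
    ∑ i, sig i * (spinCoeff D e i x)ᴴ = - spinTerm (fun i j k => (structCoeff D e x i j k : ℂ)) -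
      ((1 / 2 : ℂ) * meanCurv D e x) • 1 := by
  have h : ∀ i, (spinCoeff D e i x)ᴴ = - spinCoeff D e i x -
      (2 : ℂ) • ∑ k, ((1 / 2 : ℂ) * D.chi x (e i x) (e k x)) • sig k := by
    intro i
    rw [spinCoeff_eq]
    simp only [Matrix.conjTranspose_sub, Matrix.conjTranspose_sum, Matrix.conjTranspose_smul,
      Matrix.conjTranspose_mul, sig_conjTranspose]
    have hc := structCoeff_antisymm D e x
    have : (∑ j, ∑ k, star ((1 / 8 : ℂ) * (structCoeff D e x i k j
      - structCoeff D e x k j i + structCoeff D e x j i k)) • (sig k * sig j)) = 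
      - ∑ j, ∑ k, ((1 / 8 : ℂ) * (structCoeff D e x i k j
      - structCoeff D e x k j i + structCoeff D e x j i k)) • (sig j * sig k) := by
      rw [Finset.sum_comm]
      simp only [← Finset.sum_neg_distrib, ← neg_smul]
      refine Finset.sum_congr rfl fun j _ => Finset.sum_congr rfl fun k _ => ?_
      congr 1
      rw [hc i j k, hc j k i, hc k i j]
      simp
      ring
    rw [this]
    have h3 : ∀ k, star ((1 / 2 : ℂ) * D.chi x (e i x) (e k x)) =
      (1 / 2 : ℂ) * D.chi x (e i x) (e k x) := fun k => by simp
    simp only [h3]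
    module
  have h4 : ∑ i, sig i * ∑ k, ((1 / 2 : ℂ) * D.chi x (e i x) (e k x)) • sig k =
      ((1 / 2 : ℂ) * meanCurv D e x) • 1 := by
    have := sum_sig_spinCoeff D e x
    simp only [spinCoeff_eq, Matrix.mul_sub, Finset.sum_sub_distrib] at this
    simp only [spinTerm, Finset.mul_sum, Matrix.mul_smul, Matrix.mul_assoc] at this ⊢
    exact sub_right_injective this
  simp only [h, Matrix.mul_sub, Finset.sum_sub_distrib, Matrix.mul_smul, ← Finset.smul_sum, h4,
    Matrix.mul_neg, Finset.sum_neg_distrib, sum_sig_spinCoeff]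
  module

lemma partialFrame_eq_lie (i : Fin 3) (f : M → Fin 2 → ℂ) (x : M) :
    partialFrame e i f x = lie (e i) f x := rfl

lemma wittenUp_eq (f : M → Fin 2 → ℂ) (x : M) : wittenUp D e f x = rt • senOp D e f x := by
  have h := congrArg (fun N => N *ᵥ f x) (sum_sig_spinCoeff D e x)
  simp only [Matrix.sum_mulVec, ← Matrix.mulVec_mulVec, Matrix.sub_mulVec, Matrix.smul_mulVec,
    Matrix.one_mulVec] at h
  simp only [wittenUp, sigmaDown_succ_transpose, senUp, senOp, diracOp, Matrix.smul_mulVec,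
    ← Finset.smul_sum, Matrix.mulVec_add, Finset.sum_add_distrib, h, partialFrame_eq_lie]
  module

lemma wittenDownPrimed_eq (f : M → Fin 2 → ℂ) (x : M) :
    wittenDownPrimed D e f x = rt • senAdj D e f x := by
  have h := congrArg (fun N => N *ᵥ f x) (sum_sig_spinCoeff_adj D e x)
  simp only [Matrix.sum_mulVec, ← Matrix.mulVec_mulVec, Matrix.sub_mulVec, Matrix.smul_mulVec,
    Matrix.one_mulVec, Matrix.neg_mulVec] at h
  simp only [wittenDownPrimed, eps_sigmaDown_succ, senDownPrimed, senAdj, diracOp,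
    Matrix.smul_mulVec, ← Finset.smul_sum, Matrix.mulVec_sub, Finset.sum_sub_distrib, h,
    partialFrame_eq_lie]
  module

end

/-! ### Charge conjugation -/

/-- The antilinear map `v^A ↦ ε^{AB} \bar v_B` of spinors. -/
def cc : (Fin 2 → ℂ) →L[ℝ] (Fin 2 → ℂ) :=
  LinearMap.toContinuousLinearMap
    { toFun := fun v => raise (bar v)
      map_add' := fun v w => by
        ext A; fin_cases A <;> simp [raise, bar, eps, Matrix.vecHead, Matrix.vecTail] <;> ring
      map_smul' := fun c v => by
        ext A; fin_cases A <;> simp [raise, bar, eps, Matrix.vecHead, Matrix.vecTail] }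

lemma cc_def (v : Fin 2 → ℂ) : cc v = raise (bar v) := rfl

lemma cc_apply (v : Fin 2 → ℂ) : cc v = ![conj (v 1), -conj (v 0)] := by
  ext A; fin_cases A <;> simp [cc_def, raise, bar, eps, Matrix.vecHead, Matrix.vecTail]

lemma cc_cc (v : Fin 2 → ℂ) : cc (cc v) = -v := by
  ext A; fin_cases A <;> simp [cc_apply]

lemma cc_smul (c : ℂ) (v : Fin 2 → ℂ) : cc (c • v) = conj c • cc v := by
  ext A; fin_cases A <;> simp [cc_apply]

lemma lower_bar (v : Fin 2 → ℂ) : lower (bar v) = - cc v := by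
  ext A; fin_cases A <;> simp [cc_apply, lower, bar, eps]

lemma bar_bar (v : Fin 2 → ℂ) : bar (bar v) = v := by
  ext A; simp [bar]

lemma bar_injective : Function.Injective bar := fun v w h => by
  rw [← bar_bar v, h, bar_bar]

lemma bar_smul (c : ℂ) (v : Fin 2 → ℂ) : bar (c • v) = conj c • bar v := by
  ext A; simp [bar]

/-- With `senOp_cc` as its purpose: `cc` changes the sign of every Pauli matrix, so it also
anticommutes with `spinTerm`, which is cubic in them with real coefficients. -/
lemma sig_mulVec_cc (i : Fin 3) (v : Fin 2 → ℂ) : sig i *ᵥ cc v = - cc (sig i *ᵥ v) := by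
  fin_cases i <;> ext A <;> fin_cases A <;> simp [cc_apply, sig, pauli, Matrix.vecHead, Matrix.vecTail, mul_comm]

lemma spinTerm_mulVec_cc {c : Fin 3 → Fin 3 → Fin 3 → ℂ} (hc : ∀ i j k, conj (c i j k) = c i j k)
    (v : Fin 2 → ℂ) : spinTerm c *ᵥ cc v = - cc (spinTerm c *ᵥ v) := by
  simp only [spinTerm, Matrix.sum_mulVec, map_sum, Matrix.smul_mulVec, cc_smul, map_mul, map_add,
    map_sub, hc, ← Matrix.mulVec_mulVec, sig_mulVec_cc, Matrix.mulVec_neg, map_neg,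
    ← Finset.sum_neg_distrib, smul_neg, neg_neg, map_div₀, map_one, map_ofNat]

section

variable {M : Type*} [TopologicalSpace M] [ChartedSpace E3 M] [IsManifold 𝓘(ℝ, E3) ∞ M]
  (D : InitialData M) (e : Fin 3 → (x : M) → TangentSpace 𝓘(ℝ, E3) x)

lemma diracOp_cc {f : M → Fin 2 → ℂ} {x : M} (hf : DiffAt f x) :
    diracOp D e (fun y => cc (f y)) x = - cc (diracOp D e f x) := by
  simp only [diracOp, lie_comp_clm cc hf, sig_mulVec_cc, map_add, map_sum,
    spinTerm_mulVec_cc (fun _ _ _ => Complex.conj_ofReal _), Finset.sum_neg_distrib, neg_add]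

/-- Charge conjugation anticommutes with the Dirac operator but commutes with the real mean
curvature, so it exchanges the two Sen–Witten operators. -/
lemma senOp_cc {f : M → Fin 2 → ℂ} {x : M} (hf : DiffAt f x) :
    senOp D e (fun y => cc (f y)) x = cc (senAdj D e f x) := by
  have : conj ((1 / 2 : ℂ) * meanCurv D e x) = (1 / 2 : ℂ) * meanCurv D e x := by
    simp only [map_mul, map_div₀, map_one, map_ofNat, Complex.conj_ofReal]
  rw [senOp, senAdj, diracOp_cc D e hf, map_neg, map_add, cc_smul, this]
  module

/-- Complex conjugation of spinors as a real linear map. -/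
def barL : (Fin 2 → ℂ) →L[ℝ] (Fin 2 → ℂ) :=
  LinearMap.toContinuousLinearMap
    { toFun := bar
      map_add' := fun v w => by ext A; simp [bar]
      map_smul' := fun c v => by ext A; simp [bar] }

lemma barL_apply (v : Fin 2 → ℂ) : barL v = bar v := rfl

lemma map_conj_mulVec_bar (N : Matrix (Fin 2) (Fin 2) ℂ) (v : Fin 2 → ℂ) :
    N.map conj *ᵥ bar v = bar (N *ᵥ v) := by
  ext A; simp [bar, Matrix.mulVec, dotProduct]

/-- The primed operator is the complex conjugate of the unprimed one, so no separate analysis of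
primed spinors is needed. -/
lemma wittenUpPrimed_bar {f : M → Fin 2 → ℂ} {x : M} (hf : DiffAt f x) :
    wittenUpPrimed D e (fun y => bar (f y)) x = rt • bar (senOp D e f x) := by
  have h1 : ∀ i, lie (e i) (fun y => bar (f y)) x = bar (lie (e i) f x) :=
    fun i => lie_comp_clm barL hf
  have h2 : ∀ v w, bar (v + w) = bar v + bar w := map_add barL
  have h3 : wittenUpPrimed D e (fun y => bar (f y)) x = bar (wittenUp D e f x) := by
    simp only [wittenUpPrimed, wittenUp, senUpPrimed, senUp, sigmaDown_succ_transpose,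
      partialFrame_eq_lie, h1, map_conj_mulVec_bar, ← h2]
    rw [← barL_apply (∑ i, _), map_sum]
    refine Finset.sum_congr rfl fun i _ => ?_
    rw [barL_apply, sigmaDown_succ, Matrix.smul_mulVec, Matrix.smul_mulVec, map_conj_mulVec_bar, bar_smul, conj_rt]
  rw [h3, wittenUp_eq, bar_smul, conj_rt]

end

/-! ### Change of spin frame: the algebra -/

/-- The trilinear expression in terms of which the spin connection term is built. -/
def tri (a b m : Matrix (Fin 2) (Fin 2) ℂ) : Matrix (Fin 2) (Fin 2) ℂ :=
  (1 / 8 : ℂ) • (a * m * b - m * b * a + b * a * m)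

lemma spinTerm_eq_tri (c : Fin 3 → Fin 3 → Fin 3 → ℂ) :
    spinTerm c = ∑ a, ∑ b, ∑ m, c a b m • tri (sig a) (sig b) (sig m) := by
  simp only [spinTerm, tri, Fin.sum_univ_three]
  module

lemma tri_sum_left (r : Fin 3 → ℂ) (t : Fin 3 → Matrix (Fin 2) (Fin 2) ℂ)
    (b m : Matrix (Fin 2) (Fin 2) ℂ) : tri (∑ a, r a • t a) b m = ∑ a, r a • tri (t a) b m := by
  simp only [tri, Fin.sum_univ_three, Matrix.add_mul, Matrix.mul_add, Matrix.smul_mul,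
    Matrix.mul_smul]
  module

lemma tri_sum_mid (r : Fin 3 → ℂ) (t : Fin 3 → Matrix (Fin 2) (Fin 2) ℂ)
    (a m : Matrix (Fin 2) (Fin 2) ℂ) : tri a (∑ b, r b • t b) m = ∑ b, r b • tri a (t b) m := by
  simp only [tri, Fin.sum_univ_three, Matrix.add_mul, Matrix.mul_add, Matrix.smul_mul,
    Matrix.mul_smul]
  module

lemma tri_sum_right (r : Fin 3 → ℂ) (t : Fin 3 → Matrix (Fin 2) (Fin 2) ℂ)
    (a b : Matrix (Fin 2) (Fin 2) ℂ) : tri a b (∑ m, r m • t m) = ∑ m, r m • tri a b (t m) := by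
  simp only [tri, Fin.sum_univ_three, Matrix.add_mul, Matrix.mul_add, Matrix.smul_mul,
    Matrix.mul_smul]
  module

lemma tri_sum (r s t : Fin 3 → ℂ) (u v w : Fin 3 → Matrix (Fin 2) (Fin 2) ℂ) :
    tri (∑ a, r a • u a) (∑ b, s b • v b) (∑ m, t m • w m) =
      ∑ a, ∑ b, ∑ m, (r a * s b * t m) • tri (u a) (v b) (w m) := by
  rw [tri_sum_left]
  refine Finset.sum_congr rfl fun a _ => ?_
  rw [tri_sum_mid, Finset.smul_sum]
  refine Finset.sum_congr rfl fun b _ => ?_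
  rw [tri_sum_right, Finset.smul_sum, Finset.smul_sum]
  refine Finset.sum_congr rfl fun m _ => ?_
  rw [smul_smul, smul_smul]

lemma tri_neg_left (a b m : Matrix (Fin 2) (Fin 2) ℂ) : tri (-a) b m = - tri a b m := by
  simp only [tri, Matrix.neg_mul, Matrix.mul_neg]; module

lemma tri_neg_mid (a b m : Matrix (Fin 2) (Fin 2) ℂ) : tri a (-b) m = - tri a b m := by
  simp only [tri, Matrix.neg_mul, Matrix.mul_neg]; module

/-- The completeness relation of the Pauli matrices; it evaluates the contractions in
`sum_tri_commutator`. -/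
lemma sum_sig_mul_sig (N : Matrix (Fin 2) (Fin 2) ℂ) :
    ∑ d, sig d * N * sig d = (2 * N.trace) • 1 - N := by
  have hI := Complex.I_sq
  rw [Matrix.trace_fin_two, Matrix.eta_fin_two N]
  generalize N 0 0 = p, N 0 1 = q, N 1 0 = r, N 1 1 = s
  ext A B
  fin_cases A <;> fin_cases B <;>
    simp [Fin.sum_univ_three, sig_zero, sig_one, sig_two] <;> ring_nf <;>
    rw [hI] <;> ring

/-- Here `w` plays the part of the infinitesimal spin rotation `(∂g) g⁻¹`. The left side is what the
derivative of the rotation matrix adds to the structure functions; the right side is what the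
derivative of `g` adds to the Dirac operator. -/
lemma sum_tri_commutator (c : Fin 3) (w : Matrix (Fin 2) (Fin 2) ℂ) (hw : w.trace = 0) :
    ∑ d, (tri (w * sig d - sig d * w) (sig c) (sig d) -
      tri (sig c) (w * sig d - sig d * w) (sig d)) = sig c * w := by
  have hs : (sig c).trace = 0 := by
    rw [Matrix.trace_fin_two]; fin_cases c <;> simp [sig, pauli]
  generalize sig c = s at hs
  have step : ∀ d, tri (w * sig d - sig d * w) s (sig d) - tri s (w * sig d - sig d * w) (sig d) =
      (1 / 8 : ℂ) • ((2 : ℂ) • (s * w) - (2 : ℂ) • (s * (sig d * w * sig d))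
        + (sig d * s * sig d) * w - w * (sig d * s * sig d) - sig d * (s * w) * sig d
        + sig d * (w * s) * sig d) := by
    intro d
    have h1 := sig_mul_self d
    have h2 : ∀ N : Matrix (Fin 2) (Fin 2) ℂ, sig d * (sig d * N) = N := fun N => by
      rw [← Matrix.mul_assoc, h1, Matrix.one_mul]
    simp only [tri, ← smul_sub]
    congr 1
    simp only [Matrix.sub_mul, Matrix.mul_sub, Matrix.mul_assoc, h1, h2, Matrix.mul_one]
    module
  simp only [step, ← Finset.smul_sum, Finset.sum_add_distrib, Finset.sum_sub_distrib,
    ← Finset.mul_sum, ← Finset.sum_mul, sum_sig_mul_sig, hw, hs, Matrix.trace_mul_comm w s,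
    Finset.sum_const, Finset.card_univ, Fintype.card_fin]
  simp only [mul_zero, zero_smul, zero_sub, Matrix.mul_neg, Matrix.neg_mul, Matrix.mul_smul,
    Matrix.smul_mul]
  module

/-- The algebraic core of gauge covariance, with `R` the rotation covered by `g`, and `P`, `G` the
derivatives of `R`, `g` along the frame. The tensorial part of the transformation law `hs` is
absorbed by conjugation with `g`; the inhomogeneous part gives the derivative of `g` through
`sum_tri_commutator`. -/
lemma mul_spinTerm_of_cover {g : Matrix (Fin 2) (Fin 2) ℂ} (hg : gᴴ * g = 1)
    {R : Fin 3 → Fin 3 → ℂ} (hR : ∀ c d, ∑ a, R c a * R d a = if c = d then 1 else 0)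
    (hcov : ∀ a, g * sig a * gᴴ = ∑ b, R b a • sig b)
    {P : Fin 3 → Fin 3 → Fin 3 → ℂ} (hP : ∀ c d k, ∑ a, P c d a * R k a = - ∑ a, P c k a * R d a)
    {G : Fin 3 → Matrix (Fin 2) (Fin 2) ℂ}
    (hG : ∀ c a, G c * sig a * gᴴ + g * sig a * (G c)ᴴ = ∑ b, P c b a • sig b)
    (hG1 : ∀ c, G c * gᴴ + g * (G c)ᴴ = 0) (htr : ∀ c, (G c * gᴴ).trace = 0)
    {s s' : Fin 3 → Fin 3 → Fin 3 → ℂ}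
    (hs : ∀ a b m, s' a b m = (∑ c, ∑ d, ∑ k, R c a * R d b * R k m * s c d k) +
      ∑ c, ∑ d, (R c a * P c d b * R d m - P c d a * R c b * R d m)) :
    g * spinTerm s' = spinTerm s * g + ∑ c, sig c * G c := by
  set t : Fin 3 → Matrix (Fin 2) (Fin 2) ℂ := fun a => g * sig a * gᴴ with ht
  have hRt : ∀ c, ∑ a, R c a • t a = sig c := by
    intro c
    simp only [ht, hcov, Finset.smul_sum, smul_smul]
    rw [Finset.sum_comm]
    simp only [← Finset.sum_smul, hR, ite_smul, one_smul, zero_smul, Finset.sum_ite_eq,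
      Finset.mem_univ, if_true]
  -- Unitarity rewrites `(G c)ᴴ` as `-gᴴ (G c) gᴴ`, which turns the differentiated covering relation
  -- into a commutator.
  have hcomm : ∀ c a, ∑ b, P c b a • sig b = (G c * gᴴ) * t a - t a * (G c * gᴴ) := by
    intro c a
    have h1 : (G c)ᴴ = - gᴴ * (G c * gᴴ) := by
      have : g * (G c)ᴴ = - (G c * gᴴ) := eq_neg_of_add_eq_zero_right (hG1 c)
      calc (G c)ᴴ = gᴴ * g * (G c)ᴴ := by rw [hg, Matrix.one_mul]
        _ = - gᴴ * (G c * gᴴ) := by rw [Matrix.mul_assoc, this, Matrix.mul_neg, Matrix.neg_mul]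
    rw [← hG, h1, ht]
    simp only [Matrix.mul_assoc, Matrix.neg_mul, Matrix.mul_neg, sub_eq_add_neg]
    rw [← Matrix.mul_assoc gᴴ g, hg, Matrix.one_mul]
  -- The previous identity with its index moved to the other frame; the sign comes from the
  -- antisymmetry `hP`.
  have hPt : ∀ c d, ∑ b, P c d b • t b = -((G c * gᴴ) * sig d - sig d * (G c * gᴴ)) := by
    intro c d
    have h1 : (G c * gᴴ) * sig d - sig d * (G c * gᴴ) = ∑ k, (∑ a, P c k a * R d a) • sig k := by
      rw [← hRt d, Finset.mul_sum, Finset.sum_mul, ← Finset.sum_sub_distrib]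
      simp only [Matrix.mul_smul, Matrix.smul_mul, ← smul_sub, ← hcomm, Finset.smul_sum, smul_smul,
        Finset.sum_smul]
      rw [Finset.sum_comm]
      simp only [mul_comm]
    rw [h1, ← Finset.sum_neg_distrib]
    simp only [ht, hcov, Finset.smul_sum, smul_smul]
    rw [Finset.sum_comm]
    refine Finset.sum_congr rfl fun k _ => ?_
    rw [← Finset.sum_smul, hP, neg_smul]
  have hconj : g * spinTerm s' * gᴴ = ∑ a, ∑ b, ∑ m, s' a b m • tri (t a) (t b) (t m) := by
    have htri : ∀ a b m, g * tri (sig a) (sig b) (sig m) * gᴴ = tri (t a) (t b) (t m) := by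
      intro a b m
      have h3 : ∀ x y z : Matrix (Fin 2) (Fin 2) ℂ, g * x * gᴴ * (g * y * gᴴ) * (g * z * gᴴ) =
          g * (x * y * z) * gᴴ := by
        intro x y z
        calc g * x * gᴴ * (g * y * gᴴ) * (g * z * gᴴ)
            = g * x * (gᴴ * g) * y * (gᴴ * g) * z * gᴴ := by simp only [Matrix.mul_assoc]
          _ = g * (x * y * z) * gᴴ := by rw [hg]; simp only [Matrix.mul_assoc, Matrix.one_mul]
      simp only [tri, ht, h3, Matrix.mul_smul, Matrix.smul_mul, Matrix.mul_add, Matrix.mul_sub,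
        Matrix.add_mul, Matrix.sub_mul]
    rw [spinTerm_eq_tri]
    simp only [Finset.mul_sum, Finset.sum_mul, Matrix.mul_smul, Matrix.smul_mul, htri]
  have hmain : ∑ a, ∑ b, ∑ m, s' a b m • tri (t a) (t b) (t m) =
      spinTerm s + ∑ c, sig c * (G c * gᴴ) := by
    have e1 : ∑ a, ∑ b, ∑ m, (∑ c, ∑ d, ∑ k, R c a * R d b * R k m * s c d k) •
        tri (t a) (t b) (t m) = spinTerm s := by
      rw [spinTerm_eq_tri]
      calc _ = ∑ c, ∑ d, ∑ k, s c d k • ∑ a, ∑ b, ∑ m, (R c a * R d b * R k m) •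
            tri (t a) (t b) (t m) := by
            simp only [Fin.sum_univ_three]; module
        _ = _ := by simp only [← tri_sum, hRt]
    have e2 : ∑ a, ∑ b, ∑ m, (∑ c, ∑ d, (R c a * P c d b * R d m - P c d a * R c b * R d m)) •
        tri (t a) (t b) (t m) = ∑ c, sig c * (G c * gᴴ) := by
      calc _ = ∑ c, ∑ d, ((∑ a, ∑ b, ∑ m, (R c a * P c d b * R d m) • tri (t a) (t b) (t m)) -
            ∑ a, ∑ b, ∑ m, (P c d a * R c b * R d m) • tri (t a) (t b) (t m)) := by
            simp only [Fin.sum_univ_three]; module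
        _ = _ := by
            simp only [← tri_sum, hRt, hPt, tri_neg_left, tri_neg_mid]
            refine Finset.sum_congr rfl fun c _ => ?_
            rw [← sum_tri_commutator c _ (htr c)]
            refine Finset.sum_congr rfl fun d _ => ?_
            abel
    simp only [hs, add_smul, Finset.sum_add_distrib]
    rw [e1, e2]
  have h4 : g * spinTerm s' = (g * spinTerm s' * gᴴ) * g := by
    rw [Matrix.mul_assoc _ gᴴ g, hg, Matrix.mul_one]
  rw [h4, hconj, hmain, Matrix.add_mul, Finset.sum_mul]
  congr 1
  refine Finset.sum_congr rfl fun c _ => ?_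
  rw [Matrix.mul_assoc, Matrix.mul_assoc, hg, Matrix.mul_one]

/-! ### Orthonormal frames, their rotation matrices and structure functions -/

section

variable {M : Type*} [TopologicalSpace M] [ChartedSpace E3 M] [IsManifold 𝓘(ℝ, E3) ∞ M]
  {D : InitialData M} {ι : Type*}

lemma diffAt_mul {A : Type*} [NormedRing A] [NormedAlgebra ℝ A] {f g : M → A} {x : M}
    (hf : DiffAt f x) (hg : DiffAt g x) : DiffAt (fun y => f y * g y) x :=
  MDifferentiableAt.mul hf hg

lemma diffAt_const {F : Type*} [NormedAddCommGroup F] [NormedSpace ℝ F] {x : M} (c : F) :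
    DiffAt (fun _ : M => c) x := mdifferentiableAt_const

lemma smoothAt_bilin {B : (x : M) → TangentSpace 𝓘(ℝ, E3) x →L[ℝ] TangentSpace 𝓘(ℝ, E3) x →L[ℝ] ℝ}
    (hB : ContMDiff 𝓘(ℝ, E3) (𝓘(ℝ, E3).prod 𝓘(ℝ, E3 →L[ℝ] E3 →L[ℝ] ℝ)) ∞
      (fun x => Bundle.TotalSpace.mk' (E3 →L[ℝ] E3 →L[ℝ] ℝ)
        (E := fun x : M => TangentSpace 𝓘(ℝ, E3) x →L[ℝ] TangentSpace 𝓘(ℝ, E3) x →L[ℝ] ℝ)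
        x (B x)))
    {X Y : (x : M) → TangentSpace 𝓘(ℝ, E3) x} {x : M}
    (hX : SmoothFieldAt X x) (hY : SmoothFieldAt Y x) :
    SmoothAt (fun y => B y (X y) (Y y)) x := by
  have : ContMDiffAt 𝓘(ℝ, E3) (𝓘(ℝ, E3).prod 𝓘(ℝ)) ∞
      (fun m => Bundle.TotalSpace.mk' ℝ (E := Bundle.Trivial M ℝ) m (B m (X m) (Y m))) x := by
    apply ContMDiffAt.clm_bundle_apply₂ (F₁ := E3) (F₂ := E3)
      (E₁ := fun x : M => TangentSpace 𝓘(ℝ, E3) x) (E₂ := fun x : M => TangentSpace 𝓘(ℝ, E3) x)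
    · exact hB x
    · exact hX
    · exact hY
  simp only [Bundle.contMDiffAt_totalSpace] at this
  exact this.2

lemma smoothAt_inner (D : InitialData M) {X Y : (x : M) → TangentSpace 𝓘(ℝ, E3) x} {x : M}
    (hX : SmoothFieldAt X x) (hY : SmoothFieldAt Y x) :
    SmoothAt (fun y => D.metric.inner y (X y) (Y y)) x :=
  smoothAt_bilin D.metric.contMDiff hX hY

lemma smoothAt_chi (D : InitialData M) {X Y : (x : M) → TangentSpace 𝓘(ℝ, E3) x} {x : M}
    (hX : SmoothFieldAt X x) (hY : SmoothFieldAt Y x) :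
    SmoothAt (fun y => D.chi y (X y) (Y y)) x :=
  smoothAt_bilin D.chi_contMDiff hX hY

/-- Orthonormality gives independence, and three independent vectors span the three-dimensional
tangent space. -/
lemma frame_expansion (D : InitialData M) {x : M} {e : Fin 3 → TangentSpace 𝓘(ℝ, E3) x}
    (he : ∀ a b, D.metric.inner x (e a) (e b) = if a = b then 1 else 0)
    (v : TangentSpace 𝓘(ℝ, E3) x) : v = ∑ b, D.metric.inner x (e b) v • e b := by
  have hpair : ∀ (c : Fin 3 → ℝ) (a : Fin 3), D.metric.inner x (e a) (∑ b, c b • e b) = c a := by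
    intro c a
    simp [map_sum, he]
  have hli : LinearIndependent ℝ e := by
    rw [Fintype.linearIndependent_iff]
    intro c hc a
    rw [← hpair c a, hc, map_zero]
  have hfin : Module.finrank ℝ (TangentSpace 𝓘(ℝ, E3) x) = 3 := by
    change Module.finrank ℝ E3 = 3
    simp
  have : FiniteDimensional ℝ (TangentSpace 𝓘(ℝ, E3) x) :=
    inferInstanceAs (FiniteDimensional ℝ E3)
  have hspan := hli.span_eq_top_of_card_eq_finrank' (by rw [hfin]; simp)
  have hv : v ∈ Submodule.span ℝ (Set.range e) := by rw [hspan]; trivial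
  obtain ⟨c, hc⟩ := (Submodule.mem_span_range_iff_exists_fun ℝ).1 hv
  rw [← hc]
  refine Finset.sum_congr rfl fun b _ => ?_
  rw [hpair]

variable (S : SpinStructure D ι)

lemma smoothFieldAt_frame (i : ι) (a : Fin 3) {x : M} (hx : x ∈ S.U i) :
    SmoothFieldAt (S.frame i a) x :=
  (S.frame_contMDiffOn i a).contMDiffAt ((S.isOpen_U i).mem_nhds hx)

lemma eventually_smoothFieldAt_frame (i : ι) (a : Fin 3) {x : M} (hx : x ∈ S.U i) :
    ∀ᶠ y in nhds x, SmoothFieldAt (S.frame i a) y := by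
  filter_upwards [(S.isOpen_U i).mem_nhds hx] with y hy using smoothFieldAt_frame S i a hy

lemma frame_ne_zero (i : ι) (a : Fin 3) {x : M} (hx : x ∈ S.U i) : S.frame i a x ≠ 0 := by
  intro h
  have := S.frame_orthonormal i x hx a a
  rw [h] at this
  simp at this

lemma lie_mlieBracket_frame (i : ι) (a b : Fin 3) {x : M} (hx : x ∈ S.U i) {u : M → ℂ}
    (hu : ∀ᶠ y in nhds x, SmoothAt u y) :
    lie (S.frame i a) (lie (S.frame i b) u) x - lie (S.frame i b) (lie (S.frame i a) u) x =
      ∑ k, (structCoeff D (S.frame i) x a b k : ℂ) * lie (S.frame i k) u x := by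
  rw [← lie_mlieBracket (eventually_smoothFieldAt_frame S i a hx)
    (eventually_smoothFieldAt_frame S i b hx) (eventually_smoothFieldAt_frame S i 0 hx)
    (frame_ne_zero S i 0 hx) hu]
  have h := frame_expansion D (S.frame_orthonormal i x hx)
    (VectorField.mlieBracket 𝓘(ℝ, E3) (S.frame i a) (S.frame i b) x)
  have h2 := congrArg (fun v => (mfderiv 𝓘(ℝ, E3) 𝓘(ℝ, ℂ) u x v : ℂ)) h
  refine h2.trans ?_
  rw [map_sum]
  refine Finset.sum_congr rfl fun k _ => ?_
  rw [map_smul, D.metric.symm]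
  exact Complex.real_smul

lemma smoothAt_structCoeff (i : ι) {x : M} (hx : x ∈ S.U i) (a b k : Fin 3) :
    SmoothAt (fun y => structCoeff D (S.frame i) y a b k) x :=
  smoothAt_inner D ((smoothFieldAt_frame S i a hx).mlieBracket (smoothFieldAt_frame S i b hx))
    (smoothFieldAt_frame S i k hx)

/-- The matrix of the change of frame. -/
def rot (i j : ι) (x : M) (b a : Fin 3) : ℝ :=
  D.metric.inner x (S.frame i b x) (S.frame j a x)

variable {S} {i j : ι} {x : M}

lemma frame_eq_sum_rot (hx : x ∈ S.U i) (a : Fin 3) :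
    S.frame j a x = ∑ b, rot S i j x b a • S.frame i b x :=
  frame_expansion D (S.frame_orthonormal i x hx) _

lemma rot_mul_rot (hi : x ∈ S.U i) (hj : x ∈ S.U j) (c d : Fin 3) :
    ∑ a, rot S i j x c a * rot S i j x d a = if c = d then 1 else 0 := by
  rw [← S.frame_orthonormal i x hi c d]
  conv_rhs => rw [frame_expansion D (S.frame_orthonormal j x hj) (S.frame i d x)]
  rw [map_sum]
  refine Finset.sum_congr rfl fun a _ => ?_
  rw [map_smul, smul_eq_mul, mul_comm, rot, rot, D.metric.symm x (S.frame i d x)]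

lemma ofReal_rot_mul_rot (hi : x ∈ S.U i) (hj : x ∈ S.U j) (c d : Fin 3) :
    ∑ a, (rot S i j x c a : ℂ) * rot S i j x d a = if c = d then 1 else 0 := by
  have := rot_mul_rot hi hj c d
  split_ifs at this ⊢ <;> exact_mod_cast this

lemma smoothAt_rot (hi : x ∈ S.U i) (hj : x ∈ S.U j) (c a : Fin 3) :
    SmoothAt (fun y => rot S i j y c a) x :=
  smoothAt_inner D (smoothFieldAt_frame S i c hi) (smoothFieldAt_frame S j a hj)

lemma mlieBracket_sum_right {X : (x : M) → TangentSpace 𝓘(ℝ, E3) x}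
    {Y : Fin 3 → (x : M) → TangentSpace 𝓘(ℝ, E3) x} {r : Fin 3 → M → ℝ}
    (hr : ∀ b, SmoothAt (r b) x) (hY : ∀ b, SmoothFieldAt (Y b) x) :
    VectorField.mlieBracket 𝓘(ℝ, E3) X (fun y => ∑ b, r b y • Y b y) x =
      ∑ b, (lie X (r b) x • Y b x + r b x • VectorField.mlieBracket 𝓘(ℝ, E3) X (Y b) x) := by
  have h : ∀ b, SmoothFieldAt (fun y => r b y • Y b y) x := fun b => (hY b).smul (hr b)
  simp only [Fin.sum_univ_three]
  rw [show (fun y => r 0 y • Y 0 y + r 1 y • Y 1 y + r 2 y • Y 2 y) =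
      ((fun y => r 0 y • Y 0 y + r 1 y • Y 1 y) + fun y => r 2 y • Y 2 y) from rfl,
    VectorField.mlieBracket_add_right ((h 0).add (h 1)).mdifferentiableAt (h 2).mdifferentiableAt,
    show (fun y => r 0 y • Y 0 y + r 1 y • Y 1 y) =
      ((fun y => r 0 y • Y 0 y) + fun y => r 1 y • Y 1 y) from rfl,
    VectorField.mlieBracket_add_right (h 0).mdifferentiableAt (h 1).mdifferentiableAt,
    mlieBracket_smul_right' (hr 0) (hY 0), mlieBracket_smul_right' (hr 1) (hY 1),
    mlieBracket_smul_right' (hr 2) (hY 2)]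

lemma lie_frame_eq {F : Type*} [NormedAddCommGroup F] [NormedSpace ℝ F] (hi : x ∈ S.U i)
    (a : Fin 3) (f : M → F) :
    lie (S.frame j a) f x = ∑ c, rot S i j x c a • lie (S.frame i c) f x := by
  unfold lie
  rw [frame_eq_sum_rot (i := i) hi a, map_sum]
  refine Finset.sum_congr rfl fun c _ => ?_
  rw [map_smul]
  rfl

/-- Both entries of the bracket are expanded in the other frame. The Leibniz rule yields the
tensorial term and two terms with derivatives of the rotation matrix, in the form that
`mul_spinTerm_of_cover` expects. -/
lemma structCoeff_change (hi : x ∈ S.U i) (hj : x ∈ S.U j) (a b m : Fin 3) :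
    structCoeff D (S.frame j) x a b m =
      (∑ c, ∑ d, ∑ k, rot S i j x c a * rot S i j x d b * rot S i j x k m *
        structCoeff D (S.frame i) x c d k) +
      ∑ c, ∑ d, (rot S i j x c a * lie (S.frame i c) (fun y => rot S i j y d b) x *
          rot S i j x d m -
        lie (S.frame i c) (fun y => rot S i j y d a) x * rot S i j x c b * rot S i j x d m) := by
  have hev : ∀ a, S.frame j a =ᶠ[nhds x] fun y => ∑ b, rot S i j y b a • S.frame i b y := by
    intro a
    filter_upwards [(S.isOpen_U i).mem_nhds hi] with y hy using frame_eq_sum_rot hy a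
  have hr : ∀ c a, SmoothAt (fun y => rot S i j y c a) x := smoothAt_rot hi hj
  have hf : ∀ c, SmoothFieldAt (S.frame i c) x := fun c => smoothFieldAt_frame S i c hi
  have hbr : ∀ (X : (x : M) → TangentSpace 𝓘(ℝ, E3) x) (a : Fin 3),
      VectorField.mlieBracket 𝓘(ℝ, E3) X (S.frame j a) x =
      VectorField.mlieBracket 𝓘(ℝ, E3) X (fun y => ∑ b, rot S i j y b a • S.frame i b y) x :=
    fun X a => Filter.EventuallyEq.mlieBracket_vectorField_eq Filter.EventuallyEq.rfl (hev a)
  have h1 : VectorField.mlieBracket 𝓘(ℝ, E3) (S.frame j a) (S.frame j b) x =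
      ∑ d, (lie (S.frame j a) (fun y => rot S i j y d b) x • S.frame i d x +
        rot S i j x d b • VectorField.mlieBracket 𝓘(ℝ, E3) (S.frame j a) (S.frame i d) x) := by
    exact (hbr _ b).trans (mlieBracket_sum_right (fun d => hr d b) hf)
  have h2 : ∀ d, VectorField.mlieBracket 𝓘(ℝ, E3) (S.frame j a) (S.frame i d) x =
      ∑ c, (-lie (S.frame i d) (fun y => rot S i j y c a) x • S.frame i c x +
        rot S i j x c a • VectorField.mlieBracket 𝓘(ℝ, E3) (S.frame i c) (S.frame i d) x) := by
    intro d
    rw [VectorField.mlieBracket_swap_apply, hbr, mlieBracket_sum_right (fun d => hr d a) hf,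
      ← Finset.sum_neg_distrib]
    refine Finset.sum_congr rfl fun c _ => ?_
    rw [VectorField.mlieBracket_swap_apply (V := S.frame i c)]
    module
  have h3 : ∀ v, D.metric.inner x v (S.frame j m x) =
      ∑ k, rot S i j x k m * D.metric.inner x v (S.frame i k x) := by
    intro v
    rw [frame_eq_sum_rot (i := i) hi m, map_sum]
    simp only [map_smul, smul_eq_mul]
  have h4 : ∀ d k, D.metric.inner x (S.frame i d x) (S.frame i k x) = if d = k then 1 else 0 :=
    S.frame_orthonormal i x hi
  unfold structCoeff
  rw [h3, h1]
  simp only [h2, lie_frame_eq hi a]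
  simp only [Fin.sum_univ_three, map_add, map_smul, add_apply,
    smul_apply, smul_eq_mul, h4]
  simp
  ring

/-! ### Change of spin frame: the Dirac operator -/

/-- Entrywise derivative of a matrix-valued function. -/
def lieMat (X : (x : M) → TangentSpace 𝓘(ℝ, E3) x) (N : M → Matrix (Fin 2) (Fin 2) ℂ) (x : M) :
    Matrix (Fin 2) (Fin 2) ℂ := Matrix.of fun A B => lie X (fun y => N y A B) x

lemma lieMat_mul {X : (x : M) → TangentSpace 𝓘(ℝ, E3) x} {N P : M → Matrix (Fin 2) (Fin 2) ℂ}
    (hN : ∀ A B, DiffAt (fun y => N y A B) x) (hP : ∀ A B, DiffAt (fun y => P y A B) x) :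
    lieMat X (fun y => N y * P y) x = lieMat X N x * P x + N x * lieMat X P x := by
  ext A B
  simp only [lieMat, Matrix.of_apply, Matrix.add_apply, Matrix.mul_apply, Fin.sum_univ_two]
  rw [lie_add (diffAt_mul (hN A 0) (hP 0 B)) (diffAt_mul (hN A 1) (hP 1 B)), lie_mul (hN A 0) (hP 0 B),
    lie_mul (hN A 1) (hP 1 B)]
  ring

lemma lieMat_conjTranspose {X : (x : M) → TangentSpace 𝓘(ℝ, E3) x}
    {N : M → Matrix (Fin 2) (Fin 2) ℂ} (hN : ∀ A B, DiffAt (fun y => N y A B) x) :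
    lieMat X (fun y => (N y)ᴴ) x = (lieMat X N x)ᴴ := by
  ext A B
  exact lie_conj (hN B A)

lemma lieMat_congr {X : (x : M) → TangentSpace 𝓘(ℝ, E3) x} {N P : M → Matrix (Fin 2) (Fin 2) ℂ}
    (h : N =ᶠ[nhds x] P) : lieMat X N x = lieMat X P x := by
  ext A B
  exact lie_congr (h.mono fun y hy => by simp only [hy])

lemma lieMat_const {X : (x : M) → TangentSpace 𝓘(ℝ, E3) x} (N : Matrix (Fin 2) (Fin 2) ℂ) :
    lieMat X (fun _ => N) x = 0 := by
  ext A B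
  exact lie_const _

lemma lie_mulVec {X : (x : M) → TangentSpace 𝓘(ℝ, E3) x} {N : M → Matrix (Fin 2) (Fin 2) ℂ}
    {f : M → Fin 2 → ℂ} (hN : ∀ A B, DiffAt (fun y => N y A B) x) (hf : DiffAt f x)
    (hNf : DiffAt (fun y => N y *ᵥ f y) x) :
    lie X (fun y => N y *ᵥ f y) x = lieMat X N x *ᵥ f x + N x *ᵥ lie X f x := by
  have hc : ∀ A, DiffAt (fun y => f y A) x := fun A =>
    (ContinuousLinearMap.proj (R := ℝ) (φ := fun _ : Fin 2 => ℂ) A).mdifferentiableAt.comp x hf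
  ext A
  rw [lie_apply hNf]
  simp only [lieMat, Matrix.mulVec, dotProduct, Matrix.of_apply, Pi.add_apply, Fin.sum_univ_two]
  rw [lie_add (diffAt_mul (hN A 0) (hc 0)) (diffAt_mul (hN A 1) (hc 1)), lie_mul (hN A 0) (hc 0),
    lie_mul (hN A 1) (hc 1), lie_apply hf, lie_apply hf]
  ring

lemma conjTranspose_mul_g (hi : x ∈ S.U i) (hj : x ∈ S.U j) : (S.g i j x)ᴴ * S.g i j x = 1 :=
  (Matrix.mem_specialUnitaryGroup_iff.1 (S.g_mem i j x ⟨hi, hj⟩)).1.1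

lemma g_mul_conjTranspose (hi : x ∈ S.U i) (hj : x ∈ S.U j) : S.g i j x * (S.g i j x)ᴴ = 1 :=
  (Matrix.mem_specialUnitaryGroup_iff.1 (S.g_mem i j x ⟨hi, hj⟩)).1.2

lemma det_g (hi : x ∈ S.U i) (hj : x ∈ S.U j) : (S.g i j x).det = 1 :=
  (Matrix.mem_specialUnitaryGroup_iff.1 (S.g_mem i j x ⟨hi, hj⟩)).2

lemma conjTranspose_g (hi : x ∈ S.U i) (hj : x ∈ S.U j) :
    (S.g i j x)ᴴ = (S.g i j x).adjugate := by
  have h := Matrix.mul_adjugate (S.g i j x)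
  rw [det_g hi hj, one_smul] at h
  calc (S.g i j x)ᴴ = (S.g i j x)ᴴ * (S.g i j x * (S.g i j x).adjugate) := by
        rw [h, Matrix.mul_one]
    _ = _ := by rw [← Matrix.mul_assoc, conjTranspose_mul_g hi hj, Matrix.one_mul]

lemma smoothAt_g (hi : x ∈ S.U i) (hj : x ∈ S.U j) (A B : Fin 2) :
    SmoothAt (fun y => S.g i j y A B) x :=
  (S.g_contMDiffOn i j A B).contMDiffAt
    (((S.isOpen_U i).inter (S.isOpen_U j)).mem_nhds ⟨hi, hj⟩)

lemma eventually_mem_inter (hi : x ∈ S.U i) (hj : x ∈ S.U j) :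
    ∀ᶠ y in nhds x, y ∈ S.U i ∧ y ∈ S.U j :=
  ((S.isOpen_U i).inter (S.isOpen_U j)).mem_nhds ⟨hi, hj⟩

/-- The hypotheses of `mul_spinTerm_of_cover` are the derivatives of pointwise identities:
orthogonality of the rotation, the covering relation, unitarity and `det g = 1`. -/
lemma g_mul_spinTerm (hi : x ∈ S.U i) (hj : x ∈ S.U j) :
    S.g i j x * spinTerm (fun a b m => (structCoeff D (S.frame j) x a b m : ℂ)) =
      spinTerm (fun a b m => (structCoeff D (S.frame i) x a b m : ℂ)) * S.g i j x +
        ∑ c, sig c * lieMat (S.frame i c) (S.g i j) x := by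
  have hg : ∀ A B, DiffAt (fun y => S.g i j y A B) x := fun A B => (smoothAt_g hi hj A B).diffAt
  have hgH : ∀ A B, DiffAt (fun y => (S.g i j y)ᴴ A B) x := fun A B =>
    (Complex.conjCLE : ℂ →L[ℝ] ℂ).mdifferentiableAt.comp x (hg B A)
  have hr : ∀ b a, DiffAt (fun y => rot S i j y b a) x := fun b a => (smoothAt_rot hi hj b a).diffAt
  have hev := eventually_mem_inter hi hj
  refine mul_spinTerm_of_cover (conjTranspose_mul_g hi hj)
    (R := fun b a => (rot S i j x b a : ℂ))
    (P := fun c b a => ((lie (S.frame i c) (fun y => rot S i j y b a) x : ℝ) : ℂ))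
    ?_ (fun a => S.g_covers i j x ⟨hi, hj⟩ a) ?_ (fun c a => ?_) (fun c => ?_) (fun c => ?_) ?_
  · exact ofReal_rot_mul_rot hi hj
  · intro c d k
    have h1 : lie (S.frame i c) (fun y => ∑ a, rot S i j y d a * rot S i j y k a) x = 0 := by
      rw [lie_congr (g := fun _ => if d = k then 1 else 0), lie_const]
      filter_upwards [hev] with y hy using rot_mul_rot hy.1 hy.2 d k
    rw [lie_sum _ fun a _ => diffAt_mul (hr d a) (hr k a)] at h1
    simp only [lie_mul (hr d _) (hr k _), Finset.sum_add_distrib] at h1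
    have h2 := eq_neg_of_add_eq_zero_left h1
    have h3 := congrArg (fun r : ℝ => (r : ℂ)) h2
    push_cast at h3
    rw [h3]
    simp only [mul_comm]
  · have h1 : (fun y => S.g i j y * sig a * (S.g i j y)ᴴ) =ᶠ[nhds x]
        fun y => ∑ b, (rot S i j y b a : ℂ) • sig b := by
      filter_upwards [hev] with y hy using S.g_covers i j y hy a
    have h2 := lieMat_congr (X := S.frame i c) h1
    have hgs : ∀ A B, DiffAt (fun y => (S.g i j y * sig a) A B) x := by
      intro A B
      simp only [Matrix.mul_apply, Fin.sum_univ_two]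
      exact ((hg A 0).mul mdifferentiableAt_const).add ((hg A 1).mul mdifferentiableAt_const)
    rw [lieMat_mul hgs hgH, lieMat_mul (P := fun _ => sig a) hg (fun _ _ => diffAt_const _), lieMat_const,
      Matrix.mul_zero, add_zero, lieMat_conjTranspose hg] at h2
    rw [h2]
    ext A B
    simp only [lieMat, Matrix.of_apply, Matrix.sum_apply, Matrix.smul_apply, smul_eq_mul]
    have hrc : ∀ b, DiffAt (fun y => (rot S i j y b a : ℂ)) x := fun b =>
      Complex.ofRealCLM.mdifferentiableAt.comp x (hr b a)
    rw [lie_sum _ fun b _ => diffAt_mul (hrc b) (diffAt_const _)]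
    refine Finset.sum_congr rfl fun b _ => ?_
    rw [lie_mul (hrc b) (diffAt_const _), lie_const, mul_zero, add_zero,
      lie_ofReal (hr b a)]
  · have h1 : (fun y => S.g i j y * (S.g i j y)ᴴ) =ᶠ[nhds x] fun _ => 1 := by
      filter_upwards [hev] with y hy using g_mul_conjTranspose hy.1 hy.2
    have h2 := lieMat_congr (X := S.frame i c) h1
    rwa [lieMat_mul hg hgH, lieMat_const, lieMat_conjTranspose hg] at h2
  -- Since `gᴴ` is the adjugate of `g`, the trace of `(∂g) gᴴ` is the derivative of `det g = 1`.
  · have h1 : (fun y => S.g i j y 0 0 * S.g i j y 1 1 - S.g i j y 0 1 * S.g i j y 1 0)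
        =ᶠ[nhds x] fun _ => 1 := by
      filter_upwards [hev] with y hy
      rw [← Matrix.det_fin_two, det_g hy.1 hy.2]
    have h2 := lie_congr (X := S.frame i c) h1
    rw [lie_sub (diffAt_mul (hg 0 0) (hg 1 1)) (diffAt_mul (hg 0 1) (hg 1 0)), lie_mul (hg 0 0) (hg 1 1),
      lie_mul (hg 0 1) (hg 1 0), lie_const] at h2
    rw [conjTranspose_g hi hj, Matrix.adjugate_fin_two, Matrix.trace_fin_two]
    simp only [lieMat, Matrix.mul_apply, Fin.sum_univ_two, Matrix.of_apply, Matrix.cons_val_zero,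
      Matrix.cons_val_one, Matrix.cons_val_fin_one, Matrix.cons_val', Matrix.empty_val']
    linear_combination h2
  · intro a b m
    rw [structCoeff_change hi hj]
    push_cast
    rfl

lemma meanCurv_change (hi : x ∈ S.U i) (hj : x ∈ S.U j) :
    meanCurv D (S.frame j) x = meanCurv D (S.frame i) x := by
  have h : ∀ c d, ∑ a, rot S i j x c a * rot S i j x d a = if c = d then 1 else 0 :=
    rot_mul_rot hi hj
  unfold meanCurv
  calc ∑ a, D.chi x (S.frame j a x) (S.frame j a x)
      = ∑ c, ∑ d, (∑ a, rot S i j x c a * rot S i j x d a) *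
          D.chi x (S.frame i c x) (S.frame i d x) := by
        simp only [frame_eq_sum_rot (i := i) (j := j) hi]
        simp only [Fin.sum_univ_three, map_add, map_smul, add_apply, smul_apply, smul_eq_mul]
        ring
    _ = _ := by simp [h]

/-- The covering relation rotates the Pauli matrices exactly as the frame rotates, so the principal
part is covariant. The leftover derivative of `g` is compensated by `g_mul_spinTerm`. -/
lemma diracOp_change (hi : x ∈ S.U i) (hj : x ∈ S.U j) {f f' : M → Fin 2 → ℂ}
    (hf : DiffAt f x) (hf' : DiffAt f' x) (h : f =ᶠ[nhds x] fun y => S.g i j y *ᵥ f' y) :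
    diracOp D (S.frame i) f x = S.g i j x *ᵥ diracOp D (S.frame j) f' x := by
  have hg : ∀ A B, DiffAt (fun y => S.g i j y A B) x := fun A B => (smoothAt_g hi hj A B).diffAt
  have hgf : DiffAt (fun y => S.g i j y *ᵥ f' y) x := hf.congr_of_eventuallyEq h.symm
  have hcov : ∀ a, S.g i j x * sig a = ∑ b, (rot S i j x b a : ℂ) • (sig b * S.g i j x) := by
    intro a
    have := congrArg (fun N => N * S.g i j x) (S.g_covers i j x ⟨hi, hj⟩ a)
    simp only [Matrix.mul_assoc, conjTranspose_mul_g hi hj, Matrix.mul_one, Finset.sum_mul,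
      Matrix.smul_mul] at this
    exact this
  have hsum : ∑ a, S.g i j x *ᵥ (sig a *ᵥ lie (S.frame j a) f' x) =
      ∑ c, sig c *ᵥ (S.g i j x *ᵥ lie (S.frame i c) f' x) := by
    have h0 := ofReal_rot_mul_rot hi hj
    calc ∑ a, S.g i j x *ᵥ (sig a *ᵥ lie (S.frame j a) f' x)
        = ∑ b, ∑ c, (∑ a, (rot S i j x b a : ℂ) * rot S i j x c a) •
            (sig b *ᵥ (S.g i j x *ᵥ lie (S.frame i c) f' x)) := by
          have hl : ∀ a, lie (S.frame j a) f' x =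
              ∑ c, (rot S i j x c a : ℂ) • lie (S.frame i c) f' x := by
            intro a
            rw [lie_frame_eq hi a]
            rfl
          simp only [Matrix.mulVec_mulVec, hcov, hl, Matrix.sum_mulVec, Matrix.smul_mulVec]
          simp only [Fin.sum_univ_three, Matrix.mulVec_add, Matrix.mulVec_smul]
          module
      _ = _ := by simp [h0]
  have hlie : ∀ c, lie (S.frame i c) f x = lieMat (S.frame i c) (S.g i j) x *ᵥ f' x +
      S.g i j x *ᵥ lie (S.frame i c) f' x := fun c => by
    rw [lie_congr h, lie_mulVec hg hf' hgf]
  unfold diracOp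
  rw [Matrix.mulVec_add, Matrix.mulVec_mulVec, g_mul_spinTerm hi hj, Matrix.mulVec_sum, hsum,
    h.eq_of_nhds]
  simp only [hlie, Matrix.mulVec_add, Finset.sum_add_distrib, Matrix.add_mulVec,
    Matrix.sum_mulVec, ← Matrix.mulVec_mulVec]
  abel

lemma senOp_change (hi : x ∈ S.U i) (hj : x ∈ S.U j) {f f' : M → Fin 2 → ℂ}
    (hf : DiffAt f x) (hf' : DiffAt f' x) (h : f =ᶠ[nhds x] fun y => S.g i j y *ᵥ f' y) :
    senOp D (S.frame i) f x = S.g i j x *ᵥ senOp D (S.frame j) f' x := by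
  simp only [senOp, diracOp_change hi hj hf hf' h, meanCurv_change hi hj, h.eq_of_nhds,
    Matrix.mulVec_sub, Matrix.mulVec_smul]

end

/-! ### The Sen–Witten operators on spinor fields -/

section

variable {M : Type*} [TopologicalSpace M] [ChartedSpace E3 M] [IsManifold 𝓘(ℝ, E3) ∞ M]
  {D : InitialData M} {ι : Type*} {S : SpinStructure D ι} {x : M} {i j : ι}

lemma smoothAt_const {F : Type*} [NormedAddCommGroup F] [NormedSpace ℝ F] (c : F) :
    SmoothAt (fun _ : M => c) x := contMDiffAt_const

lemma SmoothAt.clm {F G : Type*} [NormedAddCommGroup F] [NormedSpace ℝ F] [NormedAddCommGroup G]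
    [NormedSpace ℝ G] (L : F →L[ℝ] G) {f : M → F} (hf : SmoothAt f x) :
    SmoothAt (fun y => L (f y)) x := L.contMDiff.contMDiffAt.comp x hf

lemma SmoothAt.comp_apply {f : M → Fin 2 → ℂ} (hf : SmoothAt f x) (A : Fin 2) :
    SmoothAt (fun y => f y A) x :=
  hf.clm (ContinuousLinearMap.proj (R := ℝ) (φ := fun _ : Fin 2 => ℂ) A)

lemma smoothAt_mul {A : Type*} [NormedCommRing A] [NormedAlgebra ℝ A] {f g : M → A}
    (hf : SmoothAt f x) (hg : SmoothAt g x) : SmoothAt (fun y => f y * g y) x := by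
  have : ContDiff ℝ ∞ (fun p : A × A => p.1 * p.2) := contDiff_mul
  exact this.contMDiff.contMDiffAt.comp x (hf.prodMk_space hg)

lemma smoothAt_add {F : Type*} [NormedAddCommGroup F] [NormedSpace ℝ F] {f g : M → F}
    (hf : SmoothAt f x) (hg : SmoothAt g x) : SmoothAt (fun y => f y + g y) x := hf.add hg

lemma smoothAt_sum {F : Type*} [NormedAddCommGroup F] [NormedSpace ℝ F] {α : Type*}
    (s : Finset α) {f : α → M → F} (hf : ∀ a, SmoothAt (f a) x) :
    SmoothAt (fun y => ∑ a ∈ s, f a y) x := by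
  classical
  induction s using Finset.induction_on with
  | empty => simpa using smoothAt_const (0 : F)
  | insert a s ha ih =>
    simp only [Finset.sum_insert ha]
    exact smoothAt_add (hf a) ih

lemma SmoothAt.ofReal {f : M → ℝ} (hf : SmoothAt f x) : SmoothAt (fun y => (f y : ℂ)) x :=
  hf.clm Complex.ofRealCLM

lemma SmoothAt.conj {f : M → ℂ} (hf : SmoothAt f x) : SmoothAt (fun y => conj (f y)) x :=
  hf.clm (Complex.conjCLE : ℂ →L[ℝ] ℂ)

lemma smoothAt_pi {f : M → Fin 2 → ℂ} (hf : ∀ A, SmoothAt (fun y => f y A) x) : SmoothAt f x :=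
  contMDiffAt_pi_space.2 hf

lemma SmoothAt.mulVec {N : M → Matrix (Fin 2) (Fin 2) ℂ} {f : M → Fin 2 → ℂ}
    (hN : ∀ A B, SmoothAt (fun y => N y A B) x) (hf : SmoothAt f x) :
    SmoothAt (fun y => N y *ᵥ f y) x :=
  smoothAt_pi fun A => smoothAt_sum Finset.univ fun B => smoothAt_mul (hN A B) (hf.comp_apply B)

lemma SmoothAt.csmul {r : M → ℂ} {f : M → Fin 2 → ℂ} (hr : SmoothAt r x) (hf : SmoothAt f x) :
    SmoothAt (fun y => r y • f y) x :=
  smoothAt_pi fun A => smoothAt_mul hr (hf.comp_apply A)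

lemma smoothAt_spinTerm (hx : x ∈ S.U i) (A B : Fin 2) :
    SmoothAt (fun y => spinTerm (fun a b k => (structCoeff D (S.frame i) y a b k : ℂ)) A B) x := by
  have h := fun a b k => (smoothAt_structCoeff S i hx a b k).ofReal
  simp only [spinTerm_eq_tri, Matrix.sum_apply, Matrix.smul_apply, smul_eq_mul]
  exact smoothAt_sum _ fun a => smoothAt_sum _ fun b => smoothAt_sum _ fun k =>
    smoothAt_mul (h a b k) (smoothAt_const _)

lemma smoothAt_meanCurv (hx : x ∈ S.U i) : SmoothAt (meanCurv D (S.frame i)) x :=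
  smoothAt_sum _ fun a => smoothAt_chi D (smoothFieldAt_frame S i a hx)
    (smoothFieldAt_frame S i a hx)

lemma SmoothAt.senOp (hx : x ∈ S.U i) {f : M → Fin 2 → ℂ} (hf : SmoothAt f x) :
    SmoothAt (senOp D (S.frame i) f) x := by
  refine ContMDiffAt.sub (smoothAt_add (smoothAt_sum _ fun a => ?_) ?_) ?_
  · exact SmoothAt.mulVec (fun _ _ => smoothAt_const _) (hf.lie (smoothFieldAt_frame S i a hx))
  · exact SmoothAt.mulVec (smoothAt_spinTerm hx) hf
  · exact SmoothAt.csmul (smoothAt_mul (smoothAt_const _) (smoothAt_meanCurv hx).ofReal) hf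

lemma smoothAt_spinor (f : SpinorField S) (hx : x ∈ S.U i) : SmoothAt (f.1 i) x :=
  (f.2.1 i).contMDiffAt ((S.isOpen_U i).mem_nhds hx)

lemma spinor_change (f : SpinorField S) (hi : x ∈ S.U i) (hj : x ∈ S.U j) :
    f.1 i x = S.g i j x *ᵥ f.1 j x := f.2.2.1 i j x ⟨hi, hj⟩

lemma eventually_spinor_change (f : SpinorField S) (hi : x ∈ S.U i) (hj : x ∈ S.U j) :
    f.1 i =ᶠ[nhds x] fun y => S.g i j y *ᵥ f.1 j y := by
  filter_upwards [eventually_mem_inter hi hj] with y hy using spinor_change f hy.1 hy.2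

lemma SpinorField.ext_on {f h : SpinorField S} (H : ∀ i, ∀ x ∈ S.U i, f.1 i x = h.1 i x) :
    f = h := by
  refine Subtype.ext (funext fun i => funext fun x => ?_)
  by_cases hx : x ∈ S.U i
  · exact H i x hx
  · rw [f.2.2.2 i x hx, h.2.2.2 i x hx]

open Classical in
/-- The spinor field with given components in the domains of the gauges. -/
def SpinorField.ofLocal (f : ι → M → Fin 2 → ℂ) (hf : ∀ i, ∀ x ∈ S.U i, SmoothAt (f i) x)
    (hg : ∀ i j x, x ∈ S.U i → x ∈ S.U j → f i x = S.g i j x *ᵥ f j x) : SpinorField S :=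
  ⟨fun i => (S.U i).indicator (f i), fun i x hx => by
      refine ContMDiffAt.contMDiffWithinAt ((hf i x hx).congr_of_eventuallyEq ?_)
      filter_upwards [(S.isOpen_U i).mem_nhds hx] with y hy
      exact Set.indicator_of_mem hy _,
    fun i j x hx => by
      change (S.U i).indicator (f i) x = S.g i j x *ᵥ (S.U j).indicator (f j) x
      rw [Set.indicator_of_mem hx.1, Set.indicator_of_mem hx.2]
      exact hg i j x hx.1 hx.2,
    fun i x hx => Set.indicator_of_notMem hx _⟩

lemma SpinorField.ofLocal_apply (f : ι → M → Fin 2 → ℂ)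
    (hf : ∀ i, ∀ x ∈ S.U i, SmoothAt (f i) x)
    (hg : ∀ i j x, x ∈ S.U i → x ∈ S.U j → f i x = S.g i j x *ᵥ f j x) (hx : x ∈ S.U i) :
    (SpinorField.ofLocal f hf hg).1 i x = f i x := Set.indicator_of_mem hx _

lemma diracOp_congr {e : Fin 3 → (x : M) → TangentSpace 𝓘(ℝ, E3) x} {f h : M → Fin 2 → ℂ}
    (H : f =ᶠ[nhds x] h) : diracOp D e f x = diracOp D e h x := by
  simp only [diracOp, lie_congr H, H.eq_of_nhds]

lemma senAdj_congr {e : Fin 3 → (x : M) → TangentSpace 𝓘(ℝ, E3) x} {f h : M → Fin 2 → ℂ}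
    (H : f =ᶠ[nhds x] h) : senAdj D e f x = senAdj D e h x := by
  simp only [senAdj, diracOp_congr H, H.eq_of_nhds]

lemma diracOp_add {e : Fin 3 → (x : M) → TangentSpace 𝓘(ℝ, E3) x} {f h : M → Fin 2 → ℂ}
    (hf : DiffAt f x) (hh : DiffAt h x) :
    diracOp D e (fun y => f y + h y) x = diracOp D e f x + diracOp D e h x := by
  simp only [diracOp, lie_add hf hh, Matrix.mulVec_add, Finset.sum_add_distrib]
  abel

lemma diracOp_smul {e : Fin 3 → (x : M) → TangentSpace 𝓘(ℝ, E3) x} (c : ℂ) {f : M → Fin 2 → ℂ}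
    (hf : DiffAt f x) : diracOp D e (fun y => c • f y) x = c • diracOp D e f x := by
  simp only [diracOp, lie_const_smul c hf, Matrix.mulVec_smul, ← Finset.smul_sum, smul_add]

lemma senOp_add {e : Fin 3 → (x : M) → TangentSpace 𝓘(ℝ, E3) x} {f h : M → Fin 2 → ℂ}
    (hf : DiffAt f x) (hh : DiffAt h x) :
    senOp D e (fun y => f y + h y) x = senOp D e f x + senOp D e h x := by
  simp only [senOp, diracOp_add hf hh]
  module

lemma senOp_smul {e : Fin 3 → (x : M) → TangentSpace 𝓘(ℝ, E3) x} (c : ℂ) {f : M → Fin 2 → ℂ}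
    (hf : DiffAt f x) : senOp D e (fun y => c • f y) x = c • senOp D e f x := by
  simp only [senOp, diracOp_smul c hf]
  module

lemma senAdj_smul {e : Fin 3 → (x : M) → TangentSpace 𝓘(ℝ, E3) x} (c : ℂ) {f : M → Fin 2 → ℂ}
    (hf : DiffAt f x) : senAdj D e (fun y => c • f y) x = c • senAdj D e f x := by
  simp only [senAdj, diracOp_smul c hf]
  module

variable (S) in
/-- The operator `√2 𝒟_{A'A}` on spinor fields. -/
def senField : SpinorField S →ₗ[ℂ] SpinorField S where
  toFun f := SpinorField.ofLocal (fun i => senOp D (S.frame i) (f.1 i))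
    (fun _ _ hx => (smoothAt_spinor f hx).senOp hx)
    (fun _ _ _ hi hj => senOp_change hi hj (smoothAt_spinor f hi).diffAt (smoothAt_spinor f hj).diffAt
      (eventually_spinor_change f hi hj))
  map_add' f h := SpinorField.ext_on fun i x hx => by
    rw [SpinorField.ofLocal_apply _ _ _ hx]
    refine (senOp_add (smoothAt_spinor f hx).diffAt (smoothAt_spinor h hx).diffAt).trans ?_
    change _ = (SpinorField.ofLocal _ _ _).1 i x + (SpinorField.ofLocal _ _ _).1 i x
    rw [SpinorField.ofLocal_apply _ _ _ hx, SpinorField.ofLocal_apply _ _ _ hx]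
  map_smul' c f := SpinorField.ext_on fun i x hx => by
    rw [SpinorField.ofLocal_apply _ _ _ hx]
    refine (senOp_smul c (smoothAt_spinor f hx).diffAt).trans ?_
    change _ = c • (SpinorField.ofLocal _ _ _).1 i x
    rw [SpinorField.ofLocal_apply _ _ _ hx]

lemma senField_apply (f : SpinorField S) (hx : x ∈ S.U i) :
    (senField S f).1 i x = senOp D (S.frame i) (f.1 i) x := Set.indicator_of_mem hx _

/-- For matrices in SU(2) the conjugate transpose is the adjugate; this makes charge conjugation
independent of the gauge. -/
lemma cc_g_mulVec (hi : x ∈ S.U i) (hj : x ∈ S.U j) (v : Fin 2 → ℂ) :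
    cc (S.g i j x *ᵥ v) = S.g i j x *ᵥ cc v := by
  have h := conjTranspose_g hi hj
  rw [Matrix.adjugate_fin_two] at h
  have h00 := congrFun (congrFun h 0) 0
  have h01 := congrFun (congrFun h 0) 1
  have h10 := congrFun (congrFun h 1) 0
  have h11 := congrFun (congrFun h 1) 1
  simp [Matrix.conjTranspose_apply] at h00 h01 h10 h11
  ext A
  fin_cases A <;> simp [cc_apply, Matrix.mulVec, dotProduct, h00, h01, h10, h11]; ring

variable (S) in
/-- Charge conjugation of spinor fields. -/
def ccField : SpinorField S →ₛₗ[starRingEnd ℂ] SpinorField S where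
  toFun f := SpinorField.ofLocal (fun i x => cc (f.1 i x))
    (fun _ _ hx => (smoothAt_spinor f hx).clm cc)
    (fun _ _ _ hi hj => by rw [spinor_change f hi hj, cc_g_mulVec hi hj])
  map_add' f h := SpinorField.ext_on fun i x hx => by
    change _ = (SpinorField.ofLocal _ _ _).1 i x + (SpinorField.ofLocal _ _ _).1 i x
    rw [SpinorField.ofLocal_apply _ _ _ hx, SpinorField.ofLocal_apply _ _ _ hx,
      SpinorField.ofLocal_apply _ _ _ hx]
    exact map_add cc _ _
  map_smul' c f := SpinorField.ext_on fun i x hx => by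
    change _ = conj c • (SpinorField.ofLocal _ _ _).1 i x
    rw [SpinorField.ofLocal_apply _ _ _ hx, SpinorField.ofLocal_apply _ _ _ hx]
    exact cc_smul _ _

lemma ccField_apply (f : SpinorField S) (hx : x ∈ S.U i) :
    (ccField S f).1 i x = cc (f.1 i x) :=
  Set.indicator_of_mem hx fun x => cc (f.1 i x)

lemma ccField_ccField (f : SpinorField S) : ccField S (ccField S f) = -f :=
  SpinorField.ext_on fun i x hx => by
    rw [ccField_apply _ hx, ccField_apply _ hx, cc_cc]
    rfl

variable (S) in
/-- The operator `√2 𝒟^{AA'}` on spinor fields. -/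
def adjField : SpinorField S →ₗ[ℂ] SpinorField S where
  -- Conjugating by charge conjugation makes smoothness and gauge covariance automatic;
  -- `adjField_apply` recovers the local formula. The sign compensates `J² = -1`.
  toFun f := - ccField S (senField S (ccField S f))
  map_add' f h := by simp only [map_add, neg_add]
  map_smul' c f := by
    rw [LinearMap.map_smulₛₗ, map_smul, LinearMap.map_smulₛₗ]
    simp

lemma adjField_def (f : SpinorField S) : adjField S f = - ccField S (senField S (ccField S f)) :=
  rfl

lemma adjField_apply (f : SpinorField S) (hx : x ∈ S.U i) :
    (adjField S f).1 i x = senAdj D (S.frame i) (f.1 i) x := by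
  have h1 : (ccField S f).1 i =ᶠ[nhds x] fun y => cc (f.1 i y) := by
    filter_upwards [(S.isOpen_U i).mem_nhds hx] with y hy using ccField_apply f hy
  have h2 : senOp D (S.frame i) ((ccField S f).1 i) x = cc (senAdj D (S.frame i) (f.1 i) x) := by
    rw [← senOp_cc D _ (smoothAt_spinor f hx).diffAt]
    simp only [senOp, diracOp_congr h1, h1.eq_of_nhds]
  change -(ccField S (senField S (ccField S f))).1 i x = _
  rw [ccField_apply _ hx, senField_apply _ hx, h2, cc_cc, neg_neg]

lemma adjField_ccField (f : SpinorField S) : adjField S (ccField S f) = ccField S (senField S f) := by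
  rw [adjField_def, ccField_ccField, map_neg, map_neg, neg_neg]

lemma senField_ccField (f : SpinorField S) : senField S (ccField S f) = ccField S (adjField S f) := by
  rw [adjField_def, map_neg, ccField_ccField, neg_neg]

lemma wittenSq_eq (f : SpinorField S) (hx : x ∈ S.U i) :
    wittenSq D (S.frame i) (f.1 i) x = (adjField S (senField S f)).1 i x := by
  have h1 : wittenUp D (S.frame i) (f.1 i) =ᶠ[nhds x] fun y => rt • (senField S f).1 i y := by
    filter_upwards [(S.isOpen_U i).mem_nhds hx] with y hy
    rw [wittenUp_eq, senField_apply f hy]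
  rw [wittenSq, wittenDownPrimed_eq, senAdj_congr h1,
    senAdj_smul _ (smoothAt_spinor (senField S f) hx).diffAt, adjField_apply _ hx, smul_smul, smul_smul,
    mul_assoc, rt_mul_rt]
  norm_num

lemma solvesEigenEq_iff (c : ℂ) (f : SpinorField S) :
    SolvesEigenEq S c f ↔ adjField S (senField S f) = c • f := by
  constructor
  · intro h
    refine SpinorField.ext_on fun i x hx => ?_
    rw [← wittenSq_eq f hx, h i x hx]
    rfl
  · intro h i x hx
    rw [wittenSq_eq f hx, h]
    rfl

lemma div_sqrt_two (α : ℂ) : α / ((√2 : ℝ) : ℂ) = rt * α := by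
  rw [← inv_sqrt_two]; ring

/-- Everything is moved to unprimed spinors. The second equation has to be conjugated for this,
whence `conj α` and its sign. -/
lemma solvesDiracEq_iff (α : ℂ) (f m : SpinorField S) :
    SolvesDiracEq S α f m ↔ Complex.I • senField S f = -α • ccField S m ∧
      Complex.I • senField S m = conj α • ccField S f := by
  have key : ∀ i, ∀ x ∈ S.U i,
      ((Complex.I • wittenUp D (S.frame i) (f.1 i) x = (α / (√2 : ℝ)) • lower (bar (m.1 i x)) ↔
        Complex.I • (senField S f).1 i x = -α • (ccField S m).1 i x) ∧
      (Complex.I • wittenUpPrimed D (S.frame i) (fun y => bar (m.1 i y)) x =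
        (α / (√2 : ℝ)) • lower (f.1 i x) ↔
        Complex.I • (senField S m).1 i x = conj α • (ccField S f).1 i x)) := by
    intro i x hx
    constructor
    · rw [wittenUp_eq, div_sqrt_two, lower_bar, ← ccField_apply m hx, ← senField_apply f hx,
        smul_comm, mul_smul, (smul_right_injective _ rt_ne_zero).eq_iff, smul_neg, neg_smul]
    · rw [wittenUpPrimed_bar D _ (smoothAt_spinor m hx).diffAt, div_sqrt_two, ← senField_apply m hx,
        smul_comm, mul_smul, (smul_right_injective _ rt_ne_zero).eq_iff]
      have h1 : lower (f.1 i x) = - bar ((ccField S f).1 i x) := by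
        rw [ccField_apply f hx]
        ext A
        fin_cases A <;> simp [cc_apply, bar, lower, eps]
      rw [h1, ← bar_injective.eq_iff, smul_neg, ← neg_smul, bar_smul, bar_smul, bar_bar, bar_bar,
        Complex.conj_I, map_neg, neg_smul, neg_smul, neg_inj]
  constructor
  · intro h
    exact ⟨SpinorField.ext_on fun i x hx => (key i x hx).1.1 (h i x hx).1,
      SpinorField.ext_on fun i x hx => (key i x hx).2.1 (h i x hx).2⟩
  · rintro ⟨h1, h2⟩ i x hx
    exact ⟨(key i x hx).1.2 (congrFun (congrFun (congrArg Subtype.val h1) i) x),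
      (key i x hx).2.2 (congrFun (congrFun (congrArg Subtype.val h2) i) x)⟩

lemma isPartner_iff {α : ℝ} (hα : α ≠ 0) (f m : SpinorField S) :
    IsPartner S α f m ↔ m = (-Complex.I / α) • ccField S (senField S f) := by
  have hr : ((√2 / α : ℝ) : ℂ) * rt = 1 / α := by
    unfold rt
    rw [← Complex.ofReal_mul]
    have : √2 / α * (1 / √2) = 1 / α := by field_simp
    rw [this]
    push_cast
    rfl
  have key : ∀ i, ∀ x ∈ S.U i, (-Complex.I * ((√2 / α : ℝ) : ℂ)) •
      raise (wittenUpPrimed D (S.frame i) (fun y => bar (f.1 i y)) x) =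
      (-Complex.I / α) • (ccField S (senField S f)).1 i x := by
    intro i x hx
    rw [wittenUpPrimed_bar D _ (smoothAt_spinor f hx).diffAt, ccField_apply _ hx,
      senField_apply f hx, cc_def]
    unfold raise
    rw [Matrix.mulVec_smul, smul_smul, mul_assoc, hr, mul_one_div]
  constructor
  · intro h
    exact SpinorField.ext_on fun i x hx => (h i x hx).trans (key i x hx)
  · intro h i x hx
    rw [key i x hx, h]
    rfl

end

/-! ### Integration over a coordinate patch -/

section Chart

open MeasureTheory

variable {M : Type*} [TopologicalSpace M] [ChartedSpace E3 M] [IsManifold 𝓘(ℝ, E3) ∞ M]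
  {F : Type*} [NormedAddCommGroup F] [NormedSpace ℝ F]
  {G : Type*} [NormedAddCommGroup G] [NormedSpace ℝ G]

/-- The coordinate expression of a function, extended by zero. -/
def ext (p : M) (w : M → F) : E3 → F :=
  (chartAt E3 p).target.indicator (w ∘ (chartAt E3 p).symm)

variable {p : M} {w : M → F} {x : M} {X : (x : M) → TangentSpace 𝓘(ℝ, E3) x}

lemma ext_chart (hx : x ∈ (chartAt E3 p).source) : ext p w (chartAt E3 p x) = w x := by
  rw [ext, Set.indicator_of_mem ((chartAt E3 p).map_source hx), Function.comp_apply,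
    (chartAt E3 p).left_inv hx]

lemma ext_of_mem {y : E3} (hy : y ∈ (chartAt E3 p).target) :
    ext p w y = w ((chartAt E3 p).symm y) := Set.indicator_of_mem hy _

lemma ext_of_notMem {y : E3} (hy : y ∉ (chartAt E3 p).target) : ext p w y = 0 :=
  Set.indicator_of_notMem hy _

lemma smoothAt_chart (hx : x ∈ (chartAt E3 p).source) : SmoothAt (chartAt E3 p : M → E3) x :=
  (contMDiffOn_chart (I := 𝓘(ℝ, E3)) (n := ∞) (x := p)).contMDiffAt
    ((chartAt E3 p).open_source.mem_nhds hx)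

lemma contMDiffAt_chart_symm {y : E3} (hy : y ∈ (chartAt E3 p).target) :
    ContMDiffAt 𝓘(ℝ, E3) 𝓘(ℝ, E3) ∞ (chartAt E3 p).symm y :=
  (contMDiffOn_chart_symm (I := 𝓘(ℝ, E3)) (n := ∞) (x := p)).contMDiffAt
    ((chartAt E3 p).open_target.mem_nhds hy)

lemma eventually_ext_eq {y : E3} (hy : y ∈ (chartAt E3 p).target) :
    ext p w =ᶠ[nhds y] w ∘ (chartAt E3 p).symm := by
  filter_upwards [(chartAt E3 p).open_target.mem_nhds hy] with z hz using ext_of_mem hz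

lemma contDiffAt_ext (hx : x ∈ (chartAt E3 p).source) (hw : SmoothAt w x) :
    ContDiffAt ℝ ∞ (ext p w) (chartAt E3 p x) := by
  have hy := (chartAt E3 p).map_source hx
  refine ContDiffAt.congr_of_eventuallyEq ?_ (eventually_ext_eq hy)
  rw [← contMDiffAt_iff_contDiffAt]
  refine ContMDiffAt.comp (I' := 𝓘(ℝ, E3)) _ ?_ (contMDiffAt_chart_symm hy)
  rwa [(chartAt E3 p).left_inv hx]

lemma support_ext_subset : Function.support (ext p w) ⊆ chartAt E3 p '' Function.support w := by
  intro y hy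
  have hyt : y ∈ (chartAt E3 p).target := by
    by_contra h
    exact hy (ext_of_notMem h)
  refine ⟨(chartAt E3 p).symm y, ?_, (chartAt E3 p).right_inv hyt⟩
  rwa [Function.mem_support, ext_of_mem hyt] at hy

lemma lie_comp {f : M → F} {g : F → G} (hf : DiffAt f x) (hg : DifferentiableAt ℝ g (f x)) :
    lie X (fun y => g (f y)) x = fderiv ℝ g (f x) (lie X f x) := by
  have := (hg.mdifferentiableAt.hasMFDerivAt.comp x hf.hasMFDerivAt).mfderiv
  unfold lie
  rw [show (fun y => g (f y)) = g ∘ f from rfl, this, mfderiv_eq_fderiv]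
  rfl

/-- The chain rule: `lie X (chartAt E3 p) x` is the coordinate vector of `X x`. This converts
coordinate derivatives to frame derivatives. -/
lemma fderiv_ext_lie (hx : x ∈ (chartAt E3 p).source) (hw : SmoothAt w x) :
    fderiv ℝ (ext p w) (chartAt E3 p x) (lie X (chartAt E3 p) x) = lie X w x := by
  rw [← lie_comp (smoothAt_chart hx).diffAt
    ((contDiffAt_ext hx hw).differentiableAt (by simp))]
  refine lie_congr ?_
  filter_upwards [(chartAt E3 p).open_source.mem_nhds hx] with z hz using ext_chart hz

variable [CompactSpace M]

lemma isCompact_image_tsupport (hs : tsupport w ⊆ (chartAt E3 p).source) :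
    IsCompact (chartAt E3 p '' tsupport w) :=
  (isClosed_tsupport w).isCompact.image_of_continuousOn ((chartAt E3 p).continuousOn.mono hs)

lemma tsupport_ext_subset (hs : tsupport w ⊆ (chartAt E3 p).source) :
    tsupport (ext p w) ⊆ chartAt E3 p '' tsupport w :=
  closure_minimal (support_ext_subset.trans (Set.image_mono subset_closure))
    (isCompact_image_tsupport hs).isClosed

lemma hasCompactSupport_ext (hs : tsupport w ⊆ (chartAt E3 p).source) :
    HasCompactSupport (ext p w) :=
  (isCompact_image_tsupport hs).of_isClosed_subset (isClosed_tsupport _) (tsupport_ext_subset hs)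

lemma contDiff_ext (hw : ∀ x, SmoothAt w x) (hs : tsupport w ⊆ (chartAt E3 p).source) :
    ContDiff ℝ ∞ (ext p w) := by
  rw [contDiff_iff_contDiffAt]
  intro y
  by_cases hy : y ∈ (chartAt E3 p).target
  · rw [← (chartAt E3 p).right_inv hy]
    exact contDiffAt_ext ((chartAt E3 p).map_target hy) (hw _)
  -- The image of the support is compact, hence closed in `E3`, so the extension by zero vanishes
  -- near every point outside the chart's target.
  · have : y ∉ tsupport (ext p w) := fun h => by
      obtain ⟨z, hz, rfl⟩ := tsupport_ext_subset hs h
      exact hy ((chartAt E3 p).map_source (hs hz))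
    exact contDiffAt_const.congr_of_eventuallyEq (notMem_tsupport_iff_eventuallyEq.mp this)

lemma integrable_ext (hw : ∀ x, SmoothAt w x) (hs : tsupport w ⊆ (chartAt E3 p).source) :
    Integrable (ext p w) :=
  (contDiff_ext hw hs).continuous.integrable_of_hasCompactSupport (hasCompactSupport_ext hs)

lemma smooth_mul_of_tsupport {h w : M → ℝ} (hw : ∀ x, SmoothAt w x)
    (hh : ∀ x ∈ tsupport w, SmoothAt h x) (x : M) : SmoothAt (fun x => h x * w x) x := by
  by_cases hx : x ∈ tsupport w
  · exact smoothAt_mul (hh x hx) (hw x)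
  · refine (smoothAt_const (0 : ℝ)).congr_of_eventuallyEq ?_
    filter_upwards [notMem_tsupport_iff_eventuallyEq.mp hx] with z hz
    simp [hz]

lemma tsupport_mul_subset {h w : M → ℝ} : tsupport (fun x => h x * w x) ⊆ tsupport w :=
  tsupport_mul_subset_right (f := h) (g := w)

/-- Integration by parts against the constant function 1. -/
lemma integral_fderiv_eq_zero {W : E3 → ℝ} (hW : ContDiff ℝ 1 W) (hc : HasCompactSupport W)
    (v : E3) : ∫ y, fderiv ℝ W y v = 0 := by
  have hi : Integrable (fun y => fderiv ℝ W y v) :=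
    ((hW.continuous_fderiv one_ne_zero).clm_apply continuous_const).integrable_of_hasCompactSupport
      (hc.fderiv_apply ℝ v)
  have := integral_mul_fderiv_eq_neg_fderiv_mul_of_integrable (μ := (volume : Measure E3))
    (f := fun _ => (1 : ℝ)) (g := W) (v := v) (by simp) (by simpa using hi)
    (by simpa using hW.continuous.integrable_of_hasCompactSupport hc)
    (by fun_prop) (fun y _ => hW.differentiable one_ne_zero y)
  simpa using this

end Chart

/-! ### Riemannian density and divergence theorem in a patch -/

section Patch

open MeasureTheory

variable {M : Type*} [TopologicalSpace M] [ChartedSpace E3 M] [IsManifold 𝓘(ℝ, E3) ∞ M]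
  {D : InitialData M} {ι : Type*} (S : SpinStructure D ι)

/-- The domain of both a chart and a gauge. -/
def patch (p : M) (i : ι) : Set M := (chartAt E3 p).source ∩ S.U i

/-- The coordinate components of the frame. -/
def frameMat (p : M) (i : ι) (x : M) : Matrix (Fin 3) (Fin 3) ℝ :=
  Matrix.of fun q a => lie (S.frame i a) (chartAt E3 p : M → E3) x q

/-- The density of the Riemannian volume in the coordinates. -/
def dens (p : M) (i : ι) (x : M) : ℝ := |(frameMat S p i x).det|⁻¹

/-- The Riemannian integral of a function that is supported in a patch. -/
def loc (p : M) (i : ι) (w : M → ℝ) : ℝ := ∫ y, ext p (fun x => dens S p i x * w x) y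

variable {S} {p : M} {i j : ι} {x : M}

lemma isOpen_patch : IsOpen (patch S p i) := (chartAt E3 p).open_source.inter (S.isOpen_U i)

lemma smoothAt_coord (hx : x ∈ (chartAt E3 p).source) (q : Fin 3) :
    SmoothAt (fun y => (chartAt E3 p y : E3) q) x :=
  (smoothAt_chart hx).clm (EuclideanSpace.proj q)

lemma frameMat_apply (hx : x ∈ (chartAt E3 p).source) (q a : Fin 3) :
    frameMat S p i x q a = lie (S.frame i a) (fun y => (chartAt E3 p y : E3) q) x :=
  (lie_comp_clm (EuclideanSpace.proj q) (smoothAt_chart hx).diffAt).symm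

lemma smoothAt_frameMat (hx : x ∈ patch S p i) (q a : Fin 3) :
    SmoothAt (fun y => frameMat S p i y q a) x :=
  ((smoothAt_chart hx.1).lie (smoothFieldAt_frame S i a hx.2)).clm (EuclideanSpace.proj q)

/-- The differential of the chart is surjective and the frame spans the tangent space, so the
coordinate vectors of the frame span `E3`. -/
lemma det_frameMat_ne_zero (hx : x ∈ patch S p i) : (frameMat S p i x).det ≠ 0 := by
  have hinv : ∀ v : E3, ∃ t : TangentSpace 𝓘(ℝ, E3) x,
      mfderiv 𝓘(ℝ, E3) 𝓘(ℝ, E3) (chartAt E3 p : M → E3) x t = v := by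
    intro v
    have hy := (chartAt E3 p).map_source hx.1
    have h1 := (smoothAt_chart hx.1).diffAt
    have h2 : MDifferentiableAt 𝓘(ℝ, E3) 𝓘(ℝ, E3) (chartAt E3 p).symm (chartAt E3 p x) :=
      (contMDiffAt_chart_symm hy).mdifferentiableAt (by simp)
    have hid : (chartAt E3 p : M → E3) ∘ (chartAt E3 p).symm =ᶠ[nhds (chartAt E3 p x)] id := by
      filter_upwards [(chartAt E3 p).open_target.mem_nhds hy] with z hz
        using (chartAt E3 p).right_inv hz
    have hl := (chartAt E3 p).left_inv hx.1
    have h3 := mfderiv_comp_of_eq (I := 𝓘(ℝ, E3)) (I' := 𝓘(ℝ, E3)) (I'' := 𝓘(ℝ, E3))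
      (x := chartAt E3 p x) h1 h2 hl
    rw [hid.mfderiv_eq, mfderiv_id] at h3
    have h4 : ∃ t : TangentSpace 𝓘(ℝ, E3) ((chartAt E3 p).symm (chartAt E3 p x)),
        mfderiv 𝓘(ℝ, E3) 𝓘(ℝ, E3) (chartAt E3 p : M → E3)
          ((chartAt E3 p).symm (chartAt E3 p x)) t = v :=
      ⟨_, (congrArg (fun L => L v) h3).symm⟩
    rwa [hl] at h4
  have hsurj : Function.Surjective (frameMat S p i x).mulVec := by
    intro v
    obtain ⟨t, ht⟩ := hinv (WithLp.toLp 2 v)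
    refine ⟨fun b => D.metric.inner x (S.frame i b x) t, ?_⟩
    rw [frame_expansion D (S.frame_orthonormal i x hx.2) t, map_sum] at ht
    ext q
    have := congrArg (fun e : E3 => e q) ht
    simp only [map_smul] at this
    refine Eq.trans ?_ this
    rw [Matrix.mulVec, dotProduct]
    refine Eq.trans ?_ (map_sum (EuclideanSpace.proj q : E3 →L[ℝ] ℝ)
      (fun b => (D.metric.inner x (S.frame i b x) t •
        lie (S.frame i b) (chartAt E3 p : M → E3) x : E3)) Finset.univ).symm
    refine Finset.sum_congr rfl fun b _ => ?_
    exact mul_comm _ _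
  have := Matrix.mulVec_surjective_iff_isUnit.1 hsurj
  rw [Matrix.isUnit_iff_isUnit_det] at this
  exact this.ne_zero

lemma smoothAt_det_frameMat (hx : x ∈ patch S p i) :
    SmoothAt (fun y => (frameMat S p i y).det) x := by
  have h := fun q a => smoothAt_frameMat hx q a
  simp only [Matrix.det_fin_three]
  refine ((((?_ : SmoothAt _ x).sub ?_).sub ?_).add ?_).add ?_ |>.sub ?_ <;>
    exact smoothAt_mul (smoothAt_mul (h _ _) (h _ _)) (h _ _)

lemma smoothAt_dens (hx : x ∈ patch S p i) : SmoothAt (dens S p i) x := by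
  have h0 := det_frameMat_ne_zero hx
  have h1 : ContDiffAt ℝ ∞ (fun t : ℝ => |t|⁻¹) (frameMat S p i x).det :=
    (contDiffAt_abs h0).inv (by simpa using h0)
  exact ContMDiffAt.comp (g := fun t : ℝ => |t|⁻¹) x h1.contMDiffAt (smoothAt_det_frameMat hx)

lemma dens_pos (hx : x ∈ patch S p i) : 0 < dens S p i x :=
  inv_pos.2 (abs_pos.2 (det_frameMat_ne_zero hx))

lemma dens_nonneg : 0 ≤ dens S p i x := by unfold dens; positivity

/-- Differentiating `dens² det² = 1` avoids the sign hidden in the absolute value. -/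
lemma lie_dens (hx : x ∈ patch S p i) (X : (x : M) → TangentSpace 𝓘(ℝ, E3) x) :
    lie X (dens S p i) x * (frameMat S p i x).det =
      - dens S p i x * lie X (fun y => (frameMat S p i y).det) x := by
  have hd := (smoothAt_dens hx).diffAt
  have hm := (smoothAt_det_frameMat hx).diffAt
  have hone : (fun y => (dens S p i y * dens S p i y) *
      ((frameMat S p i y).det * (frameMat S p i y).det)) =ᶠ[nhds x] fun _ => 1 := by
    filter_upwards [isOpen_patch.mem_nhds hx] with y hy
    have := det_frameMat_ne_zero hy
    rw [dens, ← sq, ← sq, inv_pow, sq_abs]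
    field_simp
  have h := lie_congr (X := X) hone
  rw [lie_const, lie_mul (diffAt_mul hd hd) (diffAt_mul hm hm), lie_mul hd hd, lie_mul hm hm] at h
  have h0 := det_frameMat_ne_zero hx
  have h1 := (dens_pos hx).ne'
  have : (2 * dens S p i x * (frameMat S p i x).det) *
    (lie X (dens S p i) x * (frameMat S p i x).det + dens S p i x *
      lie X (fun y => (frameMat S p i y).det) x) = 0 := by linear_combination h
  have := (mul_eq_zero.1 this).resolve_left (by positivity)
  linarith

/-- Jacobi's formula for the derivative of a determinant. -/
lemma lie_det {N : M → Matrix (Fin 3) (Fin 3) ℝ} (hN : ∀ q a, DiffAt (fun y => N y q a) x)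
    (X : (x : M) → TangentSpace 𝓘(ℝ, E3) x) :
    lie X (fun y => (N y).det) x =
      ∑ b, ∑ q, (N x).adjugate b q * lie X (fun y => N y q b) x := by
  have h3 : ∀ a b c a' b' c', lie X (fun y => N y a a' * N y b b' * N y c c') x =
      lie X (fun y => N y a a') x * N x b b' * N x c c' +
      N x a a' * lie X (fun y => N y b b') x * N x c c' +
      N x a a' * N x b b' * lie X (fun y => N y c c') x := by
    intro a b c a' b' c'
    rw [lie_mul (diffAt_mul (hN _ _) (hN _ _)) (hN _ _), lie_mul (hN _ _) (hN _ _)]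
    ring
  have hd : ∀ a b c a' b' c', DiffAt (fun y => N y a a' * N y b b' * N y c c') x :=
    fun a b c a' b' c' => diffAt_mul (diffAt_mul (hN _ _) (hN _ _)) (hN _ _)
  simp only [Matrix.det_fin_three]
  have hs : ∀ {f g : M → ℝ}, DiffAt f x → DiffAt g x → DiffAt (fun y => f y - g y) x :=
    fun hf hg => hf.sub hg
  have ha : ∀ {f g : M → ℝ}, DiffAt f x → DiffAt g x → DiffAt (fun y => f y + g y) x :=
    fun hf hg => hf.add hg
  have d2 := hs (hd 0 1 2 0 1 2) (hd 0 1 2 0 2 1)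
  have d3 := hs d2 (hd 0 1 2 1 0 2)
  have d4 := ha d3 (hd 0 1 2 1 2 0)
  have d5 := ha d4 (hd 0 1 2 2 0 1)
  rw [lie_sub d5 (hd _ _ _ _ _ _), lie_add d4 (hd _ _ _ _ _ _), lie_add d3 (hd _ _ _ _ _ _),
    lie_sub d2 (hd _ _ _ _ _ _), lie_sub (hd _ _ _ _ _ _) (hd _ _ _ _ _ _)]
  simp only [h3]
  rw [Matrix.adjugate_fin_three]
  simp [Fin.sum_univ_three]
  ring

lemma lie_mlieBracket_frame_real (a b : Fin 3) (hx : x ∈ S.U i) {u : M → ℝ}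
    (hu : ∀ᶠ y in nhds x, SmoothAt u y) :
    lie (S.frame i a) (lie (S.frame i b) u) x - lie (S.frame i b) (lie (S.frame i a) u) x =
      ∑ k, structCoeff D (S.frame i) x a b k * lie (S.frame i k) u x := by
  rw [← lie_mlieBracket_real (eventually_smoothFieldAt_frame S i a hx)
    (eventually_smoothFieldAt_frame S i b hx) (eventually_smoothFieldAt_frame S i 0 hx)
    (frame_ne_zero S i 0 hx) hu]
  have h := frame_expansion D (S.frame_orthonormal i x hx)
    (VectorField.mlieBracket 𝓘(ℝ, E3) (S.frame i a) (S.frame i b) x)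
  have h2 := congrArg (fun v => (mfderiv 𝓘(ℝ, E3) 𝓘(ℝ, ℝ) u x v : ℝ)) h
  refine h2.trans ?_
  rw [map_sum]
  refine Finset.sum_congr rfl fun k _ => ?_
  rw [map_smul, D.metric.symm]
  rfl

/-- The commutator of two frame fields applied to a coordinate function. -/
lemma lie_frameMat_sub (hx : x ∈ patch S p i) (a b q : Fin 3) :
    lie (S.frame i a) (fun y => frameMat S p i y q b) x -
      lie (S.frame i b) (fun y => frameMat S p i y q a) x =
      ∑ k, structCoeff D (S.frame i) x a b k * frameMat S p i x q k := by
  have hev : ∀ a, (fun y => frameMat S p i y q a) =ᶠ[nhds x]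
      lie (S.frame i a) (fun y => (chartAt E3 p y : E3) q) := by
    intro a
    filter_upwards [isOpen_patch.mem_nhds hx] with y hy using frameMat_apply hy.1 q a
  rw [lie_congr (hev b), lie_congr (hev a), lie_mlieBracket_frame_real a b hx.2]
  · simp only [frameMat_apply hx.1]
  · filter_upwards [isOpen_patch.mem_nhds hx] with y hy using smoothAt_coord hy.1 q

/-- The divergence of a frame field. -/
def divg (S : SpinStructure D ι) (i : ι) (a : Fin 3) (x : M) : ℝ :=
  ∑ b, structCoeff D (S.frame i) x b a b

/-- The left side is the coordinate divergence of `dens · w · e_a`, with each coordinate derivative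
written in the frame by means of the inverse matrix. Exchanging the two frame indices costs
structure functions, whose trace is `divg`; the remaining derivatives of the frame cancel against
that of the density. -/
lemma divergence_identity (hx : x ∈ patch S p i) {w : M → ℝ} (hw : SmoothAt w x) (a : Fin 3) :
    (∑ q, ∑ b, (frameMat S p i x)⁻¹ b q *
      lie (S.frame i b) (fun y => dens S p i y * w y * frameMat S p i y q a) x) =
      dens S p i x * (lie (S.frame i a) w x + divg S i a x * w x) := by
  have hJ := (smoothAt_dens hx).diffAt
  have hE := fun q a => (smoothAt_frameMat hx q a).diffAt
  have h0 := det_frameMat_ne_zero hx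
  have hlie : ∀ q b, lie (S.frame i b) (fun y => dens S p i y * w y * frameMat S p i y q a) x =
      lie (S.frame i b) (fun y => dens S p i y * w y) x * frameMat S p i x q a +
        dens S p i x * w x * (lie (S.frame i a) (fun y => frameMat S p i y q b) x +
          ∑ k, structCoeff D (S.frame i) x b a k * frameMat S p i x q k) := by
    intro q b
    rw [lie_mul (diffAt_mul hJ hw.diffAt) (hE q a), ← lie_frameMat_sub hx]
    ring
  have hinv : ∀ b k, ∑ q, (frameMat S p i x)⁻¹ b q * frameMat S p i x q k =
      if b = k then 1 else 0 := by
    intro b k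
    have := Matrix.nonsing_inv_mul (frameMat S p i x) (IsUnit.mk0 _ h0)
    have := congrFun (congrFun this b) k
    rwa [Matrix.mul_apply, Matrix.one_apply] at this
  have hadj : ∀ b q, (frameMat S p i x)⁻¹ b q =
      ((frameMat S p i x).det)⁻¹ * (frameMat S p i x).adjugate b q := by
    intro b q
    rw [Matrix.inv_def, Ring.inverse_eq_inv]
    rfl
  have hdet := lie_dens hx (S.frame i a)
  rw [lie_det hE] at hdet
  have hdet' : lie (S.frame i a) (dens S p i) x = - dens S p i x *
      ∑ b, ∑ q, (frameMat S p i x)⁻¹ b q * lie (S.frame i a) (fun y => frameMat S p i y q b) x := by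
    simp only [hadj, mul_assoc, ← Finset.mul_sum]
    field_simp
    linarith
  have hGa := lie_mul (X := S.frame i a) hJ hw.diffAt
  rw [hdet'] at hGa
  have e1 : ∑ q, ∑ b, (frameMat S p i x)⁻¹ b q *
      (lie (S.frame i b) (fun y => dens S p i y * w y) x * frameMat S p i x q a) =
      lie (S.frame i a) (fun y => dens S p i y * w y) x := by
    rw [Finset.sum_comm]
    have : ∀ b, ∑ q, (frameMat S p i x)⁻¹ b q *
      (lie (S.frame i b) (fun y => dens S p i y * w y) x * frameMat S p i x q a) =
      lie (S.frame i b) (fun y => dens S p i y * w y) x * if b = a then 1 else 0 := by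
      intro b
      rw [← hinv, Finset.mul_sum]
      exact Finset.sum_congr rfl fun q _ => by ring
    simp [this]
  have e2 : ∑ q, ∑ b, (frameMat S p i x)⁻¹ b q *
      ∑ k, structCoeff D (S.frame i) x b a k * frameMat S p i x q k = divg S i a x := by
    rw [Finset.sum_comm, divg]
    refine Finset.sum_congr rfl fun b _ => ?_
    simp only [Finset.mul_sum]
    rw [Finset.sum_comm]
    have : ∀ k, ∑ q, (frameMat S p i x)⁻¹ b q *
        (structCoeff D (S.frame i) x b a k * frameMat S p i x q k) =
        structCoeff D (S.frame i) x b a k * if b = k then 1 else 0 := by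
      intro k
      rw [← hinv, Finset.mul_sum]
      exact Finset.sum_congr rfl fun q _ => by ring
    simp [this]
  have e3 : ∑ q, ∑ b, (frameMat S p i x)⁻¹ b q *
      (dens S p i x * w x * (lie (S.frame i a) (fun y => frameMat S p i y q b) x +
          ∑ k, structCoeff D (S.frame i) x b a k * frameMat S p i x q k)) =
      dens S p i x * w x * ((∑ b, ∑ q, (frameMat S p i x)⁻¹ b q *
        lie (S.frame i a) (fun y => frameMat S p i y q b) x) + divg S i a x) := by
    rw [← e2, Finset.sum_comm (f := fun b q => (frameMat S p i x)⁻¹ b q *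
        lie (S.frame i a) (fun y => frameMat S p i y q b) x), ← Finset.sum_add_distrib,
      Finset.mul_sum]
    refine Finset.sum_congr rfl fun q _ => ?_
    rw [← Finset.sum_add_distrib, Finset.mul_sum]
    exact Finset.sum_congr rfl fun b _ => by ring
  refine Eq.trans ?_ ((congrArg₂ (· + ·) (e1.trans hGa) e3).trans (by ring))
  simp only [hlie, ← Finset.sum_add_distrib]
  exact Finset.sum_congr rfl fun q _ => Finset.sum_congr rfl fun b _ => mul_add _ _ _

variable [CompactSpace M]

lemma smooth_dens_mul {w : M → ℝ} (hw : ∀ x, SmoothAt w x) (hs : tsupport w ⊆ patch S p i)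
    (x : M) : SmoothAt (fun x => dens S p i x * w x) x :=
  smooth_mul_of_tsupport hw (fun _ hx => smoothAt_dens (hs hx)) x

/-- The divergence theorem in a patch. -/
lemma loc_divergence {w : M → ℝ} (hw : ∀ x, SmoothAt w x) (hs : tsupport w ⊆ patch S p i)
    (a : Fin 3) : loc S p i (fun x => lie (S.frame i a) w x + divg S i a x * w x) = 0 := by
  have hsm : ∀ q x, SmoothAt (fun y => frameMat S p i y q a * (dens S p i y * w y)) x := fun q =>
    smooth_mul_of_tsupport (smooth_dens_mul hw hs)
      fun x hx => smoothAt_frameMat (hs (tsupport_mul_subset hx)) q a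
  have hts : ∀ q, tsupport (fun y => frameMat S p i y q a * (dens S p i y * w y)) ⊆
      (chartAt E3 p).source := fun q =>
    (tsupport_mul_subset.trans (tsupport_mul_subset.trans hs)).trans Set.inter_subset_left
  have hint : ∀ q, Integrable (fun y => fderiv ℝ
      (ext p fun y => frameMat S p i y q a * (dens S p i y * w y)) y
        (EuclideanSpace.single q (1 : ℝ))) := fun q =>
    (((contDiff_ext (hsm q) (hts q)).continuous_fderiv (by simp)).clm_apply
      continuous_const).integrable_of_hasCompactSupport
        ((hasCompactSupport_ext (hts q)).fderiv_apply ℝ _)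
  have hzero : ∑ q, ∫ y, fderiv ℝ
      (ext p fun y => frameMat S p i y q a * (dens S p i y * w y)) y
        (EuclideanSpace.single q (1 : ℝ)) = 0 :=
    Finset.sum_eq_zero fun q _ => integral_fderiv_eq_zero
      ((contDiff_ext (hsm q) (hts q)).of_le (by simp)) (hasCompactSupport_ext (hts q)) _
  rw [← integral_finsetSum _ fun q _ => hint q] at hzero
  rw [loc, ← hzero]
  congr 1
  ext y
  -- Off the image of the support both integrands vanish; on it the frame is available and
  -- `divergence_identity` applies.
  by_cases hy : y ∈ (chartAt E3 p).symm ⁻¹' tsupport w ∩ (chartAt E3 p).target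
  swap
  · have hW : ∀ q, y ∉ tsupport (ext p fun y => frameMat S p i y q a * (dens S p i y * w y)) := by
      intro q h
      obtain ⟨z, hz, rfl⟩ := tsupport_ext_subset (hts q) h
      have hz' := tsupport_mul_subset (tsupport_mul_subset hz)
      refine hy ⟨?_, (chartAt E3 p).map_source (hs hz').1⟩
      rwa [Set.mem_preimage, (chartAt E3 p).left_inv (hs hz').1]
    rw [Finset.sum_eq_zero fun q _ => ?_]
    · by_cases hyt : y ∈ (chartAt E3 p).target
      · have : (chartAt E3 p).symm y ∉ tsupport w := fun h => hy ⟨h, hyt⟩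
        rw [ext_of_mem hyt, lie_eq_zero_of_notMem_tsupport this, image_eq_zero_of_notMem_tsupport this]
        simp
      · exact ext_of_notMem hyt
    · have : fderiv ℝ (ext p fun y => frameMat S p i y q a * (dens S p i y * w y)) y = 0 :=
        image_eq_zero_of_notMem_tsupport fun h => hW q (tsupport_fderiv_subset ℝ h)
      rw [this]
      rfl
  · obtain ⟨hy1, hyt⟩ := hy
    obtain ⟨x, hx, rfl⟩ : ∃ x ∈ (chartAt E3 p).source, chartAt E3 p x = y :=
      ⟨_, (chartAt E3 p).map_target hyt, (chartAt E3 p).right_inv hyt⟩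
    rw [Set.mem_preimage, (chartAt E3 p).left_inv hx] at hy1
    have hxp := hs hy1
    rw [ext_chart hx, ← divergence_identity hxp (hw x)]
    refine Finset.sum_congr rfl fun q _ => ?_
    -- The coordinate vector in the frame, with coefficients from the inverse of `frameMat`.
    have hb : EuclideanSpace.single q (1 : ℝ) =
        ∑ b, (frameMat S p i x)⁻¹ b q • lie (S.frame i b) (chartAt E3 p : M → E3) x := by
      have h1 := Matrix.mul_nonsing_inv (frameMat S p i x)
        (IsUnit.mk0 _ (det_frameMat_ne_zero hxp))
      ext r
      have h2 := congrFun (congrFun h1 r) q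
      rw [Matrix.mul_apply, Matrix.one_apply] at h2
      simp only [PiLp.single_apply, WithLp.ofLp_sum, WithLp.ofLp_smul, Finset.sum_apply,
        Pi.smul_apply, smul_eq_mul]
      rw [← h2]
      exact Finset.sum_congr rfl fun b _ => mul_comm _ _
    rw [hb, map_sum]
    refine Finset.sum_congr rfl fun b _ => ?_
    rw [map_smul, fderiv_ext_lie hx (hsm q x), smul_eq_mul]
    congr 2
    ext z
    ring

end Patch

/-! ### Independence of the integral of chart and gauge, and its positivity -/

section ChangeOfPatch

open MeasureTheory

variable {M : Type*} [TopologicalSpace M] [ChartedSpace E3 M] [IsManifold 𝓘(ℝ, E3) ∞ M]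
  {D : InitialData M} {ι : Type*} {S : SpinStructure D ι} {p p' : M} {i j : ι} {x : M}

lemma abs_det_rot (hi : x ∈ S.U i) (hj : x ∈ S.U j) :
    |(Matrix.of (rot S i j x)).det| = 1 := by
  have h : Matrix.of (rot S i j x) * (Matrix.of (rot S i j x))ᵀ = 1 := by
    ext c d
    rw [Matrix.mul_apply, Matrix.one_apply, ← rot_mul_rot hi hj c d]
    rfl
  have := congrArg Matrix.det h
  rw [Matrix.det_mul, Matrix.det_transpose, Matrix.det_one] at this
  rw [← abs_mul_abs_self, ← sq] at this
  exact (pow_eq_one_iff_of_nonneg (abs_nonneg _) two_ne_zero).1 this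

lemma differentiableAt_transition (hx : x ∈ (chartAt E3 p).source)
    (hx' : x ∈ (chartAt E3 p').source) :
    DifferentiableAt ℝ (chartAt E3 p' ∘ (chartAt E3 p).symm) (chartAt E3 p x) := by
  rw [← mdifferentiableAt_iff_differentiableAt]
  refine MDifferentiableAt.comp (I' := 𝓘(ℝ, E3)) _ ?_
    ((contMDiffAt_chart_symm ((chartAt E3 p).map_source hx)).mdifferentiableAt (by simp))
  rw [(chartAt E3 p).left_inv hx]
  exact (smoothAt_chart hx').diffAt

/-- The frame matrices differ by the Jacobian of the coordinate change on the left and a rotation on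
the right, and the rotation has determinant `±1`. -/
lemma dens_change (hx : x ∈ patch S p i) (hx' : x ∈ patch S p' j) :
    dens S p i x = |(fderiv ℝ (chartAt E3 p' ∘ (chartAt E3 p).symm) (chartAt E3 p x)).det| *
      dens S p' j x := by
  set L := fderiv ℝ (chartAt E3 p' ∘ (chartAt E3 p).symm) (chartAt E3 p x) with hL
  set b := (EuclideanSpace.basisFun (Fin 3) ℝ).toBasis with hb
  have hlie : ∀ a, lie (S.frame i a) (chartAt E3 p' : M → E3) x =
      L (lie (S.frame i a) (chartAt E3 p : M → E3) x) := by
    intro a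
    rw [hL, ← lie_comp (smoothAt_chart hx.1).diffAt (differentiableAt_transition hx.1 hx'.1)]
    refine lie_congr ?_
    filter_upwards [(chartAt E3 p).open_source.mem_nhds hx.1] with z hz
    rw [Function.comp_apply, (chartAt E3 p).left_inv hz]
  have hmat : frameMat S p' j x =
      LinearMap.toMatrix b b (L : E3 →ₗ[ℝ] E3) * frameMat S p i x * Matrix.of (rot S i j x) := by
    ext q a
    have h1 : ∀ c, (LinearMap.toMatrix b b (L : E3 →ₗ[ℝ] E3) * frameMat S p i x) q c =
        lie (S.frame i c) (chartAt E3 p' : M → E3) x q := by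
      intro c
      have h2 := congrFun (LinearMap.toMatrix_mulVec_repr b b (L : E3 →ₗ[ℝ] E3)
        (lie (S.frame i c) (chartAt E3 p : M → E3) x)) q
      rw [hlie]
      exact h2
    rw [Matrix.mul_apply]
    simp only [h1]
    rw [frameMat, Matrix.of_apply, lie_frame_eq hx.2]
    simp only [WithLp.ofLp_sum, WithLp.ofLp_smul, Finset.sum_apply, Pi.smul_apply, smul_eq_mul]
    exact Finset.sum_congr rfl fun c _ => mul_comm _ _
  have hdet := congrArg (fun N => |Matrix.det N|) hmat
  simp only [Matrix.det_mul, abs_mul, abs_det_rot hx.2 hx'.2, LinearMap.det_toMatrix] at hdet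
  have h0 := abs_pos.2 (det_frameMat_ne_zero hx)
  have h0' := abs_pos.2 (det_frameMat_ne_zero hx')
  change _ = |LinearMap.det (L : E3 →ₗ[ℝ] E3)| * _
  rw [dens, dens]
  field_simp
  linarith

variable [CompactSpace M]

/-- The change of variables formula on the image of the chart overlap, which contains the images of
the support; outside it both integrands vanish. -/
lemma loc_change {w : M → ℝ} (hs : tsupport w ⊆ patch S p i) (hs' : tsupport w ⊆ patch S p' j) :
    loc S p i w = loc S p' j w := by
  set f := chartAt E3 p' ∘ (chartAt E3 p).symm with hf
  set A := chartAt E3 p '' ((chartAt E3 p).source ∩ (chartAt E3 p').source) with hA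
  have hAo : IsOpen A := (chartAt E3 p).isOpen_image_iff_of_subset_source Set.inter_subset_left |>.2
    ((chartAt E3 p).open_source.inter (chartAt E3 p').open_source)
  have hfx : ∀ {x}, x ∈ (chartAt E3 p).source → f (chartAt E3 p x) = chartAt E3 p' x := by
    intro x hx
    rw [hf, Function.comp_apply, (chartAt E3 p).left_inv hx]
  have hinj : Set.InjOn f A := by
    rintro _ ⟨x, hx, rfl⟩ _ ⟨z, hz, rfl⟩ h
    rw [hfx hx.1, hfx hz.1] at h
    rw [(chartAt E3 p').injOn hx.2 hz.2 h]
  have hder : ∀ y ∈ A, HasFDerivWithinAt f (fderiv ℝ f y) A y := by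
    rintro _ ⟨x, hx, rfl⟩
    exact (differentiableAt_transition hx.1 hx.2).hasFDerivAt.hasFDerivWithinAt
  have hzero : ∀ {q : M} {k : ι} {y : E3}, tsupport w ⊆ patch S q k →
      ext q (fun x => dens S q k x * w x) y ≠ 0 → ∃ x ∈ tsupport w, chartAt E3 q x = y := by
    intro q k y hq hy
    obtain ⟨x, hx, rfl⟩ := support_ext_subset hy
    exact ⟨x, subset_tsupport _ (right_ne_zero_of_mul hx), rfl⟩
  rw [loc, loc, ← setIntegral_eq_integral_of_forall_compl_eq_zero (s := A),
    ← setIntegral_eq_integral_of_forall_compl_eq_zero (s := f '' A)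
      (f := ext p' fun x => dens S p' j x * w x),
    integral_image_eq_integral_abs_det_fderiv_smul volume hAo.measurableSet hder hinj]
  · refine setIntegral_congr_fun hAo.measurableSet ?_
    rintro _ ⟨x, hx, rfl⟩
    simp only [hfx hx.1, ext_chart hx.1, ext_chart hx.2, smul_eq_mul]
    by_cases hxw : x ∈ tsupport w
    · rw [dens_change (hs hxw) (hs' hxw), mul_assoc]
    · rw [image_eq_zero_of_notMem_tsupport hxw]
      simp
  · intro y hy
    by_contra h
    obtain ⟨x, hx, rfl⟩ := hzero hs' h
    exact hy ⟨_, ⟨x, ⟨(hs hx).1, (hs' hx).1⟩, rfl⟩, hfx (hs hx).1⟩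
  · intro y hy
    by_contra h
    obtain ⟨x, hx, rfl⟩ := hzero hs h
    exact hy ⟨x, ⟨(hs hx).1, (hs' hx).1⟩, rfl⟩

lemma loc_add {v w : M → ℝ} (hv : ∀ x, SmoothAt v x) (hvs : tsupport v ⊆ patch S p i)
    (hw : ∀ x, SmoothAt w x) (hws : tsupport w ⊆ patch S p i) :
    loc S p i (fun x => v x + w x) = loc S p i v + loc S p i w := by
  rw [loc, loc, loc, ← integral_add
    (integrable_ext (smooth_dens_mul hv hvs)
      ((tsupport_mul_subset.trans hvs).trans Set.inter_subset_left))
    (integrable_ext (smooth_dens_mul hw hws)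
      ((tsupport_mul_subset.trans hws).trans Set.inter_subset_left))]
  congr 1
  ext y
  by_cases hy : y ∈ (chartAt E3 p).target
  · simp only [ext_of_mem hy, mul_add]
  · simp only [ext_of_notMem hy, add_zero]

lemma loc_const_mul (c : ℝ) (w : M → ℝ) : loc S p i (fun x => c * w x) = c * loc S p i w := by
  rw [loc, loc, ← integral_const_mul]
  congr 1
  ext y
  by_cases hy : y ∈ (chartAt E3 p).target
  · simp only [ext_of_mem hy, mul_left_comm]
  · simp only [ext_of_notMem hy, mul_zero]

lemma loc_zero : loc S p i (fun _ => 0) = 0 := by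
  simpa using loc_const_mul (S := S) (p := p) (i := i) 0 (fun _ => 0)

lemma loc_nonneg {w : M → ℝ} (hw : ∀ x, 0 ≤ w x) : 0 ≤ loc S p i w :=
  integral_nonneg fun y => by
    by_cases hy : y ∈ (chartAt E3 p).target
    · rw [ext_of_mem hy]
      exact mul_nonneg dens_nonneg (hw _)
    · rw [ext_of_notMem hy]; rfl

/-- A nonnegative continuous integrand with zero integral vanishes identically, and the density is
positive. -/
lemma loc_eq_zero {w : M → ℝ} (hw : ∀ x, SmoothAt w x) (hs : tsupport w ⊆ patch S p i)
    (h0 : ∀ x, 0 ≤ w x) (h : loc S p i w = 0) (x : M) : w x = 0 := by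
  by_contra hx
  have hxp := hs (subset_tsupport _ hx)
  have hs' := (tsupport_mul_subset (h := dens S p i).trans hs).trans Set.inter_subset_left
  have hc := (contDiff_ext (smooth_dens_mul hw hs) hs').continuous
  have hnn : 0 ≤ ext p (fun x => dens S p i x * w x) := fun y => by
    by_cases hy : y ∈ (chartAt E3 p).target
    · rw [ext_of_mem hy]
      exact mul_nonneg dens_nonneg (h0 _)
    · rw [ext_of_notMem hy]; rfl
  rw [loc, integral_eq_zero_iff_of_nonneg hnn (integrable_ext (smooth_dens_mul hw hs) hs'),
    hc.ae_eq_iff_eq volume continuous_zero] at h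
  have := congrFun h (chartAt E3 p x)
  rw [ext_chart hxp.1] at this
  exact (mul_ne_zero (dens_pos hxp).ne' hx) this

end ChangeOfPatch

/-! ### Integration over the manifold -/

section Total

variable {M : Type*} [TopologicalSpace M] [ChartedSpace E3 M] [IsManifold 𝓘(ℝ, E3) ∞ M]
  {D : InitialData M} {ι : Type*}

/-- A finite smooth partition of unity subordinate to patches. -/
structure PatchCover (S : SpinStructure D ι) where
  n : ℕ
  p : Fin n → M
  g : Fin n → ι
  ρ : Fin n → M → ℝ
  smooth (k : Fin n) (x : M) : SmoothAt (ρ k) x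
  nonneg (k : Fin n) (x : M) : 0 ≤ ρ k x
  sum_eq_one (x : M) : ∑ k, ρ k x = 1
  tsupport_subset (k : Fin n) : tsupport (ρ k) ⊆ patch S (p k) (g k)

lemma exists_patchCover [T2Space M] [CompactSpace M] (S : SpinStructure D ι) :
    Nonempty (PatchCover S) := by
  choose gi hgi using S.cover
  obtain ⟨t, ht⟩ := isCompact_univ.elim_finite_subcover (fun x : M => patch S x (gi x))
    (fun _ => isOpen_patch) fun x _ => Set.mem_iUnion.2 ⟨x, mem_chart_source E3 x, hgi x⟩
  obtain ⟨n, ⟨e⟩⟩ := Finite.exists_equiv_fin t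
  obtain ⟨f, hf⟩ := SmoothPartitionOfUnity.exists_isSubordinate 𝓘(ℝ, E3) isClosed_univ
    (fun k : Fin n => patch S (e.symm k : M) (gi (e.symm k))) (fun _ => isOpen_patch) (by
      intro x hx
      obtain ⟨y, hy, hxy⟩ := Set.mem_iUnion₂.1 (ht hx)
      exact Set.mem_iUnion.2 ⟨e ⟨y, hy⟩, by simpa using hxy⟩)
  refine ⟨⟨n, fun k => e.symm k, fun k => gi (e.symm k), fun k => f k, fun k x => (f k).contMDiff x,
    fun k x => f.nonneg k x, fun x => ?_, hf⟩⟩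
  rw [← f.sum_eq_one (Set.mem_univ x), finsum_eq_sum_of_fintype]

variable {S : SpinStructure D ι} (C : PatchCover S)

/-- The integral of a function with respect to the Riemannian volume. -/
def tot (w : M → ℝ) : ℝ := ∑ k, loc S (C.p k) (C.g k) (fun x => w x * C.ρ k x)

variable {C} {v w : M → ℝ} [CompactSpace M]

lemma PatchCover.tsupport_mul (k : Fin C.n) (w : M → ℝ) :
    tsupport (fun x => w x * C.ρ k x) ⊆ patch S (C.p k) (C.g k) :=
  tsupport_mul_subset.trans (C.tsupport_subset k)

lemma PatchCover.smooth_mul (k : Fin C.n) (hw : ∀ x, SmoothAt w x) (x : M) :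
    SmoothAt (fun x => w x * C.ρ k x) x := smoothAt_mul (hw x) (C.smooth k x)

lemma tot_add (hv : ∀ x, SmoothAt v x) (hw : ∀ x, SmoothAt w x) :
    tot C (fun x => v x + w x) = tot C v + tot C w := by
  rw [tot, tot, tot, ← Finset.sum_add_distrib]
  refine Finset.sum_congr rfl fun k _ => ?_
  rw [← loc_add (C.smooth_mul k hv) (C.tsupport_mul k v) (C.smooth_mul k hw) (C.tsupport_mul k w)]
  simp only [add_mul]

lemma tot_const_mul (c : ℝ) (w : M → ℝ) : tot C (fun x => c * w x) = c * tot C w := by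
  rw [tot, tot, Finset.mul_sum]
  refine Finset.sum_congr rfl fun k _ => ?_
  rw [← loc_const_mul]
  simp only [mul_assoc]

lemma tot_sum {m : ℕ} {w : Fin m → M → ℝ} (hw : ∀ l x, SmoothAt (w l) x) (s : Finset (Fin m)) :
    tot C (fun x => ∑ l ∈ s, w l x) = ∑ l ∈ s, tot C (w l) := by
  induction s using Finset.induction_on with
  | empty => simpa using tot_const_mul (C := C) 0 (fun _ => 0)
  | insert a s ha ih =>
    simp only [Finset.sum_insert ha]
    rw [tot_add (hw a) fun x => smoothAt_sum s fun l => hw l x, ih]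

lemma tot_nonneg (hw : ∀ x, 0 ≤ w x) : 0 ≤ tot C w :=
  Finset.sum_nonneg fun k _ => loc_nonneg fun x => mul_nonneg (hw x) (C.nonneg k x)

lemma tot_mono (hv : ∀ x, SmoothAt v x) (hw : ∀ x, SmoothAt w x) (h : ∀ x, v x ≤ w x) :
    tot C v ≤ tot C w := by
  have hs : ∀ x, SmoothAt (fun x => w x - v x) x := fun x => (hw x).sub (hv x)
  have h1 := tot_nonneg (C := C) fun x => sub_nonneg.2 (h x)
  have h2 := tot_add (C := C) hs hv
  simp only [sub_add_cancel] at h2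
  linarith

lemma tot_eq_zero (hw : ∀ x, SmoothAt w x) (h0 : ∀ x, 0 ≤ w x) (h : tot C w = 0) (x : M) :
    w x = 0 := by
  have h1 := (Finset.sum_eq_zero_iff_of_nonneg fun k _ =>
    loc_nonneg fun x => mul_nonneg (h0 x) (C.nonneg k x)).1 h
  have h2 : ∀ k, w x * C.ρ k x = 0 := fun k =>
    loc_eq_zero (C.smooth_mul k hw) (C.tsupport_mul k w)
      (fun x => mul_nonneg (h0 x) (C.nonneg k x)) (h1 k (Finset.mem_univ k)) x
  rw [← mul_one (w x), ← C.sum_eq_one x, Finset.mul_sum]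
  exact Finset.sum_eq_zero fun k _ => h2 k

lemma loc_sum {m : ℕ} {w : Fin m → M → ℝ} {p : M} {i : ι} (hw : ∀ l x, SmoothAt (w l) x)
    (hs : ∀ l, tsupport (w l) ⊆ patch S p i) (s : Finset (Fin m)) :
    loc S p i (fun x => ∑ l ∈ s, w l x) = ∑ l ∈ s, loc S p i (w l) ∧
      tsupport (fun x => ∑ l ∈ s, w l x) ⊆ patch S p i := by
  induction s using Finset.induction_on with
  | empty => simp [loc_zero, tsupport]
  | insert a s ha ih =>
    simp only [Finset.sum_insert ha]
    rw [loc_add (hw a) (hs a) (fun x => smoothAt_sum s fun l => hw l x) ih.2, ih.1]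
    exact ⟨rfl, (tsupport_add _ _).trans (Set.union_subset (hs a) ih.2)⟩

/-- Each piece cut out by the partition of unity lies in two patches, so `loc_change` moves all
pieces to the same one, where they add up to `w`. -/
lemma tot_eq_loc {p : M} {i : ι} (hw : ∀ x, SmoothAt w x) (hs : tsupport w ⊆ patch S p i) :
    tot C w = loc S p i w := by
  have hs' : ∀ k, tsupport (fun x => w x * C.ρ k x) ⊆ patch S p i := fun k =>
    (tsupport_mul_subset_left (f := w) (g := C.ρ k)).trans hs
  have h : w = fun x => ∑ k, w x * C.ρ k x := by
    ext x
    rw [← Finset.mul_sum, C.sum_eq_one, mul_one]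
  conv_rhs => rw [h]
  rw [(loc_sum (fun k => C.smooth_mul k hw) hs' Finset.univ).1, tot]
  exact Finset.sum_congr rfl fun k _ => loc_change (C.tsupport_mul k w) (hs' k)

end Total

/-! ### The Hermitian pairing and the formal adjoint -/

section Pairing

variable {M : Type*} [TopologicalSpace M] [ChartedSpace E3 M] [IsManifold 𝓘(ℝ, E3) ∞ M]
  {D : InitialData M} {ι : Type*} {S : SpinStructure D ι} {x : M} {i j : ι}

/-- The real part of the Hermitian scalar product of spinors. -/
def rdot (u v : Fin 2 → ℂ) : ℝ := (star u ⬝ᵥ v).re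

lemma rdot_eq (u v : Fin 2 → ℂ) : rdot u v =
    (u 0).re * (v 0).re + (u 0).im * (v 0).im + ((u 1).re * (v 1).re + (u 1).im * (v 1).im) := by
  simp [rdot, dotProduct, Fin.sum_univ_two, Complex.mul_re]

lemma rdot_self_nonneg (u : Fin 2 → ℂ) : 0 ≤ rdot u u := by
  rw [rdot_eq]
  nlinarith [mul_self_nonneg (u 0).re, mul_self_nonneg (u 0).im, mul_self_nonneg (u 1).re,
    mul_self_nonneg (u 1).im]

lemma rdot_self_eq_zero {u : Fin 2 → ℂ} (h : rdot u u = 0) : u = 0 := by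
  rw [rdot_eq] at h
  have h0 := mul_self_nonneg (u 0).re
  have h1 := mul_self_nonneg (u 0).im
  have h2 := mul_self_nonneg (u 1).re
  have h3 := mul_self_nonneg (u 1).im
  have e0 : u 0 = 0 :=
    Complex.ext (mul_self_eq_zero.1 (by linarith)) (mul_self_eq_zero.1 (by linarith))
  have e1 : u 1 = 0 :=
    Complex.ext (mul_self_eq_zero.1 (by linarith)) (mul_self_eq_zero.1 (by linarith))
  ext A
  fin_cases A
  · exact e0
  · exact e1

lemma rdot_self_eq (u : Fin 2 → ℂ) : rdot u u = ‖u 0‖ ^ 2 + ‖u 1‖ ^ 2 := by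
  rw [rdot_eq, ← Complex.normSq_eq_norm_sq, ← Complex.normSq_eq_norm_sq, Complex.normSq_apply,
    Complex.normSq_apply]

lemma rdot_comm (u v : Fin 2 → ℂ) : rdot u v = rdot v u := by
  rw [rdot_eq, rdot_eq]; ring

lemma rdot_add_right (u v w : Fin 2 → ℂ) : rdot u (v + w) = rdot u v + rdot u w := by
  simp [rdot]

lemma rdot_add_left (u v w : Fin 2 → ℂ) : rdot (u + v) w = rdot u w + rdot v w := by
  rw [rdot_comm, rdot_add_right, rdot_comm w u, rdot_comm w v]

lemma rdot_neg_right (u v : Fin 2 → ℂ) : rdot u (-v) = - rdot u v := by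
  simp [rdot]

lemma rdot_sub_left (u v w : Fin 2 → ℂ) : rdot (u - v) w = rdot u w - rdot v w := by
  rw [rdot_comm, sub_eq_add_neg, rdot_add_right, rdot_neg_right, rdot_comm w u, rdot_comm w v]
  ring

lemma rdot_smul_right (r : ℝ) (u v : Fin 2 → ℂ) : rdot u ((r : ℂ) • v) = r * rdot u v := by
  simp [rdot_eq]
  ring

lemma rdot_smul_left (r : ℝ) (u v : Fin 2 → ℂ) : rdot ((r : ℂ) • u) v = r * rdot u v := by
  rw [rdot_comm, rdot_smul_right, rdot_comm]

lemma rdot_mulVec (N : Matrix (Fin 2) (Fin 2) ℂ) (u v : Fin 2 → ℂ) :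
    rdot u (N *ᵥ v) = rdot (Nᴴ *ᵥ u) v := by
  rw [rdot, rdot, Matrix.star_mulVec, Matrix.conjTranspose_conjTranspose, Matrix.dotProduct_mulVec]

lemma rdot_sum_right {α : Type*} (s : Finset α) (u : Fin 2 → ℂ) (v : α → Fin 2 → ℂ) :
    rdot u (∑ a ∈ s, v a) = ∑ a ∈ s, rdot u (v a) := by
  simp [rdot, dotProduct_sum]

lemma rdot_sum_left {α : Type*} (s : Finset α) (u : Fin 2 → ℂ) (v : α → Fin 2 → ℂ) :
    rdot (∑ a ∈ s, v a) u = ∑ a ∈ s, rdot (v a) u := by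
  rw [rdot_comm, rdot_sum_right]
  exact Finset.sum_congr rfl fun a _ => rdot_comm _ _

lemma rdot_self_add_le (u v : Fin 2 → ℂ) :
    rdot (u + v) (u + v) ≤ 2 * rdot u u + 2 * rdot v v := by
  have := rdot_self_nonneg (u - v)
  simp only [rdot_eq, Pi.add_apply, Pi.sub_apply, Complex.add_re, Complex.add_im, Complex.sub_re,
    Complex.sub_im] at *
  linarith

lemma lie_rdot {X : (x : M) → TangentSpace 𝓘(ℝ, E3) x} {f h : M → Fin 2 → ℂ} (hf : DiffAt f x)
    (hh : DiffAt h x) :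
    lie X (fun y => rdot (f y) (h y)) x = rdot (lie X f x) (h x) + rdot (f x) (lie X h x) := by
  have hr : ∀ {f : M → Fin 2 → ℂ}, DiffAt f x → ∀ A, DiffAt (fun y => (f y A).re) x ∧
      DiffAt (fun y => (f y A).im) x ∧ lie X (fun y => (f y A).re) x = (lie X f x A).re ∧
      lie X (fun y => (f y A).im) x = (lie X f x A).im := by
    intro f hf A
    have hA : DiffAt (fun y => f y A) x :=
      ((ContinuousLinearMap.proj (R := ℝ) (φ := fun _ : Fin 2 => ℂ) A).mdifferentiableAt).comp x hf
    refine ⟨(Complex.reCLM.mdifferentiableAt).comp x hA, (Complex.imCLM.mdifferentiableAt).comp x hA,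
      ?_, ?_⟩
    · rw [lie_re hA, lie_apply hf]
    · rw [lie_im hA, lie_apply hf]
  simp only [rdot_eq]
  have ha : ∀ {f g : M → ℝ}, DiffAt f x → DiffAt g x → DiffAt (fun y => f y + g y) x :=
    fun hf hg => hf.add hg
  have m1 := fun A => diffAt_mul (hr hf A).1 (hr hh A).1
  have m2 := fun A => diffAt_mul (hr hf A).2.1 (hr hh A).2.1
  rw [lie_add (ha (m1 0) (m2 0)) (ha (m1 1) (m2 1)), lie_add (m1 0) (m2 0),
    lie_add (m1 1) (m2 1), lie_mul (hr hf 0).1 (hr hh 0).1, lie_mul (hr hf 1).1 (hr hh 1).1,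
    lie_mul (hr hf 0).2.1 (hr hh 0).2.1, lie_mul (hr hf 1).2.1 (hr hh 1).2.1]
  simp only [(hr hf _).2.2.1, (hr hf _).2.2.2, (hr hh _).2.2.1, (hr hh _).2.2.2]
  ring

lemma SmoothAt.rdot {f h : M → Fin 2 → ℂ} (hf : SmoothAt f x) (hh : SmoothAt h x) :
    SmoothAt (fun y => rdot (f y) (h y)) x := by
  simp only [rdot_eq]
  have hr : ∀ {f : M → Fin 2 → ℂ}, SmoothAt f x → ∀ A, SmoothAt (fun y => (f y A).re) x ∧
      SmoothAt (fun y => (f y A).im) x := fun hf A =>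
    ⟨(hf.comp_apply A).clm Complex.reCLM, (hf.comp_apply A).clm Complex.imCLM⟩
  exact smoothAt_add (smoothAt_add (smoothAt_mul (hr hf 0).1 (hr hh 0).1)
    (smoothAt_mul (hr hf 0).2 (hr hh 0).2)) (smoothAt_add (smoothAt_mul (hr hf 1).1 (hr hh 1).1)
    (smoothAt_mul (hr hf 1).2 (hr hh 1).2))

/-- The real part of the pointwise Hermitian scalar product of spinor fields. -/
def pair (f h : SpinorField S) (x : M) : ℝ :=
  rdot (f.1 (S.cover x).choose x) (h.1 (S.cover x).choose x)

/-- The transition matrices are unitary, so the choice of gauge in `pair` is immaterial. -/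
lemma pair_eq (f h : SpinorField S) (hx : x ∈ S.U i) : pair f h x = rdot (f.1 i x) (h.1 i x) := by
  have hj := (S.cover x).choose_spec
  rw [pair, spinor_change f hj hx, spinor_change h hj hx, rdot_mulVec, Matrix.mulVec_mulVec,
    conjTranspose_mul_g hj hx, Matrix.one_mulVec]

lemma smooth_pair (f h : SpinorField S) (x : M) : SmoothAt (pair f h) x := by
  obtain ⟨i, hi⟩ := S.cover x
  refine ((smoothAt_spinor f hi).rdot (smoothAt_spinor h hi)).congr_of_eventuallyEq ?_
  filter_upwards [(S.isOpen_U i).mem_nhds hi] with y hy using pair_eq f h hy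

lemma pair_self_nonneg (f : SpinorField S) (x : M) : 0 ≤ pair f f x := rdot_self_nonneg _

lemma pair_comm (f h : SpinorField S) (x : M) : pair f h x = pair h f x := rdot_comm _ _

lemma eq_zero_of_pair_self {f : SpinorField S} (h : ∀ x, pair f f x = 0) : f = 0 :=
  SpinorField.ext_on fun i x hx => by
    have := h x
    rw [pair_eq f f hx] at this
    exact rdot_self_eq_zero this

/-- The product of a spinor field with a smooth real function. -/
def mulField (r : M → ℝ) (hr : ∀ x, SmoothAt r x) (f : SpinorField S) : SpinorField S :=
  SpinorField.ofLocal (fun i x => (r x : ℂ) • f.1 i x)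
    (fun _ x hx => (hr x).ofReal.csmul (smoothAt_spinor f hx))
    (fun _ _ _ hi hj => by rw [spinor_change f hi hj, Matrix.mulVec_smul])

lemma mulField_apply {r : M → ℝ} (hr : ∀ x, SmoothAt r x) (f : SpinorField S) (i : ι) (x : M) :
    (mulField r hr f).1 i x = (r x : ℂ) • f.1 i x := by
  by_cases hx : x ∈ S.U i
  · exact SpinorField.ofLocal_apply _ _ _ hx
  · rw [(mulField r hr f).2.2.2 i x hx, f.2.2.2 i x hx, smul_zero]

lemma spinTerm_structCoeff (i : ι) (x : M) :
    ∃ τ : ℝ, spinTerm (fun a b k => (structCoeff D (S.frame i) x a b k : ℂ)) =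
      (∑ a, ((1 / 2 * divg S i a x : ℝ) : ℂ) • sig a) + (Complex.I * τ) • 1 := by
  refine ⟨1 / 4 * (structCoeff D (S.frame i) x 0 1 2 + structCoeff D (S.frame i) x 1 2 0 +
    structCoeff D (S.frame i) x 2 0 1), ?_⟩
  rw [spinTerm_eq (fun a b k => by rw [structCoeff_antisymm]; push_cast; rfl)]
  congr 1
  · refine Finset.sum_congr rfl fun a _ => ?_
    simp [divg]
  · push_cast
    ring_nf

lemma rdot_I_smul (τ : ℝ) (u v : Fin 2 → ℂ) :
    rdot ((Complex.I * τ) • u) v + rdot u ((Complex.I * τ) • v) = 0 := by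
  simp [rdot_eq]
  ring

lemma rdot_sig (a : Fin 3) (u v : Fin 2 → ℂ) : rdot (sig a *ᵥ u) v = rdot u (sig a *ᵥ v) := by
  rw [rdot_mulVec, sig_conjTranspose]

/-- The Pauli matrices are Hermitian, so the derivatives combine by the product rule. The Hermitian
half divergences add up to `divg`, while the imaginary scalar and the mean curvature terms cancel.
-/
lemma rdot_senOp_sub {f h : M → Fin 2 → ℂ} (hf : DiffAt f x) (hh : DiffAt h x) :
    rdot (senOp D (S.frame i) f x) (h x) - rdot (f x) (senAdj D (S.frame i) h x) =
      ∑ a, (lie (S.frame i a) (fun y => rdot (f y) (sig a *ᵥ h y)) x +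
        divg S i a x * rdot (f x) (sig a *ᵥ h x)) := by
  obtain ⟨τ, hτ⟩ := spinTerm_structCoeff (S := S) i x
  have hl : ∀ a, lie (S.frame i a) (fun y => rdot (f y) (sig a *ᵥ h y)) x =
      rdot (sig a *ᵥ lie (S.frame i a) f x) (h x) + rdot (f x) (sig a *ᵥ lie (S.frame i a) h x) := by
    intro a
    have hL := lie_comp_clm (X := S.frame i a)
      (LinearMap.toContinuousLinearMap ((sig a).mulVecLin.restrictScalars ℝ)) hh
    have hd : DiffAt (fun y => sig a *ᵥ h y) x :=
      ((LinearMap.toContinuousLinearMap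
        ((sig a).mulVecLin.restrictScalars ℝ)).mdifferentiableAt).comp x hh
    rw [lie_rdot hf hd, rdot_sig]
    congr 2
  have h2 : ((1 / 2 : ℂ) * meanCurv D (S.frame i) x) =
      ((1 / 2 * meanCurv D (S.frame i) x : ℝ) : ℂ) := by push_cast; rfl
  have hI := rdot_I_smul τ (f x) (h x)
  simp only [hl, senOp, senAdj, diracOp, hτ, h2, rdot_sub_left, rdot_add_left, rdot_neg_right,
    rdot_add_right, rdot_smul_left, rdot_smul_right, rdot_sum_left, rdot_sum_right,
    Matrix.add_mulVec, Matrix.sum_mulVec, Matrix.smul_mulVec, Matrix.one_mulVec,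
    rdot_sig _ (f x), Finset.sum_add_distrib]
  simp only [mul_assoc, ← Finset.mul_sum]
  linarith

lemma pair_sum_right {n : ℕ} (f : SpinorField S) (h : Fin n → SpinorField S) (x : M) :
    pair f (∑ k, h k) x = ∑ k, pair f (h k) x := by
  unfold pair
  rw [← rdot_sum_right]
  congr 1
  simp [Finset.sum_apply]

lemma tsupport_subset_of_forall {F G : Type*} [Zero F] [Zero G] {w : M → F} {r : M → G}
    (h : ∀ x, x ∉ tsupport r → w x = 0) : tsupport w ⊆ tsupport r :=
  closure_minimal (fun _ hx => by_contra fun hr => hx (h _ hr)) (isClosed_tsupport r)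

lemma smooth_of_tsupport {F : Type*} [NormedAddCommGroup F] [NormedSpace ℝ F] {w : M → F}
    (h : ∀ x ∈ tsupport w, SmoothAt w x) (x : M) : SmoothAt w x := by
  by_cases hx : x ∈ tsupport w
  · exact h x hx
  · exact (smoothAt_const (0 : F)).congr_of_eventuallyEq (notMem_tsupport_iff_eventuallyEq.mp hx)

lemma mulField_eventually_zero {r : M → ℝ} (hr : ∀ x, SmoothAt r x) (f : SpinorField S) (i : ι)
    (hx : x ∉ tsupport r) : (mulField r hr f).1 i =ᶠ[nhds x] fun _ => 0 := by
  filter_upwards [notMem_tsupport_iff_eventuallyEq.mp hx] with y hy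
  rw [mulField_apply, hy]
  simp

lemma diracOp_zero (e : Fin 3 → (x : M) → TangentSpace 𝓘(ℝ, E3) x) :
    diracOp D e (fun _ => 0) x = 0 := by
  simp [diracOp, lie_const]

lemma adjField_mulField_eq_zero {r : M → ℝ} (hr : ∀ x, SmoothAt r x) (f : SpinorField S) (i : ι)
    (hx : x ∉ tsupport r) : (adjField S (mulField r hr f)).1 i x = 0 := by
  by_cases hi : x ∈ S.U i
  · rw [adjField_apply _ hi, senAdj_congr (mulField_eventually_zero hr f i hx), senAdj,
      diracOp_zero]
    simp
  · exact (adjField S (mulField r hr f)).2.2.2 i x hi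

variable [CompactSpace M] {C : PatchCover S}

/-- Cutting off one of the two fields is enough: the flux in `rdot_senOp_sub` is then supported in
the patch and the divergence theorem applies. -/
lemma tot_pair_senField_mulField {p : M} {r : M → ℝ} (hr : ∀ x, SmoothAt r x)
    (hs : tsupport r ⊆ patch S p i) (f h : SpinorField S) :
    tot C (pair (senField S f) (mulField r hr h)) =
      tot C (pair f (adjField S (mulField r hr h))) := by
  set h' := mulField r hr h with hh'
  set X : Fin 3 → M → ℝ := fun a y => rdot (f.1 i y) (sig a *ᵥ h'.1 i y) with hX
  have h0 : ∀ x, x ∉ tsupport r → h'.1 i x = 0 := fun x hx =>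
    (mulField_eventually_zero hr h i hx).eq_of_nhds
  have hXs : ∀ a, tsupport (X a) ⊆ tsupport r := fun a => tsupport_subset_of_forall fun x hx => by
    simp only [hX, h0 x hx, Matrix.mulVec_zero]
    simp [rdot]
  have hXsm : ∀ a x, SmoothAt (X a) x := fun a => smooth_of_tsupport fun x hx => by
    have hxi := (hs (hXs a hx)).2
    exact (smoothAt_spinor f hxi).rdot
      (SmoothAt.mulVec (fun _ _ => smoothAt_const _) (smoothAt_spinor h' hxi))
  have hsub : ∀ x, pair (senField S f) h' x + -1 * pair f (adjField S h') x =
      ∑ a, (lie (S.frame i a) (X a) x + divg S i a x * X a x) := by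
    intro x
    by_cases hx : x ∈ S.U i
    · rw [pair_eq _ _ hx, pair_eq _ _ hx, senField_apply f hx, adjField_apply h' hx,
        ← rdot_senOp_sub (smoothAt_spinor f hx).diffAt (smoothAt_spinor h' hx).diffAt]
      ring
    · have hxr : x ∉ tsupport r := fun h => hx (hs h).2
      have hz : ∀ j, h'.1 j x = 0 := fun j => (mulField_eventually_zero hr h j hxr).eq_of_nhds
      rw [Finset.sum_eq_zero, pair, pair, hz, adjField_mulField_eq_zero hr h _ hxr]
      · simp [rdot]
      · intro a _
        have hxa : x ∉ tsupport (X a) := fun h => hxr (hXs a h)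
        rw [lie_eq_zero_of_notMem_tsupport hxa, image_eq_zero_of_notMem_tsupport hxa]
        simp
  have hXt : ∀ a, tsupport (fun x => lie (S.frame i a) (X a) x + divg S i a x * X a x) ⊆
      tsupport r := fun a => tsupport_subset_of_forall fun x hxr => by
    have hxa : x ∉ tsupport (X a) := fun h => hxr (hXs a h)
    rw [lie_eq_zero_of_notMem_tsupport hxa, image_eq_zero_of_notMem_tsupport hxa]
    simp
  have hdsm : ∀ a x, SmoothAt (fun x => lie (S.frame i a) (X a) x + divg S i a x * X a x) x :=
    fun a => smooth_of_tsupport fun x hx => by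
      have hxi := (hs (hXt a hx)).2
      exact smoothAt_add ((hXsm a x).lie (smoothFieldAt_frame S i a hxi))
        (smoothAt_mul (smoothAt_sum _ fun b => smoothAt_structCoeff S i hxi b a b) (hXsm a x))
  have key : tot C (fun x => pair (senField S f) h' x + -1 * pair f (adjField S h') x) = 0 := by
    simp only [hsub]
    rw [tot_sum hdsm]
    refine Finset.sum_eq_zero fun a _ => ?_
    rw [tot_eq_loc (hdsm a) ((hXt a).trans hs), loc_divergence (hXsm a) ((hXs a).trans hs)]
  rw [tot_add (smooth_pair _ _) fun x => smoothAt_mul (smoothAt_const _) (smooth_pair _ _ x),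
    tot_const_mul] at key
  linarith

lemma sum_mulField (h : SpinorField S) : ∑ k, mulField (C.ρ k) (C.smooth k) h = h :=
  SpinorField.ext_on fun i x _ => by
    have h1 : (∑ k, mulField (C.ρ k) (C.smooth k) h).1 i x = ∑ k, (C.ρ k x : ℂ) • h.1 i x := by
      simp [Finset.sum_apply, mulField_apply]
    rw [h1, ← Finset.sum_smul, ← Complex.ofReal_sum, C.sum_eq_one]
    simp

/-- The formal adjoint of the operator `√2 𝒟_{A'A}` is `√2 𝒟^{AA'}`. -/
lemma tot_pair_senField (f h : SpinorField S) :
    tot C (pair (senField S f) h) = tot C (pair f (adjField S h)) := by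
  have h1 : pair (senField S f) h =
      fun x => ∑ k, pair (senField S f) (mulField (C.ρ k) (C.smooth k) h) x := by
    ext x
    rw [← pair_sum_right, sum_mulField]
  have h2 : pair f (adjField S h) =
      fun x => ∑ k, pair f (adjField S (mulField (C.ρ k) (C.smooth k) h)) x := by
    ext x
    rw [← pair_sum_right, ← map_sum, sum_mulField]
  rw [h1, h2, tot_sum fun k => smooth_pair _ _, tot_sum fun k => smooth_pair _ _]
  exact Finset.sum_congr rfl fun k _ =>
    tot_pair_senField_mulField (C.smooth k) (C.tsupport_subset k) f h

end Pairing

/-! ### A Poincaré inequality for functions with vanishing cell averages -/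

section Poincare

open MeasureTheory
open scoped ENNReal

lemma sq_lintegral_le {α : Type*} [MeasurableSpace α] (μ : Measure α) {g : α → ℝ≥0∞}
    (hg : AEMeasurable g μ) : (∫⁻ t, g t ∂μ) ^ 2 ≤ μ Set.univ * ∫⁻ t, g t ^ 2 ∂μ := by
  have h := ENNReal.lintegral_mul_le_Lp_mul_Lq μ Real.HolderConjugate.two_two
    (f := fun _ => 1) aemeasurable_const hg
  simp only [Pi.mul_apply, one_mul, ENNReal.one_rpow, lintegral_const] at h
  calc (∫⁻ t, g t ∂μ) ^ 2
      ≤ (μ Set.univ ^ (1 / 2 : ℝ) * (∫⁻ t, g t ^ (2 : ℝ) ∂μ) ^ (1 / 2 : ℝ)) ^ 2 := by gcongr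
    _ = μ Set.univ * ∫⁻ t, g t ^ 2 ∂μ := by
      rw [mul_pow, ← ENNReal.rpow_two, ← ENNReal.rpow_two, ← ENNReal.rpow_mul, ← ENNReal.rpow_mul]
      simp

/-- The fundamental theorem of calculus along the segment and the Cauchy–Schwarz inequality. -/
lemma enorm_sub_sq_le {u : E3 → ℂ} (hu : ContDiff ℝ 1 u) (y h : E3) :
    ‖u (y + h) - u y‖ₑ ^ 2 ≤
      ‖h‖ₑ ^ 2 * ∫⁻ t in Set.Icc (0 : ℝ) 1, ‖fderiv ℝ u (y + t • h)‖ₑ ^ 2 := by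
  have hd : ∀ t : ℝ, HasDerivAt (fun t : ℝ => u (y + t • h)) (fderiv ℝ u (y + t • h) h) t := by
    intro t
    have h1 : HasFDerivAt u (fderiv ℝ u (y + t • h)) (y + t • h) :=
      (hu.differentiable one_ne_zero _).hasFDerivAt
    have h2 : HasDerivAt (fun t : ℝ => y + t • h) h t := by
      simpa using ((hasDerivAt_id t).smul_const h).const_add y
    exact h1.comp_hasDerivAt t h2
  have hcont : Continuous fun t : ℝ => fderiv ℝ u (y + t • h) :=
    (hu.continuous_fderiv one_ne_zero).comp (by fun_prop)
  have hc : Continuous fun t : ℝ => fderiv ℝ u (y + t • h) h := hcont.clm_apply continuous_const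
  have ftc : ∫ t in (0 : ℝ)..1, fderiv ℝ u (y + t • h) h = u (y + h) - u y := by
    rw [intervalIntegral.integral_eq_sub_of_hasDerivAt (fun t _ => hd t)
      (hc.intervalIntegrable _ _)]
    simp
  have h1 : ‖u (y + h) - u y‖ₑ ≤ ∫⁻ t in Set.Icc (0 : ℝ) 1, ‖fderiv ℝ u (y + t • h)‖ₑ * ‖h‖ₑ := by
    rw [← ftc, intervalIntegral.integral_of_le zero_le_one, ← integral_Icc_eq_integral_Ioc]
    refine (enorm_integral_le_lintegral_enorm _).trans (lintegral_mono fun t => ?_)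
    exact ContinuousLinearMap.le_opENorm _ _
  have h2 : ∫⁻ t in Set.Icc (0 : ℝ) 1, ‖fderiv ℝ u (y + t • h)‖ₑ * ‖h‖ₑ =
      ‖h‖ₑ * ∫⁻ t in Set.Icc (0 : ℝ) 1, ‖fderiv ℝ u (y + t • h)‖ₑ := by
    rw [lintegral_mul_const _ (by fun_prop), mul_comm]
  have h3 : (∫⁻ t in Set.Icc (0 : ℝ) 1, ‖fderiv ℝ u (y + t • h)‖ₑ) ^ 2 ≤
      ∫⁻ t in Set.Icc (0 : ℝ) 1, ‖fderiv ℝ u (y + t • h)‖ₑ ^ 2 := by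
    refine (sq_lintegral_le _ (by fun_prop)).trans ?_
    simp
  calc ‖u (y + h) - u y‖ₑ ^ 2
      ≤ (‖h‖ₑ * ∫⁻ t in Set.Icc (0 : ℝ) 1, ‖fderiv ℝ u (y + t • h)‖ₑ) ^ 2 := by
        rw [← h2]; gcongr
    _ ≤ _ := by rw [mul_pow]; gcongr

/-- Tonelli's theorem together with translation invariance of Lebesgue measure. -/
lemma lintegral_shift_le {u : E3 → ℂ} (hu : ContDiff ℝ 1 u) (h : E3) :
    ∫⁻ y, ‖u (y + h) - u y‖ₑ ^ 2 ≤ ‖h‖ₑ ^ 2 * ∫⁻ y, ‖fderiv ℝ u y‖ₑ ^ 2 := by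
  have hcont : Continuous fun p : E3 × ℝ => fderiv ℝ u (p.1 + p.2 • h) :=
    (hu.continuous_fderiv one_ne_zero).comp (by fun_prop)
  calc ∫⁻ y, ‖u (y + h) - u y‖ₑ ^ 2
      ≤ ∫⁻ y, ‖h‖ₑ ^ 2 * ∫⁻ t in Set.Icc (0 : ℝ) 1, ‖fderiv ℝ u (y + t • h)‖ₑ ^ 2 :=
        lintegral_mono fun y => enorm_sub_sq_le hu y h
    _ = ‖h‖ₑ ^ 2 * ∫⁻ y, ∫⁻ t in Set.Icc (0 : ℝ) 1, ‖fderiv ℝ u (y + t • h)‖ₑ ^ 2 :=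
        lintegral_const_mul' _ _ (by simp)
    _ = ‖h‖ₑ ^ 2 * ∫⁻ t in Set.Icc (0 : ℝ) 1, ∫⁻ y, ‖fderiv ℝ u (y + t • h)‖ₑ ^ 2 := by
        rw [lintegral_lintegral_swap]
        exact (hcont.enorm.measurable.pow_const 2).aemeasurable
    _ = ‖h‖ₑ ^ 2 * ∫⁻ y, ‖fderiv ℝ u y‖ₑ ^ 2 := by
        congr 1
        have : ∀ t : ℝ, ∫⁻ y, ‖fderiv ℝ u (y + t • h)‖ₑ ^ 2 = ∫⁻ y, ‖fderiv ℝ u y‖ₑ ^ 2 :=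
          fun t => lintegral_add_right_eq_self (fun y => ‖fderiv ℝ u y‖ₑ ^ 2) (t • h)
        simp [this]

/-- The half-open cubes of side `δ` of a grid. -/
def cell (δ : ℝ) (z : Fin 3 → ℤ) : Set E3 := {y | ∀ q, y q ∈ Set.Ico (δ * z q) (δ * z q + δ)}

/-- The closed cube of side `2 δ` around the origin. -/
def cube (δ : ℝ) : Set E3 := {y | ∀ q, y q ∈ Set.Icc (-δ) δ}

lemma measurableSet_cell (δ : ℝ) (z : Fin 3 → ℤ) : MeasurableSet (cell δ z) := by
  have : cell δ z = ⋂ q, (EuclideanSpace.proj q : E3 →L[ℝ] ℝ) ⁻¹'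
      Set.Ico (δ * z q) (δ * z q + δ) := by
    ext y; simp [cell]
  rw [this]
  exact MeasurableSet.iInter fun q =>
    measurableSet_Ico.preimage (EuclideanSpace.proj q : E3 →L[ℝ] ℝ).continuous.measurable

lemma measurableSet_cube (δ : ℝ) : MeasurableSet (cube δ) := by
  have : cube δ = ⋂ q, (EuclideanSpace.proj q : E3 →L[ℝ] ℝ) ⁻¹' Set.Icc (-δ) δ := by
    ext y; simp [cube]
  rw [this]
  exact MeasurableSet.iInter fun q =>
    measurableSet_Icc.preimage (EuclideanSpace.proj q : E3 →L[ℝ] ℝ).continuous.measurable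

lemma volume_cell {δ : ℝ} (z : Fin 3 → ℤ) : volume (cell δ z) = ENNReal.ofReal δ ^ 3 := by
  have h := (PiLp.volume_preserving_ofLp (Fin 3)).measure_preimage
    (s := Set.univ.pi fun q => Set.Ico (δ * z q) (δ * z q + δ))
    (MeasurableSet.univ_pi fun _ => measurableSet_Ico).nullMeasurableSet
  have h2 : cell δ z = WithLp.ofLp ⁻¹' Set.univ.pi fun q => Set.Ico (δ * z q) (δ * z q + δ) := by
    ext y; simp [cell]
  rw [h2]
  refine h.trans ?_
  rw [volume_pi_pi]
  simp

lemma volume_cube {δ : ℝ} : volume (cube δ) = ENNReal.ofReal (2 * δ) ^ 3 := by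
  have h := (PiLp.volume_preserving_ofLp (Fin 3)).measure_preimage
    (s := Set.univ.pi fun _ => Set.Icc (-δ) δ)
    (MeasurableSet.univ_pi fun _ => measurableSet_Icc).nullMeasurableSet
  have h2 : cube δ = WithLp.ofLp ⁻¹' Set.univ.pi fun _ => Set.Icc (-δ) δ := by
    ext y; simp only [cube, Set.mem_ofPred_eq, Set.mem_preimage, Set.mem_univ_pi]
  rw [h2]
  refine h.trans ?_
  rw [volume_pi_pi]
  simp [two_mul]

lemma exists_mem_cell {δ : ℝ} (hδ : 0 < δ) (x : E3) : ∃ z, x ∈ cell δ z := by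
  refine ⟨fun q => ⌊x q / δ⌋, fun q => ⟨?_, ?_⟩⟩
  · have := Int.floor_le (x q / δ)
    rw [le_div_iff₀ hδ] at this
    linarith
  · have := Int.lt_floor_add_one (x q / δ)
    rw [div_lt_iff₀ hδ] at this
    linarith

lemma sub_mem_cube {δ : ℝ} {z : Fin 3 → ℤ} {x y : E3} (hx : x ∈ cell δ z) (hy : y ∈ cell δ z) :
    y - x ∈ cube δ := fun q => by
  have h1 := hx q
  have h2 := hy q
  simp only [Set.mem_Ico] at h1 h2
  simp only [PiLp.sub_apply, Set.mem_Icc]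
  constructor <;> linarith

lemma enorm_sq_le_of_mem_cube {δ : ℝ} {h : E3} (hh : h ∈ cube δ) :
    ‖h‖ₑ ^ 2 ≤ ENNReal.ofReal (3 * δ ^ 2) := by
  rw [← ofReal_norm, ← ENNReal.ofReal_pow (norm_nonneg _)]
  refine ENNReal.ofReal_le_ofReal ?_
  rw [EuclideanSpace.norm_sq_eq, Fin.sum_univ_three]
  have : ∀ q, ‖h q‖ ^ 2 ≤ δ ^ 2 := fun q => by
    rw [Real.norm_eq_abs]
    exact pow_le_pow_left₀ (abs_nonneg _) (abs_le.2 (hh q)) 2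
  linarith [this 0, this 1, this 2]

/-- With vanishing average, `-δ³ u(x)` is the integral of `u y - u x` over the cell containing `x`;
Cauchy–Schwarz applies, and the cell lies in the translate of `cube δ` to `x`. The larger set is the
same for all `x`, which allows the order of integration to be exchanged afterwards. -/
lemma cell_average_le {δ : ℝ} (hδ : 0 < δ) {u : E3 → ℂ} (hu : Continuous u)
    (hc : HasCompactSupport u) (x : E3)
    (h0 : ∀ z, ∫ y in cell δ z, u y = 0) :
    ENNReal.ofReal δ ^ 3 * ‖u x‖ₑ ^ 2 ≤ ∫⁻ h in cube δ, ‖u (x + h) - u x‖ₑ ^ 2 := by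
  obtain ⟨z, hz⟩ := exists_mem_cell hδ x
  have hV : volume (cell δ z) = ENNReal.ofReal δ ^ 3 := volume_cell z
  have hVf : volume (cell δ z) ≠ ⊤ := by rw [hV]; finiteness
  have hV0 : ENNReal.ofReal δ ^ 3 ≠ 0 := by simpa using hδ
  have hVt : ENNReal.ofReal δ ^ 3 ≠ ⊤ := by finiteness
  have h1 : ∫ y in cell δ z, (u y - u x) = -((δ ^ 3 : ℝ) • u x) := by
    rw [integral_sub (hu.integrable_of_hasCompactSupport hc).integrableOn
      (integrableOn_const hVf), h0, setIntegral_const, Measure.real, hV, zero_sub,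
      ENNReal.toReal_pow, ENNReal.toReal_ofReal hδ.le]
  have h2 : ENNReal.ofReal δ ^ 3 * ‖u x‖ₑ ≤ ∫⁻ y in cell δ z, ‖u y - u x‖ₑ := by
    have := enorm_integral_le_lintegral_enorm (μ := volume.restrict (cell δ z)) fun y => u y - u x
    rw [h1, enorm_neg, enorm_smul, Real.enorm_eq_ofReal (by positivity),
      ENNReal.ofReal_pow hδ.le] at this
    exact this
  have h3 : (ENNReal.ofReal δ ^ 3) * (ENNReal.ofReal δ ^ 3 * ‖u x‖ₑ ^ 2) ≤
      ENNReal.ofReal δ ^ 3 * ∫⁻ y in cell δ z, ‖u y - u x‖ₑ ^ 2 := by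
    have hcs := sq_lintegral_le (volume.restrict (cell δ z)) (g := fun y => ‖u y - u x‖ₑ)
      (by fun_prop)
    rw [Measure.restrict_apply_univ, hV] at hcs
    calc (ENNReal.ofReal δ ^ 3) * (ENNReal.ofReal δ ^ 3 * ‖u x‖ₑ ^ 2)
        = (ENNReal.ofReal δ ^ 3 * ‖u x‖ₑ) ^ 2 := by ring
      _ ≤ (∫⁻ y in cell δ z, ‖u y - u x‖ₑ) ^ 2 := by gcongr
      _ ≤ _ := hcs
  refine ((ENNReal.mul_le_mul_iff_right hV0 hVt).1 h3).trans ?_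
  calc ∫⁻ y in cell δ z, ‖u y - u x‖ₑ ^ 2
      ≤ ∫⁻ y, (cube δ).indicator (fun h => ‖u (x + h) - u x‖ₑ ^ 2) (y - x) := by
        rw [← lintegral_indicator (measurableSet_cell δ z)]
        refine lintegral_mono fun y => ?_
        by_cases hy : y ∈ cell δ z
        · rw [Set.indicator_of_mem hy, Set.indicator_of_mem (sub_mem_cube hz hy), add_sub_cancel]
        · rw [Set.indicator_of_notMem hy]
          exact zero_le
    _ = ∫⁻ h, (cube δ).indicator (fun h => ‖u (x + h) - u x‖ₑ ^ 2) h :=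
        lintegral_sub_right_eq_self _ x
    _ = _ := lintegral_indicator (measurableSet_cube δ) _

/-- The constant is `3 δ²`, the bound for `|h|²` on the cube, times 8, the ratio of the volumes of
cube and cell. -/
lemma lintegral_sq_le {δ : ℝ} (hδ : 0 < δ) {u : E3 → ℂ} (hu : ContDiff ℝ 1 u)
    (hc : HasCompactSupport u) (h0 : ∀ z, ∫ y in cell δ z, u y = 0) :
    ∫⁻ x, ‖u x‖ₑ ^ 2 ≤ ENNReal.ofReal (24 * δ ^ 2) * ∫⁻ x, ‖fderiv ℝ u x‖ₑ ^ 2 := by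
  have hV0 : ENNReal.ofReal δ ^ 3 ≠ 0 := by simpa using hδ
  have hVt : ENNReal.ofReal δ ^ 3 ≠ ⊤ := by finiteness
  have hcu := hu.continuous
  have hm : Measurable fun p : E3 × E3 => ‖u (p.1 + p.2) - u p.1‖ₑ ^ 2 := by
    refine Measurable.pow_const (Continuous.measurable ?_) 2
    exact Continuous.enorm (by fun_prop)
  refine (ENNReal.mul_le_mul_iff_right hV0 hVt).1 ?_
  calc ENNReal.ofReal δ ^ 3 * ∫⁻ x, ‖u x‖ₑ ^ 2
      = ∫⁻ x, ENNReal.ofReal δ ^ 3 * ‖u x‖ₑ ^ 2 := (lintegral_const_mul' _ _ hVt).symm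
    _ ≤ ∫⁻ x, ∫⁻ h in cube δ, ‖u (x + h) - u x‖ₑ ^ 2 :=
        lintegral_mono fun x => cell_average_le hδ hcu hc x h0
    _ = ∫⁻ h in cube δ, ∫⁻ x, ‖u (x + h) - u x‖ₑ ^ 2 := lintegral_lintegral_swap hm.aemeasurable
    _ ≤ ∫⁻ h in cube δ, ENNReal.ofReal (3 * δ ^ 2) * ∫⁻ x, ‖fderiv ℝ u x‖ₑ ^ 2 := by
        refine setLIntegral_mono' (measurableSet_cube δ) fun h hh => ?_
        refine (lintegral_shift_le hu h).trans ?_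
        gcongr
        exact enorm_sq_le_of_mem_cube hh
    _ = ENNReal.ofReal δ ^ 3 * (ENNReal.ofReal (24 * δ ^ 2) * ∫⁻ x, ‖fderiv ℝ u x‖ₑ ^ 2) := by
        rw [setLIntegral_const, volume_cube, mul_right_comm, ← mul_assoc]
        congr 1
        rw [← ENNReal.ofReal_pow (by positivity), ← ENNReal.ofReal_pow hδ.le,
          ← ENNReal.ofReal_mul (by positivity), ← ENNReal.ofReal_mul (by positivity)]
        congr 1
        ring

lemma integrable_norm_sq {F : Type*} [NormedAddCommGroup F] {w : E3 → F} (hw : Continuous w)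
    (hc : HasCompactSupport w) : Integrable fun y => ‖w y‖ ^ 2 := by
  refine (hw.norm.pow 2).integrable_of_hasCompactSupport ?_
  have h : HasCompactSupport ((fun v : F => ‖v‖ ^ 2) ∘ w) := hc.comp_left (by simp)
  exact h

lemma integral_sq_le {δ : ℝ} (hδ : 0 < δ) {u : E3 → ℂ} (hu : ContDiff ℝ 1 u)
    (hc : HasCompactSupport u) (h0 : ∀ z, ∫ y in cell δ z, u y = 0) :
    ∫ x, ‖u x‖ ^ 2 ≤ 24 * δ ^ 2 * ∫ x, ‖fderiv ℝ u x‖ ^ 2 := by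
  have hcd := hu.continuous_fderiv one_ne_zero
  have i1 := integrable_norm_sq hu.continuous hc
  have i2 := integrable_norm_sq hcd (hc.fderiv ℝ)
  have h := lintegral_sq_le hδ hu hc h0
  have e : ∀ {F : Type} [NormedAddCommGroup F] (v : F), ‖v‖ₑ ^ 2 = ENNReal.ofReal (‖v‖ ^ 2) :=
    fun v => by rw [← ofReal_norm, ENNReal.ofReal_pow (norm_nonneg _)]
  simp only [e] at h
  rw [← ofReal_integral_eq_lintegral_ofReal i1 (Filter.Eventually.of_forall fun _ => by positivity),
    ← ofReal_integral_eq_lintegral_ofReal i2 (Filter.Eventually.of_forall fun _ => by positivity),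
    ← ENNReal.ofReal_mul (by positivity)] at h
  exact (ENNReal.ofReal_le_ofReal_iff
    (mul_nonneg (by positivity) (integral_nonneg fun _ => by positivity))).1 h

/-- A Poincaré inequality for functions supported in a compact set, with vanishing integrals over
finitely many cells. -/
lemma exists_poincare {K : Set E3} (hK : IsCompact K) {ε : ℝ} (hε : 0 < ε) :
    ∃ (δ : ℝ) (s : Finset (Fin 3 → ℤ)), ∀ u : E3 → ℂ, ContDiff ℝ 1 u → tsupport u ⊆ K →
      (∀ z ∈ s, ∫ y in cell δ z, u y = 0) →
      ∫ x, ‖u x‖ ^ 2 ≤ ε * ∫ x, ‖fderiv ℝ u x‖ ^ 2 := by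
  set δ := √(ε / 24) with hδ
  have hδ0 : 0 < δ := Real.sqrt_pos.2 (by positivity)
  have hδ2 : 24 * δ ^ 2 = ε := by
    rw [hδ, Real.sq_sqrt (by positivity)]; ring
  obtain ⟨R, hR⟩ := hK.isBounded.exists_norm_le
  -- Cells with an index outside `[-N, N]` do not meet the ball of radius `R`, so their averages
  -- vanish automatically.
  set N : ℤ := ⌈R / δ⌉ + 1 with hN
  refine ⟨δ, Fintype.piFinset fun _ => Finset.Icc (-N) N, fun u hu hs h0 => ?_⟩
  have hall : ∀ z, ∫ y in cell δ z, u y = 0 := by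
    intro z
    by_cases hz : z ∈ Fintype.piFinset fun _ : Fin 3 => Finset.Icc (-N) N
    · exact h0 z hz
    · refine setIntegral_eq_zero_of_forall_eq_zero fun y hy => ?_
      by_contra hne
      have hyR := hR y (hs (subset_tsupport u hne))
      refine hz (Fintype.mem_piFinset.2 fun q => Finset.mem_Icc.2 ?_)
      have h1 : |y q| ≤ R := (PiLp.norm_apply_le y q).trans hyR
      have h2 := hy q
      rw [Set.mem_Ico] at h2
      rw [abs_le] at h1
      have h3 : R / δ ≤ (N : ℝ) - 1 := by
        rw [hN]; push_cast
        linarith [Int.le_ceil (R / δ)]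
      rw [div_le_iff₀ hδ0] at h3
      constructor
      · have : -(N : ℝ) ≤ z q := by
          by_contra hlt
          push Not at hlt
          nlinarith [mul_pos hδ0 (sub_pos.2 hlt)]
        exact_mod_cast this
      · have : (z q : ℝ) ≤ N := by
          by_contra hlt
          push Not at hlt
          nlinarith [mul_pos hδ0 (sub_pos.2 hlt)]
        exact_mod_cast this
  rw [← hδ2]
  exact integral_sq_le hδ0 hu (hK.of_isClosed_subset (isClosed_tsupport u) hs) hall

end Poincare

/-! ### The Gårding inequality in a patch -/

section Gaarding

variable {M : Type*} [TopologicalSpace M] [ChartedSpace E3 M] [IsManifold 𝓘(ℝ, E3) ∞ M]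
  {D : InitialData M} {ι : Type*} {S : SpinStructure D ι} {p x : M} {i : ι} {K : Set M}
  {u : M → Fin 2 → ℂ}

/-- The weights suit `crossTerm_le`: fifteen terms, each absorbing `1/30` of the energy, use up one
half of it. -/
lemma rdot_le (u v : Fin 2 → ℂ) : rdot u v ≤ 15 / 2 * rdot u u + 1 / 30 * rdot v v := by
  have := rdot_self_nonneg (((15 : ℝ) : ℂ) • u - v)
  rw [rdot_sub_left, rdot_comm, rdot_sub_left, rdot_comm v (_ - v), rdot_sub_left] at this
  simp only [rdot_smul_left, rdot_smul_right, rdot_comm v u] at this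
  linarith

lemma rdot_sig_self (a : Fin 3) (v : Fin 2 → ℂ) : rdot (sig a *ᵥ v) (sig a *ᵥ v) = rdot v v := by
  rw [rdot_sig, Matrix.mulVec_mulVec, sig_mul_self, Matrix.one_mulVec]

lemma mul_rdot_sig_le {c b : ℝ} (hc : |c| ≤ b) (a a' : Fin 3) (u v : Fin 2 → ℂ) :
    c * rdot u (sig a *ᵥ sig a' *ᵥ v) ≤ 15 / 2 * b ^ 2 * rdot u u + 1 / 30 * rdot v v := by
  rw [← rdot_smul_left]
  refine (rdot_le _ _).trans ?_
  rw [rdot_smul_left, rdot_smul_right, rdot_sig_self, rdot_sig_self]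
  have h1 : c * c ≤ b ^ 2 := by
    rw [← sq, ← sq_abs]
    exact pow_le_pow_left₀ (abs_nonneg c) hc 2
  nlinarith [rdot_self_nonneg u]

lemma rdot_mulVec_self_le (N : Matrix (Fin 2) (Fin 2) ℂ) (v : Fin 2 → ℂ) :
    rdot (N *ᵥ v) (N *ᵥ v) ≤ (∑ A, ∑ B, ‖N A B‖ ^ 2) * rdot v v := by
  have key : ∀ A, ‖(N *ᵥ v) A‖ ^ 2 ≤ (∑ B, ‖N A B‖ ^ 2) * (‖v 0‖ ^ 2 + ‖v 1‖ ^ 2) := by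
    intro A
    have h1 : ‖(N *ᵥ v) A‖ ≤ ‖N A 0‖ * ‖v 0‖ + ‖N A 1‖ * ‖v 1‖ := by
      simp only [Matrix.mulVec, dotProduct, Fin.sum_univ_two]
      refine (norm_add_le _ _).trans ?_
      rw [norm_mul, norm_mul]
    rw [Fin.sum_univ_two]
    calc ‖(N *ᵥ v) A‖ ^ 2 ≤ (‖N A 0‖ * ‖v 0‖ + ‖N A 1‖ * ‖v 1‖) ^ 2 := by gcongr
      _ ≤ _ := by nlinarith [sq_nonneg (‖N A 0‖ * ‖v 1‖ - ‖N A 1‖ * ‖v 0‖)]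
  rw [rdot_self_eq, rdot_self_eq, Fin.sum_univ_two, add_mul]
  exact add_le_add (key 0) (key 1)

/-- The principal part of the operator. -/
def princ (S : SpinStructure D ι) (i : ι) (u : M → Fin 2 → ℂ) (x : M) : Fin 2 → ℂ :=
  ∑ a, sig a *ᵥ lie (S.frame i a) u x

/-- The zero order part of the operator. -/
def zeroth (S : SpinStructure D ι) (i : ι) (x : M) : Matrix (Fin 2) (Fin 2) ℂ :=
  spinTerm (fun a b k => (structCoeff D (S.frame i) x a b k : ℂ)) -
    ((1 / 2 : ℂ) * meanCurv D (S.frame i) x) • 1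

/-- The squared length of the gradient. -/
def energy (S : SpinStructure D ι) (i : ι) (u : M → Fin 2 → ℂ) (x : M) : ℝ :=
  ∑ a, rdot (lie (S.frame i a) u x) (lie (S.frame i a) u x)

/-- The squared length of the operator. -/
def senSq (S : SpinStructure D ι) (i : ι) (u : M → Fin 2 → ℂ) (x : M) : ℝ :=
  rdot (senOp D (S.frame i) u x) (senOp D (S.frame i) u x)

lemma senOp_eq_princ : senOp D (S.frame i) u x = princ S i u x + zeroth S i x *ᵥ u x := by
  simp only [senOp, diracOp, princ, zeroth, Matrix.sub_mulVec, Matrix.smul_mulVec,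
    Matrix.one_mulVec]
  abel

lemma energy_nonneg : 0 ≤ energy S i u x := Finset.sum_nonneg fun _ _ => rdot_self_nonneg _

/-- The terms of order one in the commutators of the frame. -/
def crossTerm (S : SpinStructure D ι) (i : ι) (u : M → Fin 2 → ℂ) (a b : Fin 3) (x : M) : ℝ :=
  divg S i a x * rdot (u x) (sig a *ᵥ sig b *ᵥ lie (S.frame i b) u x) -
    divg S i b x * rdot (u x) (sig a *ᵥ sig b *ᵥ lie (S.frame i a) u x) +
    ∑ k, structCoeff D (S.frame i) x a b k *
      rdot (u x) (sig a *ᵥ sig b *ᵥ lie (S.frame i k) u x)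

/-- The flux whose divergence gives the cross terms. -/
def flux (S : SpinStructure D ι) (i : ι) (u : M → Fin 2 → ℂ) (a b c : Fin 3) (x : M) : ℝ :=
  rdot (u x) (sig a *ᵥ sig b *ᵥ lie (S.frame i c) u x)

lemma lie_mlieBracket_frame_spinor (a b : Fin 3) (hx : x ∈ S.U i)
    (hu : ∀ x, SmoothAt u x) :
    lie (S.frame i a) (lie (S.frame i b) u) x - lie (S.frame i b) (lie (S.frame i a) u) x =
      ∑ k, (structCoeff D (S.frame i) x a b k : ℂ) • lie (S.frame i k) u x := by
  have hd : ∀ c, DiffAt (lie (S.frame i c) u) x := fun c =>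
    ((hu x).lie (smoothFieldAt_frame S i c hx)).diffAt
  have hcomp : ∀ c A, (fun y => lie (S.frame i c) u y A) = lie (S.frame i c) fun y => u y A :=
    fun c A => funext fun y => lie_apply (hu y).diffAt A
  ext A
  rw [Pi.sub_apply, lie_apply (hd b), lie_apply (hd a), hcomp, hcomp,
    lie_mlieBracket_frame S i a b hx
      (Filter.Eventually.of_forall fun y => (hu y).comp_apply A), Finset.sum_apply]
  refine Finset.sum_congr rfl fun k _ => ?_
  rw [Pi.smul_apply, smul_eq_mul, lie_apply (hu x).diffAt]

lemma lie_sig_mulVec {X : (x : M) → TangentSpace 𝓘(ℝ, E3) x} {h : M → Fin 2 → ℂ}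
    (hh : DiffAt h x) (a : Fin 3) :
    DiffAt (fun y => sig a *ᵥ h y) x ∧ lie X (fun y => sig a *ᵥ h y) x = sig a *ᵥ lie X h x :=
  ⟨((LinearMap.toContinuousLinearMap
      ((sig a).mulVecLin.restrictScalars ℝ)).mdifferentiableAt).comp x hh,
    lie_comp_clm (LinearMap.toContinuousLinearMap ((sig a).mulVecLin.restrictScalars ℝ)) hh⟩

lemma lie_flux (hx : x ∈ S.U i) (hu : ∀ x, SmoothAt u x) (a b c d : Fin 3) :
    lie (S.frame i d) (flux S i u a b c) x =
      rdot (lie (S.frame i d) u x) (sig a *ᵥ sig b *ᵥ lie (S.frame i c) u x) +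
        rdot (u x) (sig a *ᵥ sig b *ᵥ lie (S.frame i d) (lie (S.frame i c) u) x) := by
  have h1 : DiffAt (lie (S.frame i c) u) x :=
    ((hu x).lie (smoothFieldAt_frame S i c hx)).diffAt
  have h2 := lie_sig_mulVec (X := S.frame i d) h1 b
  have h3 := lie_sig_mulVec (X := S.frame i d) h2.1 a
  unfold flux
  rw [lie_rdot (hu x).diffAt h3.1, h3.2, h2.2]

/-- For `a ≠ b` the product of the two Pauli matrices is anti-Hermitian, so the mixed term is
antisymmetrised in the derivatives. It is therefore a difference of divergences plus a commutator of
frame fields, which has order one only. -/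
lemma cross_eq (hx : x ∈ S.U i) (hu : ∀ x, SmoothAt u x) {a b : Fin 3} (hab : a ≠ b) :
    rdot (sig a *ᵥ lie (S.frame i a) u x) (sig b *ᵥ lie (S.frame i b) u x) * 2 =
      (lie (S.frame i a) (flux S i u a b b) x + divg S i a x * flux S i u a b b x) -
      (lie (S.frame i b) (flux S i u a b a) x + divg S i b x * flux S i u a b a x) -
      crossTerm S i u a b x := by
  rw [lie_flux hx hu, lie_flux hx hu]
  have hc := congrArg (fun v => rdot (u x) (sig a *ᵥ sig b *ᵥ v))
    (lie_mlieBracket_frame_spinor a b hx hu)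
  simp only [Matrix.mulVec_sub, Matrix.mulVec_sum, Matrix.mulVec_smul, rdot_sum_right,
    rdot_smul_right] at hc
  rw [sub_eq_add_neg, rdot_add_right, rdot_neg_right] at hc
  have hs : rdot (lie (S.frame i b) u x) (sig a *ᵥ sig b *ᵥ lie (S.frame i a) u x) =
      - rdot (sig a *ᵥ lie (S.frame i a) u x) (sig b *ᵥ lie (S.frame i b) u x) := by
    rw [Matrix.mulVec_mulVec, sig_anticomm hab, Matrix.neg_mulVec, rdot_neg_right,
      ← Matrix.mulVec_mulVec, ← rdot_sig, rdot_comm]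
  rw [hs, rdot_sig]
  unfold crossTerm flux
  rw [rdot_sig a (lie (S.frame i a) u x)] at *
  linarith

/-- A Weitzenböck-type identity: the diagonal terms of the square of the principal part are the full
gradient, and the mixed ones are handled by `cross_eq`. After integration the bracket of divergences
disappears. -/
lemma energy_eq (hx : x ∈ S.U i) (hu : ∀ x, SmoothAt u x) :
    energy S i u x + (
      ((lie (S.frame i 0) (flux S i u 0 1 1) x + divg S i 0 x * flux S i u 0 1 1 x) -
      (lie (S.frame i 1) (flux S i u 0 1 0) x + divg S i 1 x * flux S i u 0 1 0 x)) +
      ((lie (S.frame i 0) (flux S i u 0 2 2) x + divg S i 0 x * flux S i u 0 2 2 x) -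
      (lie (S.frame i 2) (flux S i u 0 2 0) x + divg S i 2 x * flux S i u 0 2 0 x)) +
      ((lie (S.frame i 1) (flux S i u 1 2 2) x + divg S i 1 x * flux S i u 1 2 2 x) -
      (lie (S.frame i 2) (flux S i u 1 2 1) x + divg S i 2 x * flux S i u 1 2 1 x))) =
    rdot (princ S i u x) (princ S i u x) +
      (crossTerm S i u 0 1 x + crossTerm S i u 0 2 x + crossTerm S i u 1 2 x) := by
  have h01 := cross_eq (u := u) hx hu (a := 0) (b := 1) (by decide)
  have h02 := cross_eq (u := u) hx hu (a := 0) (b := 2) (by decide)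
  have h12 := cross_eq (u := u) hx hu (a := 1) (b := 2) (by decide)
  have hP : rdot (princ S i u x) (princ S i u x) = energy S i u x +
      rdot (sig 0 *ᵥ lie (S.frame i 0) u x) (sig 1 *ᵥ lie (S.frame i 1) u x) * 2 +
      rdot (sig 0 *ᵥ lie (S.frame i 0) u x) (sig 2 *ᵥ lie (S.frame i 2) u x) * 2 +
      rdot (sig 1 *ᵥ lie (S.frame i 1) u x) (sig 2 *ᵥ lie (S.frame i 2) u x) * 2 := by
    simp only [princ, energy, Fin.sum_univ_three, rdot_add_left, rdot_add_right, rdot_sig_self]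
    rw [rdot_comm (sig 1 *ᵥ _) (sig 0 *ᵥ _), rdot_comm (sig 2 *ᵥ _) (sig 0 *ᵥ _),
      rdot_comm (sig 2 *ᵥ _) (sig 1 *ᵥ _)]
    ring
  linarith

/-- Each of the three cross terms has five summands (two with `divg`, three with structure
functions), each bounded by `mul_rdot_sig_le`. -/
lemma crossTerm_le {b : ℝ} (hd : ∀ a, |divg S i a x| ≤ b)
    (hs : ∀ a a' k, |structCoeff D (S.frame i) x a a' k| ≤ b) :
    crossTerm S i u 0 1 x + crossTerm S i u 0 2 x + crossTerm S i u 1 2 x ≤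
      225 / 2 * b ^ 2 * rdot (u x) (u x) + 1 / 2 * energy S i u x := by
  have hE : ∀ k, rdot (lie (S.frame i k) u x) (lie (S.frame i k) u x) ≤ energy S i u x := fun k =>
    Finset.single_le_sum (f := fun k => rdot (lie (S.frame i k) u x) (lie (S.frame i k) u x))
      (fun _ _ => rdot_self_nonneg _) (Finset.mem_univ k)
  have h1 : ∀ {c : ℝ}, |c| ≤ b → ∀ a a' k, c * rdot (u x) (sig a *ᵥ sig a' *ᵥ
      lie (S.frame i k) u x) ≤ 15 / 2 * b ^ 2 * rdot (u x) (u x) + 1 / 30 * energy S i u x :=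
    fun hc a a' k => (mul_rdot_sig_le hc a a' _ _).trans (by linarith [hE k])
  have h2 : ∀ a a', crossTerm S i u a a' x ≤
      5 * (15 / 2 * b ^ 2 * rdot (u x) (u x) + 1 / 30 * energy S i u x) := by
    intro a a'
    have e1 := h1 (hd a) a a' a'
    have e2 := h1 (c := -divg S i a' x) (by rw [abs_neg]; exact hd a') a a' a
    have e3 := fun k => h1 (hs a a' k) a a' k
    rw [crossTerm, Fin.sum_univ_three]
    linarith [e3 0, e3 1, e3 2]
  linarith [h2 0 1, h2 0 2, h2 1 2]

lemma exists_coeff_bound [CompactSpace M] (hK : IsClosed K) (hKp : K ⊆ S.U i) :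
    ∃ b : ℝ, ∀ x ∈ K, (∀ a, |divg S i a x| ≤ b) ∧
      (∀ a a' k, |structCoeff D (S.frame i) x a a' k| ≤ b) ∧
      ∑ A, ∑ B, ‖zeroth S i x A B‖ ^ 2 ≤ b := by
  have hs : ∀ a a' k, ContinuousOn (fun x => structCoeff D (S.frame i) x a a' k) K :=
    fun a a' k x hx => (smoothAt_structCoeff S i (hKp hx) a a' k).continuousAt.continuousWithinAt
  have hd : ∀ a, ContinuousOn (fun x => divg S i a x) K := fun a =>
    continuousOn_finsetSum _ fun b _ => hs b a b
  have hz : ∀ A B, ContinuousOn (fun x => zeroth S i x A B) K := fun A B x hx => by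
    refine ContinuousAt.continuousWithinAt ?_
    refine ContinuousAt.sub (smoothAt_spinTerm (hKp hx) A B).continuousAt ?_
    exact ((continuousAt_const.mul (smoothAt_meanCurv (hKp hx)).ofReal.continuousAt)).mul
      continuousAt_const
  have hF : ContinuousOn (fun x => (∑ a, |divg S i a x|) +
      (∑ a, ∑ a', ∑ k, |structCoeff D (S.frame i) x a a' k|) +
      ∑ A, ∑ B, ‖zeroth S i x A B‖ ^ 2) K :=
    ((continuousOn_finsetSum _ fun a _ => (hd a).abs).add
      (continuousOn_finsetSum _ fun a _ => continuousOn_finsetSum _ fun a' _ =>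
        continuousOn_finsetSum _ fun k _ => (hs a a' k).abs)).add
      (continuousOn_finsetSum _ fun A _ => continuousOn_finsetSum _ fun B _ =>
        (hz A B).norm.pow 2)
  obtain ⟨b, hb⟩ := hK.isCompact.exists_bound_of_continuousOn hF
  refine ⟨b, fun x hx => ?_⟩
  have hb' := (le_abs_self _).trans (hb x hx)
  have n1 : ∀ a, |divg S i a x| ≤ ∑ a, |divg S i a x| := fun a =>
    Finset.single_le_sum (f := fun a => |divg S i a x|) (fun _ _ => abs_nonneg _)
      (Finset.mem_univ a)
  have n2 : ∀ a a' k, |structCoeff D (S.frame i) x a a' k| ≤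
      ∑ a, ∑ a', ∑ k, |structCoeff D (S.frame i) x a a' k| := fun a a' k =>
    (Finset.single_le_sum (f := fun k => |structCoeff D (S.frame i) x a a' k|)
      (fun _ _ => abs_nonneg _) (Finset.mem_univ k)).trans
    ((Finset.single_le_sum (f := fun a' => ∑ k, |structCoeff D (S.frame i) x a a' k|)
      (fun _ _ => Finset.sum_nonneg fun _ _ => abs_nonneg _) (Finset.mem_univ a')).trans
    (Finset.single_le_sum (f := fun a => ∑ a', ∑ k, |structCoeff D (S.frame i) x a a' k|)
      (fun _ _ => Finset.sum_nonneg fun _ _ => Finset.sum_nonneg fun _ _ => abs_nonneg _)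
      (Finset.mem_univ a)))
  have p1 : 0 ≤ ∑ a, |divg S i a x| := Finset.sum_nonneg fun _ _ => abs_nonneg _
  have p2 : 0 ≤ ∑ a, ∑ a', ∑ k, |structCoeff D (S.frame i) x a a' k| :=
    Finset.sum_nonneg fun _ _ => Finset.sum_nonneg fun _ _ => Finset.sum_nonneg fun _ _ =>
      abs_nonneg _
  have p3 : 0 ≤ ∑ A, ∑ B, ‖zeroth S i x A B‖ ^ 2 :=
    Finset.sum_nonneg fun _ _ => Finset.sum_nonneg fun _ _ => by positivity
  exact ⟨fun a => by linarith [n1 a], fun a a' k => by linarith [n2 a a' k], by linarith⟩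

/-- Smooth functions supported in a patch. -/
def Adm (S : SpinStructure D ι) (p : M) (i : ι) (w : M → ℝ) : Prop :=
  (∀ x, SmoothAt w x) ∧ tsupport w ⊆ patch S p i

lemma adm_of {F : Type*} [Zero F] {u : M → F} {w : M → ℝ} (hs : tsupport u ⊆ patch S p i)
    (h0 : ∀ x, x ∉ tsupport u → w x = 0) (hsm : ∀ x ∈ patch S p i, SmoothAt w x) :
    Adm S p i w := by
  have h1 : tsupport w ⊆ tsupport u := tsupport_subset_of_forall h0
  exact ⟨smooth_of_tsupport fun x hx => hsm x (hs (h1 hx)), h1.trans hs⟩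

lemma Adm.add {v w : M → ℝ} (hv : Adm S p i v) (hw : Adm S p i w) :
    Adm S p i fun x => v x + w x :=
  ⟨fun x => smoothAt_add (hv.1 x) (hw.1 x),
    (tsupport_add _ _).trans (Set.union_subset hv.2 hw.2)⟩

lemma Adm.const_mul [CompactSpace M] {w : M → ℝ} (hw : Adm S p i w) (c : ℝ) :
    Adm S p i fun x => c * w x :=
  ⟨fun x => smoothAt_mul (smoothAt_const c) (hw.1 x),
    (tsupport_mul_subset (h := fun _ => c)).trans hw.2⟩

lemma loc_mono [CompactSpace M] {v w : M → ℝ} (hv : Adm S p i v) (hw : Adm S p i w)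
    (h : ∀ x, v x ≤ w x) : loc S p i v ≤ loc S p i w := by
  have hn : Adm S p i fun x => w x + -1 * v x := hw.add (hv.const_mul (-1))
  have h1 : 0 ≤ loc S p i fun x => w x + -1 * v x := loc_nonneg fun x => by linarith [h x]
  rw [loc_add hw.1 hw.2 (hv.const_mul (-1)).1 (hv.const_mul (-1)).2, loc_const_mul] at h1
  linarith

lemma rdot_zero_left (v : Fin 2 → ℂ) : rdot 0 v = 0 := by simp [rdot]

section

variable (hu : ∀ x, SmoothAt u x) (hs : tsupport u ⊆ patch S p i)
include hu hs

lemma adm_rdot : Adm S p i fun x => rdot (u x) (u x) :=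
  adm_of hs (fun x hx => by rw [image_eq_zero_of_notMem_tsupport hx, rdot_zero_left])
    fun x _ => (hu x).rdot (hu x)

lemma adm_energy : Adm S p i (energy S i u) :=
  adm_of hs (fun x hx => by
      simp [energy, lie_eq_zero_of_notMem_tsupport hx, rdot_zero_left])
    fun x hx => smoothAt_sum _ fun a => ((hu x).lie (smoothFieldAt_frame S i a hx.2)).rdot
      ((hu x).lie (smoothFieldAt_frame S i a hx.2))

lemma adm_senSq : Adm S p i (senSq S i u) :=
  adm_of hs (fun x hx => by
      simp [senSq, senOp_eq_princ, princ, lie_eq_zero_of_notMem_tsupport hx,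
        image_eq_zero_of_notMem_tsupport hx, rdot_zero_left])
    fun x hx => ((hu x).senOp hx.2).rdot ((hu x).senOp hx.2)

lemma adm_flux (a b c : Fin 3) : Adm S p i (flux S i u a b c) :=
  adm_of hs (fun x hx => by
      simp [flux, image_eq_zero_of_notMem_tsupport hx, rdot_zero_left])
    fun x hx => (hu x).rdot (SmoothAt.mulVec (fun _ _ => smoothAt_const _)
      (SmoothAt.mulVec (fun _ _ => smoothAt_const _)
        ((hu x).lie (smoothFieldAt_frame S i c hx.2))))

end

lemma adm_divergence {w : M → ℝ} (hw : Adm S p i w) (a : Fin 3) :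
    Adm S p i fun x => lie (S.frame i a) w x + divg S i a x * w x :=
  adm_of hw.2 (fun x hx => by
      simp [lie_eq_zero_of_notMem_tsupport hx, image_eq_zero_of_notMem_tsupport hx])
    fun x hx => smoothAt_add ((hw.1 x).lie (smoothFieldAt_frame S i a hx.2))
      (smoothAt_mul (smoothAt_sum _ fun b => smoothAt_structCoeff S i hx.2 b a b) (hw.1 x))

lemma loc_signed_divergence [CompactSpace M] {m : ℕ} {w : Fin m → M → ℝ}
    (hw : ∀ l, Adm S p i (w l)) (s : Fin m → ℝ) (e : Fin m → Fin 3) :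
    Adm S p i (fun x => ∑ l, s l * (lie (S.frame i (e l)) (w l) x + divg S i (e l) x * w l x)) ∧
    loc S p i (fun x => ∑ l, s l * (lie (S.frame i (e l)) (w l) x + divg S i (e l) x * w l x)) =
      0 := by
  have h1 := fun l => (adm_divergence (hw l) (e l)).const_mul (s l)
  have h2 := loc_sum (fun l => (h1 l).1) (fun l => (h1 l).2) Finset.univ
  refine ⟨⟨fun x => smoothAt_sum _ fun l => (h1 l).1 x, h2.2⟩, h2.1.trans ?_⟩
  refine Finset.sum_eq_zero fun l _ => ?_
  rw [loc_const_mul, loc_divergence (hw l).1 (hw l).2, mul_zero]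

/-- Integration of `energy_eq`, with half of the energy absorbed by `crossTerm_le` and the principal
part replaced by the full operator at the cost of a zero order term. -/
lemma exists_gaarding [CompactSpace M] (hK : IsClosed K) (hKp : K ⊆ patch S p i) :
    ∃ C : ℝ, 0 ≤ C ∧ ∀ u : M → Fin 2 → ℂ, (∀ x, SmoothAt u x) → tsupport u ⊆ K →
      loc S p i (energy S i u) ≤
        C * (loc S p i (senSq S i u) + loc S p i fun x => rdot (u x) (u x)) := by
  obtain ⟨b, hb⟩ := exists_coeff_bound hK (hKp.trans Set.inter_subset_right)
  set L := 2 * |b| + 225 / 2 * b ^ 2 with hL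
  have hL0 : 0 ≤ L := by positivity
  refine ⟨4 + 2 * L, by positivity, fun u hu hs => ?_⟩
  have hsp := hs.trans hKp
  have hE := adm_energy hu hsp
  have hA := adm_senSq hu hsp
  have hR := adm_rdot hu hsp
  -- The tables list the indices, signs and directions of the six divergences in `energy_eq`, in the
  -- same order.
  obtain ⟨hD, hD0⟩ := loc_signed_divergence (m := 6)
    (w := fun l => flux S i u ((![0, 0, 0, 0, 1, 1] : Fin 6 → Fin 3) l)
      ((![1, 1, 2, 2, 2, 2] : Fin 6 → Fin 3) l) ((![1, 0, 2, 0, 2, 1] : Fin 6 → Fin 3) l))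
    (fun l => adm_flux hu hsp _ _ _) ![1, -1, 1, -1, 1, -1] ![0, 1, 0, 2, 1, 2]
  have hE2 := hE.const_mul (1 / 2)
  have hA2 := hA.const_mul 2
  have hR2 := hR.const_mul L
  have key : ∀ x, 1 / 2 * energy S i u x + _ ≤
      2 * senSq S i u x + L * rdot (u x) (u x) := fun x => by
    by_cases hx : x ∈ tsupport u
    · have hxK := hs hx
      obtain ⟨h1, h2, h3⟩ := hb x hxK
      have e1 := energy_eq (u := u) (hKp hxK).2 hu
      have e2 := crossTerm_le (u := u) h1 h2
      have e3 : rdot (princ S i u x) (princ S i u x) ≤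
          2 * senSq S i u x + 2 * (|b| * rdot (u x) (u x)) := by
        have h4 : princ S i u x = senOp D (S.frame i) u x + -(zeroth S i x *ᵥ u x) := by
          rw [senOp_eq_princ]; abel
        have h5 := rdot_self_add_le (senOp D (S.frame i) u x) (-(zeroth S i x *ᵥ u x))
        rw [← h4, rdot_neg_right, rdot_comm (-_), rdot_neg_right, neg_neg] at h5
        have h6 := rdot_mulVec_self_le (zeroth S i x) (u x)
        have h7 : (∑ A, ∑ B, ‖zeroth S i x A B‖ ^ 2) * rdot (u x) (u x) ≤
            |b| * rdot (u x) (u x) :=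
          mul_le_mul_of_nonneg_right (h3.trans (le_abs_self b)) (rdot_self_nonneg _)
        unfold senSq
        linarith
      have e4 : 1 / 2 * energy S i u x +
        (((lie (S.frame i 0) (flux S i u 0 1 1) x + divg S i 0 x * flux S i u 0 1 1 x) -
        (lie (S.frame i 1) (flux S i u 0 1 0) x + divg S i 1 x * flux S i u 0 1 0 x)) +
        ((lie (S.frame i 0) (flux S i u 0 2 2) x + divg S i 0 x * flux S i u 0 2 2 x) -
        (lie (S.frame i 2) (flux S i u 0 2 0) x + divg S i 2 x * flux S i u 0 2 0 x)) +
        ((lie (S.frame i 1) (flux S i u 1 2 2) x + divg S i 1 x * flux S i u 1 2 2 x) -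
        (lie (S.frame i 2) (flux S i u 1 2 1) x + divg S i 2 x * flux S i u 1 2 1 x))) ≤
        2 * senSq S i u x + L * rdot (u x) (u x) := by
        rw [hL]
        linarith
      refine le_trans (le_of_eq ?_) e4
      exact congrArg _ (show (∑ l, (![1, -1, 1, -1, 1, -1] : Fin 6 → ℝ) l *
        (lie (S.frame i ((![0, 1, 0, 2, 1, 2] : Fin 6 → Fin 3) l))
          (flux S i u ((![0, 0, 0, 0, 1, 1] : Fin 6 → Fin 3) l)
            ((![1, 1, 2, 2, 2, 2] : Fin 6 → Fin 3) l) ((![1, 0, 2, 0, 2, 1] : Fin 6 → Fin 3) l)) x +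
          divg S i ((![0, 1, 0, 2, 1, 2] : Fin 6 → Fin 3) l) x *
          flux S i u ((![0, 0, 0, 0, 1, 1] : Fin 6 → Fin 3) l)
            ((![1, 1, 2, 2, 2, 2] : Fin 6 → Fin 3) l)
              ((![1, 0, 2, 0, 2, 1] : Fin 6 → Fin 3) l) x)) = _ by
        rw [Fin.sum_univ_six]
        simp only [Matrix.cons_val]
        ring)
    · have z1 : energy S i u x = 0 := by
        simp [energy, lie_eq_zero_of_notMem_tsupport hx, rdot_zero_left]
      have hf : ∀ a b c, x ∉ tsupport (flux S i u a b c) := fun a b c h => hx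
        (tsupport_subset_of_forall (fun y hy => by
          simp [flux, image_eq_zero_of_notMem_tsupport hy, rdot_zero_left]) h)
      have z2 : 0 ≤ 2 * senSq S i u x + L * rdot (u x) (u x) := by
        have := rdot_self_nonneg (senOp D (S.frame i) u x)
        have := mul_nonneg hL0 (rdot_self_nonneg (u x))
        unfold senSq
        linarith
      rw [z1, Finset.sum_eq_zero fun l _ => ?_]
      · linarith
      · rw [lie_eq_zero_of_notMem_tsupport (hf _ _ _), image_eq_zero_of_notMem_tsupport (hf _ _ _)]
        simp
  have hm := loc_mono (hE2.add hD) (hA2.add hR2) key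
  rw [loc_add hE2.1 hE2.2 hD.1 hD.2, loc_add hA2.1 hA2.2 hR2.1 hR2.2, hD0, loc_const_mul,
    loc_const_mul, loc_const_mul] at hm
  have p1 : 0 ≤ loc S p i (senSq S i u) := loc_nonneg fun x => rdot_self_nonneg _
  have p2 : 0 ≤ loc S p i fun x => rdot (u x) (u x) := loc_nonneg fun x => rdot_self_nonneg _
  nlinarith [mul_nonneg hL0 p1]

end Gaarding

/-! ### Finite dimension of spaces of spinor fields with bounded energy -/

section Finite

open MeasureTheory

variable {M : Type*} [TopologicalSpace M] [ChartedSpace E3 M] [IsManifold 𝓘(ℝ, E3) ∞ M]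
  [CompactSpace M] {D : InitialData M} {ι : Type*} {S : SpinStructure D ι} {p x : M} {i : ι}
  {K : Set M} {u : M → Fin 2 → ℂ}

lemma exists_chart_bound (hK : IsClosed K) (hKp : K ⊆ patch S p i) :
    ∃ H : ℝ, 0 ≤ H ∧ ∀ x ∈ K, (∑ b, ∑ q, |(frameMat S p i x)⁻¹ b q|) ≤ H ∧ dens S p i x ≤ H ∧
      (dens S p i x)⁻¹ ≤ H := by
  have hE : ∀ q a, ContinuousOn (fun x => frameMat S p i x q a) K := fun q a x hx =>
    (smoothAt_frameMat (hKp hx) q a).continuousAt.continuousWithinAt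
  have hEm : ContinuousOn (fun x => frameMat S p i x) K :=
    continuousOn_pi.2 fun q => continuousOn_pi.2 fun a => hE q a
  have hdet : ContinuousOn (fun x => (frameMat S p i x).det) K := fun x hx =>
    (smoothAt_det_frameMat (hKp hx)).continuousAt.continuousWithinAt
  have hinv : ∀ b q, ContinuousOn (fun x => (frameMat S p i x)⁻¹ b q) K := by
    intro b q
    have h1 : ContinuousOn (fun x => (frameMat S p i x).adjugate b q) K := by
      have : Continuous fun N : Matrix (Fin 3) (Fin 3) ℝ => N.adjugate b q :=
        (continuous_id.matrix_adjugate).matrix_elem b q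
      exact this.comp_continuousOn hEm
    refine ((hdet.inv₀ fun x hx => det_frameMat_ne_zero (hKp hx)).mul h1).congr fun x _ => ?_
    rw [Matrix.inv_def, Ring.inverse_eq_inv]
    rfl
  have hd : ContinuousOn (dens S p i) K := fun x hx =>
    (smoothAt_dens (hKp hx)).continuousAt.continuousWithinAt
  have hd' : ContinuousOn (fun x => (dens S p i x)⁻¹) K :=
    hd.inv₀ fun x hx => (dens_pos (hKp hx)).ne'
  have hF : ContinuousOn (fun x => (∑ b, ∑ q, |(frameMat S p i x)⁻¹ b q|) + dens S p i x +
      (dens S p i x)⁻¹) K :=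
    ((continuousOn_finsetSum _ fun b _ => continuousOn_finsetSum _ fun q _ =>
      (hinv b q).abs).add hd).add hd'
  obtain ⟨H, hH⟩ := hK.isCompact.exists_bound_of_continuousOn hF
  refine ⟨|H|, abs_nonneg H, fun x hx => ?_⟩
  have h1 := ((le_abs_self _).trans (hH x hx)).trans (le_abs_self H)
  have h2 : 0 ≤ ∑ b, ∑ q, |(frameMat S p i x)⁻¹ b q| :=
    Finset.sum_nonneg fun _ _ => Finset.sum_nonneg fun _ _ => abs_nonneg _
  have h3 := dens_pos (hKp hx)
  have h4 := inv_pos.2 h3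
  exact ⟨by linarith, by linarith, by linarith⟩

/-- A vector is expanded in the coordinate frame with coefficients from the inverse matrix, whose
entries `H` bounds. -/
lemma norm_fderiv_ext_le {w : M → ℂ} (hx : x ∈ patch S p i) (hw : SmoothAt w x) {H : ℝ}
    (hH : (∑ b, ∑ q, |(frameMat S p i x)⁻¹ b q|) ≤ H) :
    ‖fderiv ℝ (ext p w) (chartAt E3 p x)‖ ≤ H * ∑ b, ‖lie (S.frame i b) w x‖ := by
  have hH0 : 0 ≤ H := le_trans
    (Finset.sum_nonneg fun _ _ => Finset.sum_nonneg fun _ _ => abs_nonneg _) hH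
  refine ContinuousLinearMap.opNorm_le_bound _
    (mul_nonneg hH0 (Finset.sum_nonneg fun _ _ => norm_nonneg _)) fun v => ?_
  have hv : v = ∑ b, (∑ q, (frameMat S p i x)⁻¹ b q * v q) •
      lie (S.frame i b) (chartAt E3 p : M → E3) x := by
    have h1 := Matrix.mul_nonsing_inv (frameMat S p i x)
      (IsUnit.mk0 _ (det_frameMat_ne_zero hx))
    have h2 : frameMat S p i x *ᵥ ((frameMat S p i x)⁻¹ *ᵥ v.ofLp) = v.ofLp := by
      rw [Matrix.mulVec_mulVec, h1, Matrix.one_mulVec]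
    ext r
    refine (congrFun h2 r).symm.trans ?_
    simp only [WithLp.ofLp_sum, WithLp.ofLp_smul, Finset.sum_apply, Pi.smul_apply, smul_eq_mul]
    rw [Matrix.mulVec, dotProduct]
    refine Finset.sum_congr rfl fun b _ => ?_
    exact mul_comm (frameMat S p i x r b) (∑ q, (frameMat S p i x)⁻¹ b q * v q)
  have hc : ∀ b, |∑ q, (frameMat S p i x)⁻¹ b q * v q| ≤ H * ‖v‖ := by
    intro b
    calc |∑ q, (frameMat S p i x)⁻¹ b q * v q|
        ≤ ∑ q, |(frameMat S p i x)⁻¹ b q| * ‖v‖ := by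
          refine (Finset.abs_sum_le_sum_abs _ _).trans (Finset.sum_le_sum fun q _ => ?_)
          rw [abs_mul]
          exact mul_le_mul_of_nonneg_left (PiLp.norm_apply_le v q) (abs_nonneg _)
      _ ≤ H * ‖v‖ := by
          rw [← Finset.sum_mul]
          refine mul_le_mul_of_nonneg_right (le_trans ?_ hH) (norm_nonneg v)
          exact Finset.single_le_sum (f := fun b => ∑ q, |(frameMat S p i x)⁻¹ b q|)
            (fun _ _ => Finset.sum_nonneg fun _ _ => abs_nonneg _) (Finset.mem_univ b)
  conv_lhs => rw [hv]
  rw [map_sum]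
  refine (norm_sum_le _ _).trans ?_
  rw [mul_right_comm, Finset.mul_sum]
  refine Finset.sum_le_sum fun b _ => ?_
  rw [map_smul, fderiv_ext_lie hx.1 hw, norm_smul, Real.norm_eq_abs]
  exact mul_le_mul_of_nonneg_right (hc b) (norm_nonneg _)

lemma ext_eq_zero_of_notMem {F : Type*} [NormedAddCommGroup F] [NormedSpace ℝ F] {w : M → F}
    {y : E3} (hs : tsupport w ⊆ (chartAt E3 p).source) (hy : y ∉ chartAt E3 p '' tsupport w) :
    ext p w y = 0 ∧ fderiv ℝ (ext p w) y = 0 := by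
  have h : y ∉ tsupport (ext p w) := fun h => hy (tsupport_ext_subset hs h)
  exact ⟨image_eq_zero_of_notMem_tsupport h,
    image_eq_zero_of_notMem_tsupport fun h' => h (tsupport_fderiv_subset ℝ h')⟩

lemma tsupport_comp_apply (u : M → Fin 2 → ℂ) (A : Fin 2) :
    tsupport (fun x => u x A) ⊆ tsupport u :=
  tsupport_subset_of_forall fun x hx => by rw [image_eq_zero_of_notMem_tsupport hx]; rfl

/-- Of the constant `3 H³`, the 3 is Cauchy–Schwarz over the frame directions, `H²` comes from
`norm_fderiv_ext_le`, and the last `H` from inserting the density. -/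
lemma sum_norm_fderiv_ext_le (hx : x ∈ patch S p i) (hu : SmoothAt u x) {H : ℝ}
    (h1 : (∑ b, ∑ q, |(frameMat S p i x)⁻¹ b q|) ≤ H) (h3 : (dens S p i x)⁻¹ ≤ H) :
    ∑ A, ‖fderiv ℝ (ext p fun x => u x A) (chartAt E3 p x)‖ ^ 2 ≤
      3 * H ^ 3 * (dens S p i x * energy S i u x) := by
  have hH0 : 0 ≤ H := le_trans
    (Finset.sum_nonneg fun _ _ => Finset.sum_nonneg fun _ _ => abs_nonneg _) h1
  have h4 : ∀ A, ‖fderiv ℝ (ext p fun x => u x A) (chartAt E3 p x)‖ ^ 2 ≤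
      3 * H ^ 2 * ∑ b, ‖lie (S.frame i b) u x A‖ ^ 2 := by
    intro A
    have h5 := norm_fderiv_ext_le hx (hu.comp_apply A) h1
    simp only [← lie_apply hu.diffAt] at h5
    have h6 : (∑ b, ‖lie (S.frame i b) u x A‖) ^ 2 ≤ 3 * ∑ b, ‖lie (S.frame i b) u x A‖ ^ 2 := by
      simpa using sq_sum_le_card_mul_sum_sq (s := (Finset.univ : Finset (Fin 3)))
        (f := fun b => ‖lie (S.frame i b) u x A‖)
    calc _ ≤ (H * ∑ b, ‖lie (S.frame i b) u x A‖) ^ 2 := pow_le_pow_left₀ (norm_nonneg _) h5 2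
      _ = H ^ 2 * (∑ b, ‖lie (S.frame i b) u x A‖) ^ 2 := mul_pow _ _ _
      _ ≤ H ^ 2 * (3 * ∑ b, ‖lie (S.frame i b) u x A‖ ^ 2) :=
        mul_le_mul_of_nonneg_left h6 (sq_nonneg H)
      _ = _ := by ring
  have h6 : energy S i u x = ∑ A, ∑ b, ‖lie (S.frame i b) u x A‖ ^ 2 := by
    rw [Finset.sum_comm]
    exact Finset.sum_congr rfl fun b _ => by rw [rdot_self_eq, Fin.sum_univ_two]
  have h7 : ∑ A, ‖fderiv ℝ (ext p fun x => u x A) (chartAt E3 p x)‖ ^ 2 ≤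
      3 * H ^ 2 * energy S i u x := by
    rw [h6, Finset.mul_sum]
    exact Finset.sum_le_sum fun A _ => h4 A
  have hd := dens_pos hx
  have hE := energy_nonneg (S := S) (i := i) (u := u) (x := x)
  have h8 : 1 ≤ H * dens S p i x := by
    have := mul_le_mul_of_nonneg_right h3 hd.le
    rwa [inv_mul_cancel₀ hd.ne'] at this
  calc _ ≤ 3 * H ^ 2 * energy S i u x := h7
    _ ≤ 3 * H ^ 2 * energy S i u x * (H * dens S p i x) :=
      le_mul_of_one_le_right (by positivity) h8
    _ = 3 * H ^ 3 * (dens S p i x * energy S i u x) := by ring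

lemma ext_dens_mul_nonneg {w : M → ℝ} (hw : ∀ x, 0 ≤ w x) (y : E3) :
    0 ≤ ext p (fun x => dens S p i x * w x) y := by
  by_cases hy : y ∈ (chartAt E3 p).target
  · rw [ext_of_mem hy]
    exact mul_nonneg dens_nonneg (hw _)
  · rw [ext_of_notMem hy]

lemma integrable_ext_dens {w : M → ℝ} (hw : Adm S p i w) :
    Integrable (ext p fun x => dens S p i x * w x) :=
  integrable_ext (smooth_dens_mul hw.1 hw.2)
    ((tsupport_mul_subset.trans hw.2).trans Set.inter_subset_left)

lemma exists_fderiv_bound (hK : IsClosed K) (hKp : K ⊆ patch S p i) :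
    ∃ C : ℝ, 0 ≤ C ∧ ∀ u : M → Fin 2 → ℂ, (∀ x, SmoothAt u x) → tsupport u ⊆ K →
      (∑ A, ∫ y, ‖fderiv ℝ (ext p fun x => u x A) y‖ ^ 2) ≤ C * loc S p i (energy S i u) := by
  obtain ⟨H, hH0, hH⟩ := exists_chart_bound hK hKp
  refine ⟨3 * H ^ 3, by positivity, fun u hu hs => ?_⟩
  have hsp := hs.trans hKp
  have hsA : ∀ A, tsupport (fun x => u x A) ⊆ (chartAt E3 p).source := fun A =>
    (tsupport_comp_apply u A).trans (hsp.trans Set.inter_subset_left)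
  have i2 : ∀ A, Integrable fun y => ‖fderiv ℝ (ext p fun x => u x A) y‖ ^ 2 := fun A =>
    integrable_norm_sq ((contDiff_ext (fun x => (hu x).comp_apply A) (hsA A)).continuous_fderiv
      (by simp)) ((hasCompactSupport_ext (hsA A)).fderiv ℝ)
  rw [← integral_finsetSum _ fun A _ => i2 A, loc, ← integral_const_mul]
  refine integral_mono (integrable_finsetSum _ fun A _ => i2 A)
    ((integrable_ext_dens (adm_energy hu hsp)).const_mul _) fun y => ?_
  by_cases hy : y ∈ chartAt E3 p '' tsupport u
  · obtain ⟨x, hx, rfl⟩ := hy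
    obtain ⟨h1, -, h3⟩ := hH x (hs hx)
    have := sum_norm_fderiv_ext_le (hsp hx) (hu x) h1 h3
    dsimp only
    rwa [ext_chart (hsp hx).1]
  · have hz : ∀ A, fderiv ℝ (ext p fun x => u x A) y = 0 := fun A =>
      (ext_eq_zero_of_notMem (hsA A)
        fun h => hy (Set.image_mono (tsupport_comp_apply u A) h)).2
    have h0 : ∑ A, ‖fderiv ℝ (ext p fun x => u x A) y‖ ^ 2 = 0 :=
      Finset.sum_eq_zero fun A _ => by rw [hz A, norm_zero, sq, zero_mul]
    dsimp only
    rw [h0]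
    exact mul_nonneg (by positivity) (ext_dens_mul_nonneg (fun x => energy_nonneg) y)

lemma exists_mass_bound (hK : IsClosed K) (hKp : K ⊆ patch S p i) :
    ∃ C : ℝ, 0 ≤ C ∧ ∀ u : M → Fin 2 → ℂ, (∀ x, SmoothAt u x) → tsupport u ⊆ K →
      loc S p i (fun x => rdot (u x) (u x)) ≤ C * ∑ A, ∫ y, ‖ext p (fun x => u x A) y‖ ^ 2 := by
  obtain ⟨H, hH0, hH⟩ := exists_chart_bound hK hKp
  refine ⟨H, hH0, fun u hu hs => ?_⟩
  have hsp := hs.trans hKp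
  have hsA : ∀ A, tsupport (fun x => u x A) ⊆ (chartAt E3 p).source := fun A =>
    (tsupport_comp_apply u A).trans (hsp.trans Set.inter_subset_left)
  have i1 : ∀ A, Integrable fun y => ‖ext p (fun x => u x A) y‖ ^ 2 := fun A =>
    integrable_norm_sq (contDiff_ext (fun x => (hu x).comp_apply A) (hsA A)).continuous
      (hasCompactSupport_ext (hsA A))
  rw [← integral_finsetSum _ fun A _ => i1 A, loc, ← integral_const_mul]
  refine integral_mono (integrable_ext_dens (adm_rdot hu hsp))
    ((integrable_finsetSum _ fun A _ => i1 A).const_mul _) fun y => ?_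
  dsimp only
  by_cases hy : y ∈ chartAt E3 p '' tsupport u
  · obtain ⟨x, hx, rfl⟩ := hy
    obtain ⟨-, h2, -⟩ := hH x (hs hx)
    rw [ext_chart (hsp hx).1, Fin.sum_univ_two, ext_chart (hsp hx).1, ext_chart (hsp hx).1,
      ← rdot_self_eq]
    exact mul_le_mul_of_nonneg_right h2 (rdot_self_nonneg _)
  · have hz : ext p (fun x => dens S p i x * rdot (u x) (u x)) y = 0 := by
      by_cases hyt : y ∈ (chartAt E3 p).target
      · have : (chartAt E3 p).symm y ∉ tsupport u := fun h =>
          hy ⟨_, h, (chartAt E3 p).right_inv hyt⟩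
        rw [ext_of_mem hyt, image_eq_zero_of_notMem_tsupport this, rdot_zero_left, mul_zero]
      · exact ext_of_notMem hyt
    rw [hz]
    exact mul_nonneg hH0 (Finset.sum_nonneg fun _ _ => sq_nonneg _)

/-- Poincaré in coordinates followed by the Gårding inequality. The constant is chosen before `ε`,
so the factor on the right can be made as small as desired. -/
lemma exists_cells (hK : IsClosed K) (hKp : K ⊆ patch S p i) :
    ∃ C : ℝ, 0 ≤ C ∧ ∀ ε : ℝ, 0 < ε → ∃ (δ : ℝ) (s : Finset (Fin 3 → ℤ)),
      ∀ u : M → Fin 2 → ℂ, (∀ x, SmoothAt u x) → tsupport u ⊆ K →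
        (∀ z ∈ s, ∀ A, ∫ y in cell δ z, ext p (fun x => u x A) y = 0) →
        loc S p i (fun x => rdot (u x) (u x)) ≤
          ε * C * (loc S p i (senSq S i u) + loc S p i fun x => rdot (u x) (u x)) := by
  obtain ⟨C1, hC1, hg⟩ := exists_gaarding hK hKp
  obtain ⟨C2, hC2, hf⟩ := exists_fderiv_bound hK hKp
  obtain ⟨C3, hC3, hf'⟩ := exists_mass_bound hK hKp
  refine ⟨C3 * C2 * C1, by positivity, fun ε hε => ?_⟩
  have hKs := hKp.trans Set.inter_subset_left
  obtain ⟨δ, s, hP⟩ := exists_poincare (K := chartAt E3 p '' K)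
    (hK.isCompact.image_of_continuousOn ((chartAt E3 p).continuousOn.mono hKs)) hε
  refine ⟨δ, s, fun u hu hs h0 => ?_⟩
  have hsA : ∀ A, tsupport (fun x => u x A) ⊆ K := fun A => (tsupport_comp_apply u A).trans hs
  have h1 : ∑ A, ∫ y, ‖ext p (fun x => u x A) y‖ ^ 2 ≤
      ε * ∑ A, ∫ y, ‖fderiv ℝ (ext p fun x => u x A) y‖ ^ 2 := by
    rw [Finset.mul_sum]
    refine Finset.sum_le_sum fun A _ => hP _ ?_ ?_ fun z hz => h0 z hz A
    · exact (contDiff_ext (fun x => (hu x).comp_apply A) ((hsA A).trans hKs)).of_le (by simp)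
    · exact (tsupport_ext_subset ((hsA A).trans hKs)).trans (Set.image_mono (hsA A))
  have h2 := hf u hu hs
  have h3 := hf' u hu hs
  calc loc S p i (fun x => rdot (u x) (u x))
      ≤ C3 * ∑ A, ∫ y, ‖ext p (fun x => u x A) y‖ ^ 2 := h3
    _ ≤ C3 * (ε * ∑ A, ∫ y, ‖fderiv ℝ (ext p fun x => u x A) y‖ ^ 2) := by gcongr
    _ ≤ C3 * (ε * (C2 * loc S p i (energy S i u))) := by gcongr
    _ ≤ C3 * (ε * (C2 * (C1 * (loc S p i (senSq S i u) + loc S p i fun x => rdot (u x) (u x))))) := by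
      gcongr
      exact hg u hu hs
    _ = _ := by ring

/-! ### Localisation of spinor fields and finite dimension -/

variable (C : PatchCover S) (k : Fin C.n)

/-- The components of a spinor field in a gauge, cut off to the patch. -/
def cut (f : SpinorField S) : M → Fin 2 → ℂ := (mulField (C.ρ k) (C.smooth k) f).1 (C.g k)

lemma cut_apply (f : SpinorField S) (x : M) : cut C k f x = (C.ρ k x : ℂ) • f.1 (C.g k) x :=
  mulField_apply (C.smooth k) f (C.g k) x

lemma tsupport_cut (f : SpinorField S) : tsupport (cut C k f) ⊆ tsupport (C.ρ k) :=
  tsupport_subset_of_forall fun _ hx =>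
    (mulField_eventually_zero (C.smooth k) f (C.g k) hx).eq_of_nhds

lemma smooth_cut (f : SpinorField S) (x : M) : SmoothAt (cut C k f) x :=
  smooth_of_tsupport (fun _ hx =>
    smoothAt_spinor (mulField (C.ρ k) (C.smooth k) f)
      (C.tsupport_subset k (tsupport_cut C k f hx)).2) x

lemma rho_le_one (x : M) : C.ρ k x ≤ 1 := by
  rw [← C.sum_eq_one x]
  exact Finset.single_le_sum (f := fun k => C.ρ k x) (fun k _ => C.nonneg k x) (Finset.mem_univ k)

lemma pair_mulField (f : SpinorField S) (x : M) :
    pair (mulField (C.ρ k) (C.smooth k) f) (mulField (C.ρ k) (C.smooth k) f) x =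
      C.ρ k x ^ 2 * pair f f x := by
  unfold pair
  rw [mulField_apply, rdot_smul_left, rdot_smul_right]
  ring

lemma rdot_cut (f : SpinorField S) : (fun x => rdot (cut C k f x) (cut C k f x)) =
    pair (mulField (C.ρ k) (C.smooth k) f) (mulField (C.ρ k) (C.smooth k) f) := by
  ext x
  by_cases hx : x ∈ tsupport (C.ρ k)
  · rw [pair_eq _ _ (C.tsupport_subset k hx).2]
    rfl
  · rw [pair_mulField, image_eq_zero_of_notMem_tsupport hx, image_eq_zero_of_notMem_tsupport
      fun h => hx (tsupport_cut C k f h), rdot_zero_left]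
    simp

lemma loc_rdot_cut (f : SpinorField S) :
    loc S (C.p k) (C.g k) (fun x => rdot (cut C k f x) (cut C k f x)) =
      tot C (pair (mulField (C.ρ k) (C.smooth k) f) (mulField (C.ρ k) (C.smooth k) f)) := by
  rw [← rdot_cut]
  have h := adm_rdot (smooth_cut C k f) ((tsupport_cut C k f).trans (C.tsupport_subset k))
  rw [tot_eq_loc h.1 h.2]

/-- The product rule: the commutator of the operator with the cut-off is Clifford multiplication by
its gradient, of order zero. -/
lemma senOp_cut (f : SpinorField S) (hx : x ∈ S.U (C.g k)) :
    senOp D (S.frame (C.g k)) (cut C k f) x = (C.ρ k x : ℂ) • (senField S f).1 (C.g k) x +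
      ∑ a, ((lie (S.frame (C.g k) a) (C.ρ k) x : ℝ) : ℂ) • sig a *ᵥ f.1 (C.g k) x := by
  have hf := (smoothAt_spinor f hx).diffAt
  have hl : ∀ a, lie (S.frame (C.g k) a) (cut C k f) x =
      ((lie (S.frame (C.g k) a) (C.ρ k) x : ℝ) : ℂ) • f.1 (C.g k) x +
        (C.ρ k x : ℂ) • lie (S.frame (C.g k) a) (f.1 (C.g k)) x := by
    intro a
    have h1 : cut C k f = fun y => C.ρ k y • f.1 (C.g k) y := by
      ext1 y
      rw [cut_apply]
      exact Complex.coe_smul _ _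
    rw [h1, lie_smul_real (C.smooth k x).diffAt hf, Complex.coe_smul, Complex.coe_smul]
  rw [senField_apply f hx]
  simp only [senOp, diracOp, hl, cut_apply, Matrix.mulVec_add, Matrix.mulVec_smul,
    Finset.sum_add_distrib, ← Finset.smul_sum]
  module

/-- The 20 is 2 from splitting off the gradient terms times 10 from splitting a sum of three by
`rdot_self_add_le` twice. -/
lemma senSq_cut_le {b : ℝ} (f : SpinorField S) (hx : x ∈ S.U (C.g k))
    (hb : ∀ a, |lie (S.frame (C.g k) a) (C.ρ k) x| ≤ b) :
    senSq S (C.g k) (cut C k f) x ≤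
      2 * pair (senField S f) (senField S f) x + 20 * b ^ 2 * pair f f x := by
  rw [senSq, senOp_cut C k f hx]
  refine (rdot_self_add_le _ _).trans ?_
  rw [pair_eq _ _ hx, pair_eq _ _ hx, rdot_smul_left, rdot_smul_right]
  set v := f.1 (C.g k) x
  set r := fun a => lie (S.frame (C.g k) a) (C.ρ k) x with hr
  have h1 : ∀ a, rdot ((r a : ℂ) • sig a *ᵥ v) ((r a : ℂ) • sig a *ᵥ v) ≤ b ^ 2 * rdot v v := by
    intro a
    rw [rdot_smul_left, rdot_smul_right, rdot_sig_self, ← mul_assoc, ← sq, ← sq_abs]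
    exact mul_le_mul_of_nonneg_right (pow_le_pow_left₀ (abs_nonneg _) (hb a) 2)
      (rdot_self_nonneg v)
  have h2 : rdot (∑ a, (r a : ℂ) • sig a *ᵥ v) (∑ a, (r a : ℂ) • sig a *ᵥ v) ≤
      10 * (b ^ 2 * rdot v v) := by
    rw [Fin.sum_univ_three]
    have e1 := rdot_self_add_le ((r 0 : ℂ) • sig 0 *ᵥ v + (r 1 : ℂ) • sig 1 *ᵥ v)
      ((r 2 : ℂ) • sig 2 *ᵥ v)
    have e2 := rdot_self_add_le ((r 0 : ℂ) • sig 0 *ᵥ v) ((r 1 : ℂ) • sig 1 *ᵥ v)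
    linarith [h1 0, h1 1, h1 2]
  have h3 : C.ρ k x * (C.ρ k x * rdot ((senField S f).1 (C.g k) x) ((senField S f).1 (C.g k) x)) ≤
      rdot ((senField S f).1 (C.g k) x) ((senField S f).1 (C.g k) x) := by
    have e1 := rdot_self_nonneg ((senField S f).1 (C.g k) x)
    have e2 := C.nonneg k x
    have e3 := rho_le_one C k x
    exact (mul_le_of_le_one_left (mul_nonneg e2 e1) e3).trans (mul_le_of_le_one_left e1 e3)
  linarith

lemma tot_senSq_cut_le : ∃ B : ℝ, 0 ≤ B ∧ ∀ f : SpinorField S,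
    loc S (C.p k) (C.g k) (senSq S (C.g k) (cut C k f)) ≤
      2 * tot C (pair (senField S f) (senField S f)) + B * tot C (pair f f) := by
  have hK : IsClosed (tsupport (C.ρ k)) := isClosed_tsupport _
  have hc : ContinuousOn (fun x => ∑ a, |lie (S.frame (C.g k) a) (C.ρ k) x|) (tsupport (C.ρ k)) :=
    continuousOn_finsetSum _ fun a _ => ContinuousOn.abs fun x hx =>
      ((C.smooth k x).lie (smoothFieldAt_frame S (C.g k) a
        (C.tsupport_subset k hx).2)).continuousAt.continuousWithinAt
  obtain ⟨b, hb⟩ := hK.isCompact.exists_bound_of_continuousOn hc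
  refine ⟨20 * b ^ 2, by positivity, fun f => ?_⟩
  have hA := adm_senSq (smooth_cut C k f) ((tsupport_cut C k f).trans (C.tsupport_subset k))
  have s1 : ∀ x, SmoothAt (fun x => 2 * pair (senField S f) (senField S f) x) x := fun x =>
    smoothAt_mul (smoothAt_const _) (smooth_pair _ _ x)
  have s2 : ∀ x, SmoothAt (fun x => 20 * b ^ 2 * pair f f x) x := fun x =>
    smoothAt_mul (smoothAt_const _) (smooth_pair _ _ x)
  rw [← tot_eq_loc (C := C) hA.1 hA.2, ← tot_const_mul, ← tot_const_mul, ← tot_add s1 s2]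
  refine tot_mono hA.1 (fun x => smoothAt_add (s1 x) (s2 x)) fun x => ?_
  by_cases hx : x ∈ tsupport (C.ρ k)
  · refine senSq_cut_le C k f (C.tsupport_subset k hx).2 fun a => ?_
    refine le_trans ?_ ((le_abs_self _).trans (hb x hx))
    exact Finset.single_le_sum (f := fun a => |lie (S.frame (C.g k) a) (C.ρ k) x|)
      (fun _ _ => abs_nonneg _) (Finset.mem_univ a)
  · have hx' : x ∉ tsupport (cut C k f) := fun h => hx (tsupport_cut C k f h)
    have h0 : senSq S (C.g k) (cut C k f) x = 0 := by
      simp [senSq, senOp_eq_princ, princ, lie_eq_zero_of_notMem_tsupport hx',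
        image_eq_zero_of_notMem_tsupport hx', rdot_zero_left]
    rw [h0]
    have := pair_self_nonneg (senField S f) x
    have := pair_self_nonneg f x
    positivity

lemma exists_cells_cut (c : ℝ) {θ : ℝ} (hθ : 0 < θ) :
    ∃ (δ : ℝ) (s : Finset (Fin 3 → ℤ)), ∀ f : SpinorField S,
      tot C (pair (senField S f) (senField S f)) ≤ c * tot C (pair f f) →
      (∀ z ∈ s, ∀ A, ∫ y in cell δ z, ext (C.p k) (fun x => cut C k f x A) y = 0) →
      tot C (pair (mulField (C.ρ k) (C.smooth k) f) (mulField (C.ρ k) (C.smooth k) f)) ≤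
        θ * tot C (pair f f) := by
  obtain ⟨B, hB, hsen⟩ := tot_senSq_cut_le C k
  obtain ⟨C0, hC0, hcell⟩ := exists_cells (isClosed_tsupport (C.ρ k)) (C.tsupport_subset k)
  -- The accumulated constant is `Q - 1`, so the choice `ε = θ / Q` leaves at most `θ`; the added 1
  -- keeps `Q` positive.
  set Q := C0 * (2 * |c| + B + 1) + 1 with hQ
  have hQ0 : 0 < Q := by positivity
  obtain ⟨δ, s, h⟩ := hcell (θ / Q) (by positivity)
  refine ⟨δ, s, fun f hf h0 => ?_⟩
  have h1 := h (cut C k f) (smooth_cut C k f) (tsupport_cut C k f) h0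
  have hT : 0 ≤ tot C (pair f f) := tot_nonneg (pair_self_nonneg f)
  have h2 : tot C (pair (mulField (C.ρ k) (C.smooth k) f) (mulField (C.ρ k) (C.smooth k) f)) ≤
      tot C (pair f f) := tot_mono (smooth_pair _ _) (smooth_pair _ _) fun x => by
    rw [pair_mulField]
    exact mul_le_of_le_one_left (pair_self_nonneg f x)
      (pow_le_one₀ (C.nonneg k x) (rho_le_one C k x))
  rw [loc_rdot_cut] at h1
  have h3 : loc S (C.p k) (C.g k) (senSq S (C.g k) (cut C k f)) +
      tot C (pair (mulField (C.ρ k) (C.smooth k) f) (mulField (C.ρ k) (C.smooth k) f)) ≤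
      (2 * |c| + B + 1) * tot C (pair f f) := by
    have e1 := hsen f
    have e2 : c * tot C (pair f f) ≤ |c| * tot C (pair f f) :=
      mul_le_mul_of_nonneg_right (le_abs_self c) hT
    linarith
  calc _ ≤ θ / Q * C0 * ((2 * |c| + B + 1) * tot C (pair f f)) :=
        h1.trans (mul_le_mul_of_nonneg_left h3 (by positivity))
    _ = θ * ((Q - 1) / Q) * tot C (pair f f) := by rw [hQ]; ring
    _ ≤ θ * 1 * tot C (pair f f) := by
        refine mul_le_mul_of_nonneg_right (mul_le_mul_of_nonneg_left ?_ hθ.le) hT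
        rw [div_le_one hQ0]
        linarith
    _ = θ * tot C (pair f f) := by rw [mul_one]

/-- Cauchy–Schwarz for the partition of unity: `1 = (∑ ρ)² ≤ n ∑ ρ²`. -/
lemma tot_le_sum_mulField (f : SpinorField S) :
    tot C (pair f f) ≤ C.n * ∑ k, tot C (pair (mulField (C.ρ k) (C.smooth k) f)
      (mulField (C.ρ k) (C.smooth k) f)) := by
  rw [← tot_sum fun k => smooth_pair _ _, ← tot_const_mul]
  refine tot_mono (smooth_pair _ _) (fun x => smoothAt_mul (smoothAt_const _)
    (smoothAt_sum _ fun k => smooth_pair _ _ x)) fun x => ?_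
  simp only [pair_mulField]
  rw [← Finset.sum_mul, ← mul_assoc]
  refine le_mul_of_one_le_left (pair_self_nonneg f x) ?_
  have := sq_sum_le_card_mul_sum_sq (s := Finset.univ) (f := fun k => C.ρ k x)
  rw [C.sum_eq_one] at this
  simpa using this

/-- The integral of a component of a spinor field over a cell. -/
def cellIntegral (δ : ℝ) (z : Fin 3 → ℤ) (A : Fin 2) : SpinorField S →ₗ[ℂ] ℂ where
  toFun f := ∫ y in cell δ z, ext (C.p k) (fun x => cut C k f x A) y
  map_add' f h := by
    have hi : ∀ f : SpinorField S, Integrable (ext (C.p k) fun x => cut C k f x A) := fun f =>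
      integrable_ext (fun x => (smooth_cut C k f x).comp_apply A)
        ((tsupport_comp_apply _ A).trans ((tsupport_cut C k f).trans
          ((C.tsupport_subset k).trans Set.inter_subset_left)))
    rw [← integral_add (hi f).integrableOn (hi h).integrableOn]
    congr 1
    ext y
    by_cases hy : y ∈ (chartAt E3 (C.p k)).target
    · simp only [ext_of_mem hy, cut_apply]
      simp [mul_add]
    · simp only [ext_of_notMem hy, add_zero]
  map_smul' c f := by
    rw [RingHom.id_apply, ← integral_smul]
    congr 1
    ext y
    by_cases hy : y ∈ (chartAt E3 (C.p k)).target
    · simp only [ext_of_mem hy, cut_apply]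
      simp [mul_left_comm]
    · simp only [ext_of_notMem hy, smul_zero]

/-- Finitely many cell averages determine an element of `V`: if all vanish, the pieces of the field
are so small that its norm is at most a fraction of itself. -/
lemma finiteDimensional_of_senField_le {c : ℝ} (V : Submodule ℂ (SpinorField S))
    (hV : ∀ f ∈ V, tot C (pair (senField S f) (senField S f)) ≤ c * tot C (pair f f)) :
    FiniteDimensional ℂ V := by
  -- One factor `n` is the number of pieces and another comes from `tot_le_sum_mulField`, so `n² θ =
  -- 1 - θ < 1` is what is needed.
  set θ : ℝ := 1 / ((C.n : ℝ) ^ 2 + 1) with hθ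
  have hθ0 : 0 < θ := by positivity
  choose δ s h using fun k => exists_cells_cut C k c hθ0
  let L : V →ₗ[ℂ] (k : Fin C.n) → s k → Fin 2 → ℂ :=
    (LinearMap.pi fun k => LinearMap.pi fun z => LinearMap.pi fun A =>
      cellIntegral C k (δ k) z.1 A) ∘ₗ V.subtype
  refine FiniteDimensional.of_injective L ?_
  rw [injective_iff_map_eq_zero]
  intro f hf
  have h0 : ∀ k, ∀ z ∈ s k, ∀ A,
      ∫ y in cell (δ k) z, ext (C.p k) (fun x => cut C k f.1 x A) y = 0 := fun k z hz A =>
    congrFun (congrFun (congrFun hf k) ⟨z, hz⟩) A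
  have h1 := tot_le_sum_mulField C f.1
  have h2 : ∑ k, tot C (pair (mulField (C.ρ k) (C.smooth k) f.1)
      (mulField (C.ρ k) (C.smooth k) f.1)) ≤ C.n * (θ * tot C (pair f.1 f.1)) := by
    refine (Finset.sum_le_sum fun k _ => h k f.1 (hV f.1 f.2) (h0 k)).trans ?_
    simp
  have hT : 0 ≤ tot C (pair f.1 f.1) := tot_nonneg (pair_self_nonneg f.1)
  have h3 : tot C (pair f.1 f.1) ≤ (C.n : ℝ) ^ 2 * θ * tot C (pair f.1 f.1) := by
    refine h1.trans ((mul_le_mul_of_nonneg_left h2 (Nat.cast_nonneg _)).trans (le_of_eq ?_))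
    ring
  have h4 : (C.n : ℝ) ^ 2 * θ = 1 - θ := by
    rw [hθ]
    field_simp
    ring
  rw [h4] at h3
  have h5 : tot C (pair f.1 f.1) = 0 := by
    refine le_antisymm ?_ hT
    by_contra hpos
    push Not at hpos
    nlinarith [mul_pos hθ0 hpos]
  exact Subtype.ext (eq_zero_of_pair_self fun x =>
    tot_eq_zero (smooth_pair _ _) (pair_self_nonneg f.1) h5 x)

end Finite

/-! ### The spectrum of the squared Sen–Witten operator -/

/-- In a basis `J` is a matrix `N` followed by conjugation, and `J² = -1` says that `N` times its
conjugate is `-1`. The determinant gives `|det N|² = (-1)^n`, so `n` is even. -/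
lemma even_finrank_of_quaternionic {V : Type*} [AddCommGroup V] [Module ℂ V]
    [FiniteDimensional ℂ V] (J : V →ₛₗ[starRingEnd ℂ] V) (hJ : ∀ v, J (J v) = -v) :
    Even (Module.finrank ℂ V) := by
  set b := Module.finBasis ℂ V
  set N : Matrix (Fin (Module.finrank ℂ V)) (Fin (Module.finrank ℂ V)) ℂ :=
    Matrix.of fun i j => b.repr (J (b j)) i with hN
  have hJb : ∀ j, J (b j) = ∑ i, N i j • b i := fun j => (b.sum_repr (J (b j))).symm
  have hmul : N * N.map conj = -1 := by
    ext k j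
    have h1 := hJ (b j)
    rw [hJb, map_sum] at h1
    simp only [LinearMap.map_smulₛₗ, hJb, Finset.smul_sum, smul_smul] at h1
    have h2 := congrArg (fun v => b.repr v k) h1
    simp only [map_sum, map_smul, Finsupp.coe_finsetSum, Finset.sum_apply, Finsupp.smul_apply,
      Module.Basis.repr_self, map_neg, Finsupp.neg_apply, smul_eq_mul] at h2
    rw [Matrix.mul_apply, Matrix.neg_apply, Matrix.one_apply]
    simp only [Finsupp.single_apply, mul_ite, mul_one, mul_zero, Finset.sum_ite_eq',
      Finset.mem_univ, if_true] at h2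
    simp only [Matrix.map_apply]
    rw [show (if k = j then (1 : ℂ) else 0) = if j = k then 1 else 0 by simp only [eq_comm], ← h2]
    exact Finset.sum_congr rfl fun i _ => mul_comm _ _
  have hdet := congrArg Matrix.det hmul
  have hc : (N.map conj).det = conj N.det := by
    rw [← RingHom.mapMatrix_apply, ← RingHom.map_det]
  rw [Matrix.det_mul, hc, Complex.mul_conj, Matrix.det_neg, Matrix.det_one, Fintype.card_fin,
    mul_one] at hdet
  by_contra hodd
  rw [Nat.not_even_iff_odd] at hodd
  rw [hodd.neg_one_pow] at hdet
  have h3 : Complex.normSq N.det = -1 := by exact_mod_cast hdet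
  linarith [Complex.normSq_nonneg N.det]

section Spectrum

variable {M : Type*} [TopologicalSpace M] [ChartedSpace E3 M] [IsManifold 𝓘(ℝ, E3) ∞ M]
  [CompactSpace M] {D : InitialData M} {ι : Type*} {S : SpinStructure D ι} (C : PatchCover S)

/-- The real part of the `L²` scalar product of spinor fields. -/
def ip (f h : SpinorField S) : ℝ := tot C (pair f h)

variable {C}

lemma ip_self_nonneg (f : SpinorField S) : 0 ≤ ip C f f := tot_nonneg (pair_self_nonneg f)

lemma eq_zero_of_ip_self {f : SpinorField S} (h : ip C f f = 0) : f = 0 :=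
  eq_zero_of_pair_self fun x => tot_eq_zero (smooth_pair f f) (pair_self_nonneg f) h x

lemma ip_senField (f h : SpinorField S) : ip C (senField S f) h = ip C f (adjField S h) :=
  tot_pair_senField f h

lemma ip_smul_right (c : ℂ) (f : SpinorField S) : ip C f (c • f) = c.re * ip C f f := by
  rw [ip, ip, ← tot_const_mul]
  congr 1
  ext x
  change rdot _ (c • _) = _ * rdot _ _
  simp [rdot_eq]
  ring

lemma ip_comm (f h : SpinorField S) : ip C f h = ip C h f :=
  congrArg (tot C) (funext fun x => pair_comm f h x)

lemma ip_I_smul (c : ℂ) (f : SpinorField S) :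
    ip C (Complex.I • f) (c • f) = c.im * ip C f f := by
  rw [ip, ip, ← tot_const_mul]
  congr 1
  ext x
  change rdot (Complex.I • _) (c • _) = _ * rdot _ _
  simp [rdot_eq]
  ring

lemma ip_senField_self {c : ℂ} {f : SpinorField S} (h : adjField S (senField S f) = c • f) :
    ip C (senField S f) (senField S f) = c.re * ip C f f := by
  rw [ip_senField, h, ip_smul_right]

/-- Pairing the equation with `f` gives `‖Af‖² = Re c ‖f‖²`, hence `Re c ≥ 0`. -/
lemma eigenvalue_eq (C : PatchCover S) {c : ℂ} {f : SpinorField S} (hf : f ≠ 0)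
    (h : adjField S (senField S f) = c • f) : c = ((√c.re : ℝ) : ℂ) ^ 2 := by
  have hpos : 0 < ip C f f := (ip_self_nonneg f).lt_of_ne' fun h0 => hf (eq_zero_of_ip_self h0)
  have h1 := ip_senField_self (C := C) h
  have h2 : 0 ≤ c.re := by
    have := ip_self_nonneg (C := C) (senField S f)
    rw [h1] at this
    exact nonneg_of_mul_nonneg_left this hpos
  -- Only the real part of the scalar product is available, so the imaginary part of `c` is read off
  -- by pairing with `i f`; the other side is `Re⟨i Af, Af⟩ = 0`.
  have h3 := ip_senField (C := C) (Complex.I • f) (senField S f)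
  rw [h, ip_I_smul, map_smul] at h3
  have h4 := ip_I_smul (C := C) 1 (senField S f)
  rw [one_smul, Complex.one_im, zero_mul, h3] at h4
  have him : c.im = 0 := (mul_eq_zero.1 h4).resolve_right hpos.ne'
  rw [← Complex.ofReal_pow, Real.sq_sqrt h2]
  exact Complex.ext rfl him

/-- With `n = Jm` the system reads `A f = iα n` and `A* n = -iα f`. Adjointness then gives `Im α
(‖f‖² + ‖n‖²) = 0`, and composing the two equations gives the squared one. -/
lemma dirac_eigen {α : ℂ} {f m : SpinorField S} (hne : f ≠ 0 ∨ m ≠ 0) (C : PatchCover S)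
    (h1 : Complex.I • senField S f = -α • ccField S m)
    (h2 : Complex.I • senField S m = conj α • ccField S f) :
    α.im = 0 ∧ adjField S (senField S f) = α ^ 2 • f := by
  set n := ccField S m with hn
  have hI : ∀ {u v : SpinorField S} {c : ℂ}, Complex.I • u = c • v → u = (-Complex.I * c) • v := by
    intro u v c h
    rw [mul_smul, ← h, smul_smul]
    simp
  have hA : senField S f = (Complex.I * α) • n := by
    rw [hI h1]
    congr 1
    ring
  have hB : adjField S n = (-Complex.I * α) • f := by
    rw [hn, adjField_ccField, hI h2, LinearMap.map_smulₛₗ, ccField_ccField, smul_neg, ← neg_smul]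
    congr 1
    simp
  refine ⟨?_, ?_⟩
  · have h3 := ip_senField (C := C) f n
    rw [hA, hB, ip_comm, ip_smul_right, ip_smul_right] at h3
    simp only [Complex.mul_re, Complex.I_re, Complex.I_im, Complex.neg_re, Complex.neg_im] at h3
    have h4 : α.im * (ip C f f + ip C n n) = 0 := by linarith
    refine (mul_eq_zero.1 h4).resolve_right fun h5 => ?_
    have hf := ip_self_nonneg (C := C) f
    have hn' := ip_self_nonneg (C := C) n
    have hf0 : f = 0 := eq_zero_of_ip_self (C := C) (by linarith)
    have hn0 : n = 0 := eq_zero_of_ip_self (C := C) (by linarith)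
    rcases hne with h | h
    · exact h hf0
    · apply h
      rw [← neg_eq_zero, ← ccField_ccField, ← hn, hn0, map_zero]
  · rw [hA, map_smul, hB, smul_smul]
    congr 1
    linear_combination (-α ^ 2) * Complex.I_mul_I

/-- The antilinear map that takes an eigenspinor to its partner. -/
def partner (S : SpinStructure D ι) (α : ℝ) : SpinorField S →ₛₗ[starRingEnd ℂ] SpinorField S :=
  (-Complex.I / (α : ℂ)) • (ccField S).comp (senField S)

lemma partner_apply (α : ℝ) (f : SpinorField S) :
    partner S α f = (-Complex.I / (α : ℂ)) • ccField S (senField S f) := rfl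

variable {α : ℝ} {f : SpinorField S}

lemma ccField_partner (hα : α ≠ 0) :
    Complex.I • senField S f = -(α : ℂ) • ccField S (partner S α f) := by
  have hα' : (α : ℂ) ≠ 0 := by exact_mod_cast hα
  rw [partner_apply, LinearMap.map_smulₛₗ, ccField_ccField, smul_neg, smul_neg, smul_smul,
    ← neg_smul]
  congr 1
  simp
  field_simp

lemma senField_partner (hα : α ≠ 0) (h : adjField S (senField S f) = ((α : ℂ) ^ 2) • f) :
    senField S (partner S α f) = (-Complex.I * α) • ccField S f := by
  have hα' : (α : ℂ) ≠ 0 := by exact_mod_cast hα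
  rw [partner_apply, map_smul, senField_ccField, h, LinearMap.map_smulₛₗ, smul_smul]
  congr 1
  simp
  field_simp

lemma partner_eigen (hα : α ≠ 0) (h : adjField S (senField S f) = ((α : ℂ) ^ 2) • f) :
    adjField S (senField S (partner S α f)) = ((α : ℂ) ^ 2) • partner S α f := by
  have hα' : (α : ℂ) ≠ 0 := by exact_mod_cast hα
  rw [senField_partner hα h, map_smul, adjField_ccField, partner_apply, smul_smul]
  congr 1
  field_simp

lemma partner_partner (hα : α ≠ 0) (h : adjField S (senField S f) = ((α : ℂ) ^ 2) • f) :
    partner S α (partner S α f) = -f := by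
  have hα' : (α : ℂ) ≠ 0 := by exact_mod_cast hα
  rw [partner_apply, senField_partner hα h, LinearMap.map_smulₛₗ, ccField_ccField, smul_smul]
  have : -Complex.I / (α : ℂ) * conj (-Complex.I * (α : ℂ)) = 1 := by
    simp
    field_simp
    simp
  rw [this, one_smul]

/-- Applying the partner map to a relation `s f + t m = 0` gives a second relation, and eliminating
`m` leaves `(|s|² + |t|²) f = 0`. -/
lemma linearIndependent_partner (hα : α ≠ 0) (hf : f ≠ 0)
    (h : adjField S (senField S f) = ((α : ℂ) ^ 2) • f) :
    LinearIndependent ℂ ![f, partner S α f] := by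
  rw [LinearIndependent.pair_iff]
  intro s t hst
  have h2 := congrArg (partner S α) hst
  rw [map_add, LinearMap.map_smulₛₗ, LinearMap.map_smulₛₗ, partner_partner hα h, map_zero] at h2
  have h3 : (conj s * s + t * conj t) • f = 0 := by
    have : (conj s * s + t * conj t) • f = conj s • (s • f + t • partner S α f) -
        t • (conj s • partner S α f + conj t • -f) := by module
    rw [this, hst, h2, smul_zero, smul_zero, sub_zero]
  have h4 := (smul_eq_zero.1 h3).resolve_right hf
  rw [mul_comm, Complex.mul_conj, Complex.mul_conj, ← Complex.ofReal_add] at h4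
  have h5 : Complex.normSq s + Complex.normSq t = 0 := by exact_mod_cast h4
  have hs := Complex.normSq_nonneg s
  have ht := Complex.normSq_nonneg t
  exact ⟨Complex.normSq_eq_zero.1 (by linarith), Complex.normSq_eq_zero.1 (by linarith)⟩

/-- The space of solutions of `2 𝒟^{AA'} 𝒟_{A'B} λ^B = c λ^A`. -/
def eigenSub (S : SpinStructure D ι) (c : ℂ) : Submodule ℂ (SpinorField S) :=
  LinearMap.ker (adjField S ∘ₗ senField S - c • LinearMap.id)

lemma mem_eigenSub {c : ℂ} : f ∈ eigenSub S c ↔ adjField S (senField S f) = c • f := by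
  simp [eigenSub, sub_eq_zero]

lemma even_finrank_eigenSub (hα : α ≠ 0) [FiniteDimensional ℂ (eigenSub S ((α : ℂ) ^ 2))] :
    Even (Module.finrank ℂ (eigenSub S ((α : ℂ) ^ 2))) := by
  refine even_finrank_of_quaternionic
    ⟨⟨fun f => ⟨partner S α f.1, mem_eigenSub.2 (partner_eigen hα (mem_eigenSub.1 f.2))⟩,
      fun f h => Subtype.ext (map_add (partner S α) f.1 h.1)⟩,
      fun c f => Subtype.ext (LinearMap.map_smulₛₗ (partner S α) c f.1)⟩ ?_
  intro f
  exact Subtype.ext (partner_partner hα (mem_eigenSub.1 f.2))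

end Spectrum

end SenWitten

end

/-! ### Assembly of the four claims -/

theorem mainTheorem3 {M : Type*} [TopologicalSpace M] [T2Space M] [CompactSpace M]
    [ChartedSpace SenWitten.E3 M] [IsManifold 𝓘(ℝ, SenWitten.E3) ∞ M]
    (D : SenWitten.InitialData M) {ι : Type*} (S : SenWitten.SpinStructure D ι) :
    -- the eigenvalues of the Sen–Witten operator (on Dirac spinors) are real, and the unprimed part
    -- solves the eigenvalue equation of the squared operator
    (∀ (α : ℂ) (f m : SenWitten.SpinorField S), (f ≠ 0 ∨ m ≠ 0) →
      SenWitten.SolvesDiracEq S α f m →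
        α.im = 0 ∧ SenWitten.SolvesEigenEq S (α ^ 2) f) ∧
    -- the eigenvalues of its square are real and nonnegative, i.e. of the form `α ^ 2`
    (∀ (c : ℂ) (f : SenWitten.SpinorField S), SenWitten.IsEigenspinor S c f →
      ∃ α : ℝ, c = (α : ℂ) ^ 2) ∧
    -- the partner of an eigenspinor forms a Dirac eigenspinor with it, and is a linearly independent eigenspinor
    (∀ (α : ℝ), α ≠ 0 → ∀ f : SenWitten.SpinorField S,
      SenWitten.IsEigenspinor S ((α : ℂ) ^ 2) f →
      ∃ m : SenWitten.SpinorField S, SenWitten.IsPartner S α f m ∧ SenWitten.SolvesDiracEq S α f m ∧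
        SenWitten.IsEigenspinor S ((α : ℂ) ^ 2) m ∧ LinearIndependent ℂ ![f, m]) ∧
    -- the eigenspace of a nonzero eigenvalue has finite even dimension
    (∀ c : ℂ, c ≠ 0 → (∃ f : SenWitten.SpinorField S, SenWitten.IsEigenspinor S c f) →
      ∃ V : Submodule ℂ (SenWitten.SpinorField S),
        (∀ f, f ∈ V ↔ SenWitten.SolvesEigenEq S c f) ∧
        FiniteDimensional ℂ V ∧ Even (Module.finrank ℂ V)) := by
  open SenWitten in
  obtain ⟨C⟩ := exists_patchCover S
  refine ⟨?_, ?_, ?_, ?_⟩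
  · intro α f m hne h
    obtain ⟨h1, h2⟩ := (solvesDiracEq_iff α f m).1 h
    obtain ⟨h3, h4⟩ := dirac_eigen hne C h1 h2
    exact ⟨h3, (solvesEigenEq_iff _ f).2 h4⟩
  · rintro c f ⟨hf, h⟩
    exact ⟨_, eigenvalue_eq C hf ((solvesEigenEq_iff c f).1 h)⟩
  · rintro α hα f ⟨hf, h⟩
    have h' := (solvesEigenEq_iff _ f).1 h
    have hli := linearIndependent_partner hα hf h'
    refine ⟨partner S α f, (isPartner_iff hα f _).2 rfl, (solvesDiracEq_iff _ _ _).2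
      ⟨ccField_partner hα, ?_⟩, ⟨hli.ne_zero 1, (solvesEigenEq_iff _ _).2 (partner_eigen hα h')⟩, hli⟩
    rw [senField_partner hα h', smul_smul, Complex.conj_ofReal]
    congr 1
    linear_combination (-α : ℂ) * Complex.I_mul_I
  · rintro c hc ⟨f, hf, h⟩
    have hcα := eigenvalue_eq C hf ((solvesEigenEq_iff c f).1 h)
    have hα : √c.re ≠ 0 := fun h0 => hc (by rw [hcα, h0]; simp)
    rw [hcα]
    -- On the eigenspace the required bound for `‖Af‖²` is the equality `ip_senField_self`.
    have hfd : FiniteDimensional ℂ (eigenSub S (((√c.re : ℝ) : ℂ) ^ 2)) :=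
      finiteDimensional_of_senField_le C (c := ((((√c.re : ℝ) : ℂ) ^ 2)).re) _
        fun f hf => (ip_senField_self (C := C) (mem_eigenSub.1 hf)).le
    exact ⟨eigenSub S _, fun f => mem_eigenSub.trans (solvesEigenEq_iff _ f).symm, hfd,
      even_finrank_eigenSub hα⟩
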